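/- **Notation.** Let $\sigma(A)=-B^{-1}A^{T}B$ be the automorphism of order four of $\mathfrak{sl}_3(\mathbb C)$ given by $B=E_{13}+E_{22}-E_{31}$, and let $\mathfrak{Cg}$ be the hyperspecial twisted current algebra of type $A_2^{(2)}$, realized as the Lie algebra of all $A(t)\in\mathfrak{sl}_3(\mathbb C[t])$ with $\sigma(A(t))=A(it)$, graded by the degree in $t$. Its degree zero part is $\mathfrak g=\mathfrak{sl}_2$ with basis $E_{13}$, $y_0=E_{31}$, $h_0=E_{11}-E_{33}$. For $r\in\mathbb Z_{\ge 0}$ put $y_{2r}=E_{31}t^{4r}$ and $y_{r+1/2}=(E_{21}+i^{2r+1}E_{32})t^{2r+1}$. Let $\mathfrak{Cn}^+$ be the subalgebra of strictly upper triangular elements and $\mathfrak{Ch}_+$ the space of diagonal elements without constant term. Let $\mathbf U=\mathbf U(\mathfrak{Cg})$, $y^{(b)}=y^b/b!$ and $a_+=\max\{a,0\}$. For integers $m\ge 1$, $n\ge 0$ write $n=n_1m+n_0$ with $n_1\in\mathbb Z$, $0<n_0\le m$. Let $D(m,n)$ be the graded $\mathfrak{Cg}$-module generated by an element $v_n$ of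 degree $0$ with defining relations $$(\mathfrak{Cn}^+\oplus\mathfrak{Ch}_+)v_n=0,\quad h_0v_n=nv_n,\quad y_0^{n+1}v_n=0,$$ $$y_{2n_1+2}v_n=0,\quad y_{n_1+\frac32}v_n=0\quad\text{if } m>1,$$ $$y_{2n_1}^{n_0+1}v_n=0,\quad y_{n_1+\frac12}^{(2n_0-m)_++1}v_n=0\quad\text{if } n_0<m.$$ A graded $\mathfrak{Cg}$-module $V$ *admits a level $m$ Demazure flag* if it has a finite chain $0=F_0\subset F_1\subset\dots\subset F_N=V$ of graded submodules such that each $F_{j+1}/F_j$ is isomorphic, as a graded module, to some $D(m,n)$, $n\ge 0$, with its grading shifted so that its generator has some degree $s\ge 0$. For $\ell\ge 1$ let $\mathcal P_\ell$ be the set of partitions $$\xi=(\xi_0\ge\xi_1\ge\dots\ge\xi_\ell>0),\qquad (\xi_1,\dots,\xi_{\ell-1})=\big((x+1)^{\ell-1-p},x^{p}\big)$$ for some integers $x$ and $p$, where $p=0$ if $\ell=1$, and $1\le p\le\ell-1$ if $\ell>1$. Put $|\xi|=\xi_1+\dots+\xi_\ell=n$, and let $V(\xi)$ be the graded quotient of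 $D(1,n)$ by the submodule generated by $$y_{2\ell}v_n,\quad y_{\ell+\frac12}v_n,\quad y_{2\ell-2}^{(\xi_\ell+1)}v_n\ \text{ if } \xi_\ell+1<\xi_{\ell-1},\quad y_{\ell-\frac12}^{((2\xi_\ell-\xi_{\ell-1})_++1)}v_n\ \text{ if } \xi_\ell<\xi_{\ell-1}.$$ **Theorem.** Let $\xi\in\mathcal P_\ell$, with $p$ as above. 1. There is an isomorphism of $\mathfrak{sl}_2$-modules $$V(\xi)\cong D(\xi_1,\xi_1)^{\otimes(\ell-1-p)}\otimes D(\xi_{\ell-1},\xi_{\ell-1})^{\otimes p}\otimes D(\xi_{\ell-1},\xi_\ell),$$ and $$\dim V(\xi)=\binom{\xi_1+2}{2}^{\ell-1-p}\binom{\xi_{\ell-1}+2}{2}^{p}\Big((\xi_\ell+1)+\tfrac12(2\xi_\ell-\xi_{\ell-1})_+(\xi_{\ell-1}+1)\Big).$$ 2. $V(\xi)$ admits a level $m$ Demazure flag for every integer $m\ge\xi_0$. If moreover $\xi_0$ is normalized, that is, $\xi_0=\xi_1$ if $\ell>1$, and $\xi_0\le 2\xi_1$ if $\ell=1$, then for every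 integer $m\ge 1$ the module $V(\xi)$ admits a level $m$ Demazure flag if and only if $m\ge\xi_0$. -/

import Mathlib

open scoped TensorProduct Polynomial

noncomputable section

namespace HyperspecialA22

attribute [local instance] LieRing.ofAssociativeRing

/-! ### The hyperspecial twisted current algebra of type `A₂⁽²⁾` -/

/-- The bilinear form on `ℂ³` (extended to `ℂ[t]³`) that is symplectic on the span of the first and
the third basis vector and symmetric on the second one. The map `σ A = - B⁻¹ Aᵀ B` is an
automorphism of order four of `sl₃`. -/
def formB : Matrix (Fin 3) (Fin 3) ℂ[X] := !![0, 0, 1; 0, 1, 0; -1, 0, 0]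

/-- The substitution `A(t) ↦ A(i t)` on matrices of polynomials. -/
def rot : Matrix (Fin 3) (Fin 3) ℂ[X] →ₐ[ℂ] Matrix (Fin 3) (Fin 3) ℂ[X] :=
  (Polynomial.aeval (Polynomial.C Complex.I * Polynomial.X : ℂ[X])).mapMatrix

/-- The twisted current algebra: the trace zero matrices `A(t)` over `ℂ[t]` such that
`σ (A(t)) = A(i t)`, i.e. the coefficient of `t ^ k` lies in the `i ^ k`-eigenspace of `σ`.
Its elements of degree `4k`, `2k+1`, `4k+2` are `sl₂ ⊗ t^(4k)` (`sl₂` in the corners of the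
matrix), the two-dimensional space of root vectors for `±α/2 + (k+1/2)δ`, and the line
`diag(1,-2,1) t^(4k+2)`; together these are `h ⊕ n̂⁺ ⊕ n⁻` inside the affine algebra. -/
def currentAlg : LieSubalgebra ℂ (Matrix (Fin 3) (Fin 3) ℂ[X]) where
  carrier := {A | A.trace = 0 ∧ A.transpose * formB = -(formB * rot A)}
  zero_mem' := by simp
  add_mem' := by
    rintro A C ⟨hA, hA'⟩ ⟨hC, hC'⟩
    refine ⟨by rw [Matrix.trace_add, hA, hC, add_zero], ?_⟩
    rw [Matrix.transpose_add, add_mul, hA', hC', map_add, mul_add, neg_add]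
  smul_mem' := by
    rintro c A ⟨hA, hA'⟩
    refine ⟨by rw [Matrix.trace_smul, hA, smul_zero], ?_⟩
    rw [Matrix.transpose_smul, smul_mul_assoc, hA', map_smul, mul_smul_comm, smul_neg]
  lie_mem' := by
    rintro A C ⟨hA, hA'⟩ ⟨hC, hC'⟩
    refine ⟨?_, ?_⟩
    · rw [LieRing.of_associative_ring_bracket, Matrix.trace_sub, Matrix.trace_mul_comm, sub_self]
    · rw [LieRing.of_associative_ring_bracket, Matrix.transpose_sub, Matrix.transpose_mul,
        Matrix.transpose_mul, sub_mul, mul_assoc, mul_assoc, hA', hC', mul_neg, mul_neg,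
        ← mul_assoc, ← mul_assoc, hA', hC', map_sub, map_mul, map_mul, mul_sub, neg_mul, neg_mul,
        neg_neg, neg_neg, mul_assoc, mul_assoc, neg_sub]

/-- Membership in `currentAlg`, entry by entry. -/
theorem mem_currentAlg {A : Matrix (Fin 3) (Fin 3) ℂ[X]} :
    A ∈ currentAlg ↔ A 0 0 + A 1 1 + A 2 2 = 0 ∧
      ∀ s, s = Polynomial.aeval (R := ℂ) (Polynomial.C Complex.I * Polynomial.X : ℂ[X]) →
        A 2 0 = s (A 2 0) ∧ A 1 0 = -s (A 2 1) ∧ A 0 0 = -s (A 2 2) ∧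
        A 2 1 = s (A 1 0) ∧ A 1 1 = -s (A 1 1) ∧ A 0 1 = -s (A 1 2) ∧
        A 2 2 = -s (A 0 0) ∧ A 1 2 = s (A 0 1) ∧ A 0 2 = s (A 0 2) := by
  change (A.trace = 0 ∧ A.transpose * formB = -(formB * rot A)) ↔ _
  rw [Matrix.trace_fin_three, ← Matrix.ext_iff]
  refine and_congr_right fun _ => ?_
  simp only [forall_eq, Fin.forall_fin_succ, Matrix.mul_apply, Fin.sum_univ_three, formB, rot,
    Matrix.neg_apply, Matrix.transpose_apply, AlgHom.mapMatrix_apply, Matrix.map_apply]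
  simp [and_assoc, neg_eq_iff_eq_neg]

/-- The Lie algebra `𝔠𝔤`. -/
abbrev CG : Type := currentAlg

/-- The universal enveloping algebra `U = U(𝔠𝔤)`. -/
abbrev U : Type := UniversalEnvelopingAlgebra ℂ CG

/-- The inclusion `𝔠𝔤 → U`. -/
abbrev toU (z : CG) : U := UniversalEnvelopingAlgebra.ι ℂ z

/-- The element `y_{2r}` (root `-α + 2rδ`): `E₃₁ t^(4r)`. -/
def yEven (r : ℕ) : CG :=
  ⟨!![0, 0, 0; 0, 0, 0; Polynomial.X ^ (4 * r), 0, 0], by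
    have h4 : (Polynomial.C Complex.I ^ 4 : ℂ[X]) = 1 := by
      rw [← Polynomial.C_pow, Complex.I_pow_four, Polynomial.C_1]
    rw [mem_currentAlg]
    refine ⟨by simp, ?_⟩
    rintro s rfl
    simp [map_pow, mul_pow, pow_mul, h4]⟩

/-- The element `y_{r+1/2}` (root `-α/2 + (r+1/2)δ`): `(E₂₁ + i^(2r+1) E₃₂) t^(2r+1)`. -/
def yOdd (r : ℕ) : CG :=
  ⟨!![0, 0, 0; Polynomial.X ^ (2 * r + 1), 0, 0;
      0, Polynomial.C (Complex.I ^ (2 * r + 1)) * Polynomial.X ^ (2 * r + 1), 0], by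
    rw [mem_currentAlg]
    refine ⟨by simp, ?_⟩
    rintro s rfl
    have h : (Complex.I ^ (2 * r + 1)) * Complex.I ^ (2 * r + 1) = -1 := by
      rw [← mul_pow, Complex.I_mul_I, pow_succ, pow_mul]; simp
    have hh : (Polynomial.C Complex.I ^ (2 * r + 1) * Polynomial.C Complex.I ^ (2 * r + 1) :
        ℂ[X]) = -1 := by
      rw [← Polynomial.C_pow, ← Polynomial.C_mul, h]; simp
    simp [mul_pow, ← mul_assoc, hh]⟩

/-- A two by two matrix placed in the corners of a three by three matrix. -/
def corner (a : Matrix (Fin 2) (Fin 2) ℂ) : Matrix (Fin 3) (Fin 3) ℂ[X] :=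
  !![Polynomial.C (a 0 0), 0, Polynomial.C (a 0 1); 0, 0, 0;
      Polynomial.C (a 1 0), 0, Polynomial.C (a 1 1)]

theorem corner_lie (a b : Matrix (Fin 2) (Fin 2) ℂ) :
    corner (a * b - b * a) = corner a * corner b - corner b * corner a := by
  ext1 i j
  fin_cases i <;> fin_cases j <;>
    simp [corner, Matrix.mul_apply, Fin.sum_univ_two]

/-- The embedding of `𝔤 = sl₂` as the degree zero part of `𝔠𝔤`, in the corners of the matrix. -/
def slIncl : LieAlgebra.SpecialLinear.sl (Fin 2) ℂ →ₗ⁅ℂ⁆ CG where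
  toFun a := ⟨corner a.1, by
    have ht : a.1 0 0 + a.1 1 1 = 0 := by
      rw [← Matrix.trace_fin_two]; exact a.2
    have h0 : a.1 0 0 = -a.1 1 1 := eq_neg_of_add_eq_zero_left ht
    rw [mem_currentAlg]
    refine ⟨by simp [corner, h0], ?_⟩
    rintro s rfl
    simp [corner, h0]⟩
  map_add' a b := by
    ext i j; fin_cases i <;> fin_cases j <;> simp [corner]
  map_smul' c a := by
    ext i j; fin_cases i <;> fin_cases j <;> simp [corner, Polynomial.smul_C]
  map_lie' {a b} := by
    exact Subtype.ext (corner_lie a.1 b.1)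

/-- The element `h₀ = E₁₁ - E₃₃`. -/
def h0 : CG :=
  ⟨!![1, 0, 0; 0, 0, 0; 0, 0, -1], by
    rw [mem_currentAlg]
    refine ⟨by simp, ?_⟩
    rintro s rfl
    simp⟩

/-- `𝔠𝔫⁺`: the strictly upper triangular elements of `𝔠𝔤`. -/
def nPlus : Set CG := {A | ∀ i j, j ≤ i → A.1 i j = 0}

/-- `𝔠𝔥₊`: the diagonal elements of `𝔠𝔤` without constant term. -/
def hPlus : Set CG := {A | (∀ i j, i ≠ j → A.1 i j = 0) ∧ ∀ i, (A.1 i i).coeff 0 = 0}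

/-! ### Gradings -/

/-- The elements of `𝔠𝔤` that are homogeneous of degree `d` in `t`. -/
def CGdeg (d : ℕ) : Set CG := {A | ∀ i j k, k ≠ d → (A.1 i j).coeff k = 0}

/-- The component of degree `k` of `U`, spanned by the products of homogeneous elements of `𝔠𝔤`
with degrees adding up to `k`. -/
def Udeg (k : ℤ) : Submodule ℂ U :=
  Submodule.span ℂ {u | ∃ w : List (ℕ × CG), (∀ a ∈ w, a.2 ∈ CGdeg a.1) ∧
    (((w.map Prod.fst).sum : ℕ) : ℤ) = k ∧ u = (w.map fun a => toU a.2).prod}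

/-! ### The modules `D(m,n)` -/

/-- For `m ≥ 1` write `n = n₁ m + n₀` with `n₁ ∈ ℤ` and `0 < n₀ ≤ m`. This is `n₁ + 1 = ⌈n/m⌉`,
a natural number. -/
def quo (m n : ℕ) : ℕ := (n + m - 1) / m

/-- The number `n₀ = n - n₁ m = n + m - (n₁ + 1) m`. -/
def rmd (m n : ℕ) : ℕ := n + m - quo m n * m

/-- The elements of `U` that annihilate the generator `v_n` of `D(m,n)` by definition. With
`q = n₁ + 1` the elements `y_{2n₁+2}`, `y_{n₁+3/2}`, `y_{2n₁}`, `y_{n₁+1/2}` are `yEven q`, `yOdd q`,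
`yEven (q-1)`, `yOdd (q-1)`; here `q ≥ 1` as soon as `n₀ < m`. -/
def demazureRel (m n : ℕ) : Set U :=
  {u | ∃ z ∈ nPlus ∪ hPlus, u = toU z} ∪
  {toU h0 - algebraMap ℂ U n, toU (yEven 0) ^ (n + 1)} ∪
  {u | 1 < m ∧ (u = toU (yEven (quo m n)) ∨ u = toU (yOdd (quo m n)))} ∪
  {u | rmd m n < m ∧ (u = toU (yEven (quo m n - 1)) ^ (rmd m n + 1) ∨
    u = toU (yOdd (quo m n - 1)) ^ ((2 * rmd m n - m) + 1))}

/-- The module `D(m,n)`: the cyclic `U`-module with these defining relations. -/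
abbrev D (m n : ℕ) : Type := U ⧸ (Submodule.span U (demazureRel m n) : Submodule U U)

/-- The generator `v_n` of `D(m,n)`. -/
def vgen (m n : ℕ) : D m n := Submodule.Quotient.mk 1

/-- The grading of `D(m,n)`, with the generator in degree zero. -/
def Ddeg (m n : ℕ) (k : ℤ) : Submodule ℂ (D m n) :=
  (Udeg k).map ((Submodule.span U (demazureRel m n)).mkQ.restrictScalars ℂ)

/-! ### Partitions and the modules `V(ξ)` -/

/-- The set of partitions `ξ = (ξ₀ ≥ (x+1)^(ℓ-1-p) ≥ x^p ≥ ξ_ℓ > 0)` of length `ℓ + 1`, where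
`p = 0` if `ℓ = 1`, and `1 ≤ p ≤ ℓ - 1` if `ℓ > 1`. -/
structure IsPart (ℓ p : ℕ) (ξ : ℕ → ℕ) : Prop where
  range_p : (ℓ = 1 ∧ p = 0) ∨ (1 < ℓ ∧ 1 ≤ p ∧ p ≤ ℓ - 1)
  anti : Antitone ξ
  pos : 0 < ξ ℓ
  zero : ∀ j, ℓ < j → ξ j = 0
  form : ∃ x : ℕ, (∀ j, 1 ≤ j → j ≤ ℓ - 1 - p → ξ j = x + 1) ∧
    (∀ j, ℓ - 1 - p < j → j ≤ ℓ - 1 → ξ j = x)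

/-- `|ξ|`, the sum of the parts `ξ₁, …, ξ_ℓ`. -/
def size (ℓ : ℕ) (ξ : ℕ → ℕ) : ℕ := ∑ j ∈ Finset.Icc 1 ℓ, ξ j

/-- The divided power `z^(b) = z^b / b!` in `U`. -/
def divPow (z : CG) (b : ℕ) : U := ((b.factorial : ℂ)⁻¹) • toU z ^ b

/-- The vectors of `D(1,|ξ|)` that are killed in `V(ξ)`; the number `2 φ(ξ;ℓ-1)` is
`(2 ξ_ℓ - ξ_{ℓ-1})₊`, a truncated difference. -/
def vRel (ℓ : ℕ) (ξ : ℕ → ℕ) : Set (D 1 (size ℓ ξ)) :=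
  {toU (yEven ℓ) • vgen 1 (size ℓ ξ), toU (yOdd ℓ) • vgen 1 (size ℓ ξ)} ∪
  {w | ξ ℓ + 1 < ξ (ℓ - 1) ∧ w = divPow (yEven (ℓ - 1)) (ξ ℓ + 1) • vgen 1 (size ℓ ξ)} ∪
  {w | ξ ℓ < ξ (ℓ - 1) ∧
    w = divPow (yOdd (ℓ - 1)) ((2 * ξ ℓ - ξ (ℓ - 1)) + 1) • vgen 1 (size ℓ ξ)}

/-- The module `V(ξ)`. -/
abbrev V (ℓ : ℕ) (ξ : ℕ → ℕ) : Type := D 1 (size ℓ ξ) ⧸ Submodule.span U (vRel ℓ ξ)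

/-- The grading of `V(ξ)`, as a quotient of `D(1,|ξ|)`. -/
def Vdeg (ℓ : ℕ) (ξ : ℕ → ℕ) (k : ℤ) : Submodule ℂ (V ℓ ξ) :=
  (Ddeg 1 (size ℓ ξ) k).map ((Submodule.span U (vRel ℓ ξ)).mkQ.restrictScalars ℂ)

/-! ### Demazure flags -/

section Flags

variable {M : Type} [AddCommGroup M] [Module U M] [Module ℂ M] [IsScalarTower ℂ U M]

/-- A submodule of a graded module is graded if it is spanned by its homogeneous elements. -/
def IsGradedSub (gr : ℤ → Submodule ℂ M) (N : Submodule U M) : Prop :=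
  N.restrictScalars ℂ = ⨆ k, N.restrictScalars ℂ ⊓ gr k

/-- The component of degree `k` of the subquotient `N / N'`, for `N' ≤ N`. -/
def subquoDeg (gr : ℤ → Submodule ℂ M) (N' N : Submodule U M) (k : ℤ) :
    Submodule ℂ (N ⧸ N'.submoduleOf N) :=
  ((gr k).comap (N.subtype.restrictScalars ℂ)).map ((N'.submoduleOf N).mkQ.restrictScalars ℂ)

/-- The graded module `M` admits a Demazure flag of level `m`: a finite chain of graded submodules
from `0` to `M` in which each successive quotient is, for some `n, s ≥ 0`, isomorphic to `D(m,n)`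
shifted so that its generator has degree `s`. -/
def HasDemazureFlag (gr : ℤ → Submodule ℂ M) (m : ℕ) : Prop :=
  ∃ (N : ℕ) (F : ℕ → Submodule U M), F 0 = ⊥ ∧ F N = ⊤ ∧ (∀ j ≤ N, IsGradedSub gr (F j)) ∧
    ∀ j < N, F j ≤ F (j + 1) ∧
      ∃ (n s : ℕ) (e : (F (j + 1) ⧸ (F j).submoduleOf (F (j + 1))) ≃ₗ[U] D m n),
        ∀ k : ℤ, (subquoDeg gr (F j) (F (j + 1)) k).map (e.toLinearMap.restrictScalars ℂ) =
          Ddeg m n (k - s)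

end Flags

/-! ### `sl₂`-modules -/

/-- The Lie algebra `𝔤 = sl₂`. -/
abbrev sl2 : Type := LieAlgebra.SpecialLinear.sl (Fin 2) ℂ

/-- Bundled `sl₂`-modules. -/
structure SlMod where
  carrier : Type
  [addCommGroup : AddCommGroup carrier]
  [module : Module ℂ carrier]
  [lieRingModule : LieRingModule sl2 carrier]
  [lieModule : LieModule ℂ sl2 carrier]

attribute [instance] SlMod.addCommGroup SlMod.module SlMod.lieRingModule SlMod.lieModule

/-- The restriction of a `U`-module to `sl₂`. -/
def resSl (M : Type) [AddCommGroup M] [Module U M] [Module ℂ M] [IsScalarTower ℂ U M] : SlMod :=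
  letI : LieRingModule sl2 M :=
    { bracket := fun a w => toU (slIncl a) • w
      add_lie := fun a b w => by
        change toU (slIncl (a + b)) • w = toU (slIncl a) • w + toU (slIncl b) • w
        rw [toU, map_add, map_add, add_smul]
      lie_add := fun a w w' => smul_add _ w w'
      leibniz_lie := fun a b w => by
        change toU (slIncl a) • toU (slIncl b) • w =
          toU (slIncl ⁅a, b⁆) • w + toU (slIncl b) • toU (slIncl a) • w
        rw [toU, toU, toU, LieHom.map_lie, LieHom.map_lie, LieRing.of_associative_ring_bracket,
          sub_smul, mul_smul, mul_smul, sub_add_cancel] }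
  letI : LieModule ℂ sl2 M :=
    { smul_lie := fun c a w => by
        change toU (slIncl (c • a)) • w = c • toU (slIncl a) • w
        rw [toU, map_smul, map_smul, smul_assoc]
      lie_smul := fun c a w => by
        change toU (slIncl a) • c • w = c • toU (slIncl a) • w
        rw [← algebraMap_smul U c w, ← algebraMap_smul U c (toU (slIncl a) • w), smul_smul, smul_smul,
          Algebra.commutes] }
  ⟨M⟩

/-- The tensor product of two `sl₂`-modules. -/
def SlMod.tensor (A B : SlMod) : SlMod := ⟨A.carrier ⊗[ℂ] B.carrier⟩

/-- The trivial one-dimensional `sl₂`-module. -/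
def SlMod.triv : SlMod :=
  letI : LieRingModule sl2 ℂ :=
    { bracket := fun _ _ => 0
      add_lie := fun _ _ _ => (add_zero 0).symm
      lie_add := fun _ _ _ => (add_zero 0).symm
      leibniz_lie := fun _ _ _ => (add_zero 0).symm }
  letI : LieModule ℂ sl2 ℂ :=
    { smul_lie := fun c _ _ => (smul_zero c).symm
      lie_smul := fun c _ _ => (smul_zero c).symm }
  ⟨ℂ⟩

/-- The tensor power `A^{⊗ k}`. -/
def SlMod.tpow (A : SlMod) : ℕ → SlMod
  | 0 => SlMod.triv
  | k + 1 => (A.tpow k).tensor A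

/-- Isomorphism of `sl₂`-modules. -/
def SlMod.Iso (A B : SlMod) : Prop := Nonempty (A.carrier ≃ₗ⁅ℂ, sl2⁆ B.carrier)

end HyperspecialA22

end

open scoped TensorProduct Polynomial

noncomputable section

namespace HyperspecialA22

attribute [local instance] LieRing.ofAssociativeRing

/-! ### A basis of the twisted current algebra and its brackets. -/

section

open Polynomial

/-! All modules involved are cyclic and of one shape. A state `(x, a, p, y)` stands for the
partition `((x+1)^a, x^p, y)`. Its left ideal `stI x a p y` consists of the relations of a highest
weight vector `v` of weight `n = a(x+1) + px + y` that is killed by `yOdd j` and `yEven j` for `j >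
k = a + p`, by `E^(y+1)` and by `O^((2y-x)₊+1)`, where `O = yOdd k` and `E = yEven k` are the
extreme surviving lowering operators. `V(ξ)` is the state with `x = ξ_{ℓ-1}`, `a = ℓ-1-p`, `y = ξ_ℓ`
(`IsPart.ann_wgen`), and for `n > 0` the module `D(m,n)` is the state `(m, 0, n₁, n₀)`
(`span_demazureRel`).

Extensions. Moving a box from the last part `y > 0` to a part `x` keeps the weight and gives a
quotient of the state. The kernel is generated by a power of `E` or by one or two powers of `O`
applied to `v`, and each of these vectors satisfies the relations of a state of smaller weight with
last part `x - y`. When no part `x` is left, `x` is raised to `x + 1` in the same manner. Iteration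
reduces a state to Demazure modules of level `m`, provided `x ≤ m`, and `x < m` if `a > 0`
(`flt_state`). The relations come from the vanishing of monomials `E^b O^c v`: the components of the
exponential of the generating series of the lowering operators kill `v` once the drop in weight plus
the degree is even and exceeds `2n` (`coeff_garland_smul_eq_zero`), and after normal ordering such a
component has a nonzero multiple of `E^b O^c v` as its leading term (`coeff_garland_mon`,
`mon_eq_zero`).

Dimensions. For very large `m` the level `m` leaves are irreducible `sl₂`-modules, which bounds
every state from above by an explicit character `ch` (`spanned_state`). For the local Weyl module of
weight `n` the bound is `3^n`. It is attained: the tensor product of `n` evaluation modules `ℂ³` at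
points `s a_i` is cyclic at `s = 1`, and its lattice degenerates at `s = 0` to a quotient of the
local Weyl module (`three_pow_le_finrank`). Sharpness passes from the middle of an extension to both
ends (`Ext.isExact`), and every state with `x > 0` is obtained from a local Weyl module by repeated
passage to such quotients, so all bounds are sharp (`isExact_state`). Hence the extensions are short
exact sequences and the reductions are honest flags (`Flt.exists_flag`).

The character `ch` is a product, namely that of the tensor product in the first part, and
finite-dimensional weight modules over `sl₂` are determined by their characters
(`nonempty_equiv_of_finrank_wtSpace`). Conversely, the top quotient of a level `m` flag of `V(ξ)` is
`D(m,n)` with `n = |ξ|`, so `dim D(m,n) ≤ dim V(ξ)` (`exists_stDim_le_of_flag`). Since kernels of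
extensions are nonzero, dimensions of states of a fixed weight drop strictly along them, which
excludes `m < ξ_0` when `ξ_0` is normalized (`stDim_le`, `stDim_lt_of_two_mul`). -/

theorem I_odd_mul_self (k : ℕ) :
    (Complex.I ^ (2 * k + 1)) * Complex.I ^ (2 * k + 1) = -1 := by
  rw [← mul_pow, Complex.I_mul_I, pow_succ, pow_mul]; simp

theorem C_I_pow_four : (C Complex.I ^ 4 : ℂ[X]) = 1 := by
  rw [← C_pow, Complex.I_pow_four, C_1]

/-- The element `E₁₃ t^(4k)`. -/
def xEven (k : ℕ) : CG :=
  ⟨!![0, 0, X ^ (4 * k); 0, 0, 0; 0, 0, 0], by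
    rw [mem_currentAlg]
    refine ⟨by simp, ?_⟩
    rintro s rfl
    simp [map_pow, mul_pow, pow_mul, C_I_pow_four]⟩

/-- The element `(E₁₂ + i^(2k+1) E₂₃) t^(2k+1)`. -/
def xOdd (k : ℕ) : CG :=
  ⟨!![0, X ^ (2 * k + 1), 0; 0, 0, C (Complex.I ^ (2 * k + 1)) * X ^ (2 * k + 1); 0, 0, 0], by
    rw [mem_currentAlg]
    refine ⟨by simp, ?_⟩
    rintro s rfl
    have hh : (C Complex.I ^ (2 * k + 1) * C Complex.I ^ (2 * k + 1) : ℂ[X]) = -1 := by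
      rw [← C_pow, ← C_mul, I_odd_mul_self]; simp
    simp [mul_pow, ← mul_assoc, hh]⟩

/-- The diagonal element of degree `2j`: `diag(1,0,-1) t^(2j)` for even `j` and
`diag(1,-2,1) t^(2j)` for odd `j`. -/
def hDiag (j : ℕ) : CG :=
  ⟨!![X ^ (2 * j), 0, 0; 0, C ((-1) ^ j - 1) * X ^ (2 * j), 0;
      0, 0, C (-(-1) ^ j) * X ^ (2 * j)], by
    rw [mem_currentAlg]
    refine ⟨by simp; ring, ?_⟩
    rintro s rfl
    have h : (C Complex.I ^ (2 * j) : ℂ[X]) = (-1) ^ j := by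
      rw [pow_mul, ← C_pow, Complex.I_sq]; simp
    rcases Nat.even_or_odd j with hj | hj <;> simp [mul_pow, h, hj.neg_one_pow]⟩

theorem C_two_eq : (C 2 : ℂ[X]) = 2 := rfl

theorem CG_ext {A B : CG} (h : ∀ i j, A.1 i j = B.1 i j) : A = B :=
  Subtype.ext (Matrix.ext h)

theorem lie_val (A B : CG) : (⁅A, B⁆ : CG).1 = A.1 * B.1 - B.1 * A.1 := rfl

theorem lie_hDiag_yOdd (j k : ℕ) :
    ⁅hDiag j, yOdd k⁆ = (-(2 - (-1) ^ j) : ℂ) • yOdd (k + j) := by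
  apply CG_ext
  have h : (Complex.I ^ (2 * (k + j) + 1)) = (-1) ^ j * Complex.I ^ (2 * k + 1) := by
    rw [show 2 * (k + j) + 1 = 2 * j + (2 * k + 1) by ring, pow_add, pow_mul, Complex.I_sq]
  intro a b
  rw [lie_val]
  rcases Nat.even_or_odd j with hj | hj <;> fin_cases a <;> fin_cases b <;>
    simp [hDiag, yOdd, hj.neg_one_pow, smul_eq_C_mul, C_two_eq, h] <;>
    ring

theorem lie_hDiag_even_yEven (j k : ℕ) :
    ⁅hDiag (2 * j), yEven k⁆ = (-2 : ℂ) • yEven (k + j) := by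
  apply CG_ext
  intro a b
  rw [lie_val]
  fin_cases a <;> fin_cases b <;>
    simp [hDiag, yEven, smul_eq_C_mul, C_two_eq, pow_mul]
  ring

/-- The first and third diagonal entries of `hDiag (2 * j + 1)` agree, so the root `-α` vanishes on
it. -/
theorem lie_hDiag_odd_yEven (j k : ℕ) : ⁅hDiag (2 * j + 1), yEven k⁆ = 0 := by
  apply CG_ext
  intro a b
  rw [lie_val]
  fin_cases a <;> fin_cases b <;>
    simp [hDiag, yEven, pow_succ, pow_mul]
  ring

theorem lie_xOdd_yOdd (j k : ℕ) : ⁅xOdd j, yOdd k⁆ = hDiag (j + k + 1) := by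
  apply CG_ext
  have h : (C Complex.I ^ (2 * j + 1) * C Complex.I ^ (2 * k + 1) : ℂ[X]) =
      (-1) ^ (j + k + 1) := by
    rw [← pow_add, show 2 * j + 1 + (2 * k + 1) = 2 * (j + k + 1) by ring, pow_mul, ← C_pow,
      Complex.I_sq]; simp
  intro a b
  rw [lie_val]
  fin_cases a <;> fin_cases b <;>
    simp [hDiag, xOdd, yOdd]
  · ring
  · linear_combination (X ^ (2 * j + 1 + (2 * k + 1))) * h
  · linear_combination (X ^ (2 * j + 1 + (2 * k + 1))) * h

theorem lie_xOdd_yEven (j k : ℕ) :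
    ⁅xOdd j, yEven k⁆ = (Complex.I ^ (2 * j + 1)) • yOdd (j + 2 * k) := by
  apply CG_ext
  have h := I_odd_mul_self j
  have h' : (C Complex.I ^ (2 * j + 1) * C Complex.I ^ (2 * j + 1) : ℂ[X]) = -1 := by
      rw [← C_pow, ← C_mul, h]; simp
  have h2 : (C Complex.I ^ (2 * (j + 2 * k) + 1) : ℂ[X]) = C Complex.I ^ (2 * j + 1) := by
    rw [show 2 * (j + 2 * k) + 1 = 4 * k + (2 * j + 1) by ring, pow_add, pow_mul, C_I_pow_four]
    simp
  intro a b
  rw [lie_val]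
  fin_cases a <;> fin_cases b <;>
    simp [xOdd, yOdd, yEven, smul_eq_C_mul, h2]
  · ring
  · linear_combination (-X ^ (2 * j + 1 + 4 * k)) * h'

theorem lie_xEven_yEven (j k : ℕ) : ⁅xEven j, yEven k⁆ = hDiag (2 * (j + k)) := by
  apply CG_ext
  intro a b
  rw [lie_val]
  fin_cases a <;> fin_cases b <;>
    simp [xEven, hDiag, yEven, pow_mul] <;> ring

theorem lie_xEven_yOdd (j k : ℕ) :
    ⁅xEven j, yOdd k⁆ = (Complex.I ^ (2 * k + 1)) • xOdd (k + 2 * j) := by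
  apply CG_ext
  have h := I_odd_mul_self k
  have h' : (C Complex.I ^ (2 * k + 1) * C Complex.I ^ (2 * k + 1) : ℂ[X]) = -1 := by
      rw [← C_pow, ← C_mul, h]; simp
  have h2 : (C Complex.I ^ (2 * (k + 2 * j) + 1) : ℂ[X]) = C Complex.I ^ (2 * k + 1) := by
    rw [show 2 * (k + 2 * j) + 1 = 4 * j + (2 * k + 1) by ring, pow_add, pow_mul, C_I_pow_four]
    simp
  intro a b
  rw [lie_val]
  fin_cases a <;> fin_cases b <;>
    simp [xOdd, yOdd, xEven, smul_eq_C_mul, h2]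
  · ring
  · linear_combination (-X ^ (2 * k + 1 + 4 * j)) * h'

/-- The bracket of `E₂₁ + a E₃₂` and `E₂₁ + b E₃₂` is `(a - b) E₃₁`. For `a = i^(2j+1)` and `b =
i^(2k+1)` the scalars are opposite if `j + k` is odd and equal if it is even. -/
theorem lie_yOdd_yOdd_of_odd (j k m : ℕ) (h : j + k + 1 = 2 * m) :
    ⁅yOdd j, yOdd k⁆ = (2 * Complex.I ^ (2 * j + 1)) • yEven m := by
  apply CG_ext
  have h1 : (C Complex.I ^ (2 * k + 1) : ℂ[X]) = - C Complex.I ^ (2 * j + 1) := by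
    have h' : (C Complex.I ^ (2 * j + 1) * C Complex.I ^ (2 * j + 1) : ℂ[X]) = -1 := by
      rw [← C_pow, ← C_mul, I_odd_mul_self]; simp
    have h'' : (C Complex.I ^ (2 * j + 1) * C Complex.I ^ (2 * k + 1) : ℂ[X]) = 1 := by
      rw [← pow_add, show 2 * j + 1 + (2 * k + 1) = 4 * m by omega, pow_mul, C_I_pow_four, one_pow]
    linear_combination (C Complex.I ^ (2 * k + 1) : ℂ[X]) * h' - C Complex.I ^ (2 * j + 1) * h''
  intro a b
  rw [lie_val]
  fin_cases a <;> fin_cases b <;>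
    simp [yOdd, yEven, smul_eq_C_mul, C_two_eq, h1]
  rw [show 4 * m = (2 * j + 1) + (2 * k + 1) by omega]
  ring

theorem lie_yOdd_yOdd_of_even (j k : ℕ) (h : Even (j + k)) : ⁅yOdd j, yOdd k⁆ = 0 := by
  apply CG_ext
  have h1 : (C Complex.I ^ (2 * k + 1) : ℂ[X]) = C Complex.I ^ (2 * j + 1) := by
    obtain ⟨m, hm⟩ := h
    have h' : (C Complex.I ^ (2 * j + 1) * C Complex.I ^ (2 * j + 1) : ℂ[X]) = -1 := by
      rw [← C_pow, ← C_mul, I_odd_mul_self]; simp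
    have h'' : (C Complex.I ^ (2 * j + 1) * C Complex.I ^ (2 * k + 1) : ℂ[X]) = -1 := by
      rw [← pow_add, show 2 * j + 1 + (2 * k + 1) = 4 * m + 2 by omega, pow_add, pow_mul,
        C_I_pow_four, one_pow, ← C_pow, Complex.I_sq]
      simp
    linear_combination (C Complex.I ^ (2 * k + 1) : ℂ[X]) * h' - C Complex.I ^ (2 * j + 1) * h''
  intro a b
  rw [lie_val]
  fin_cases a <;> fin_cases b <;>
    simp [yOdd, h1]
  ring

theorem lie_yEven_yOdd (j k : ℕ) : ⁅yEven j, yOdd k⁆ = 0 := by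
  apply CG_ext
  intro a b
  rw [lie_val]
  fin_cases a <;> fin_cases b <;>
    simp [yOdd, yEven]

theorem lie_yEven_yEven (j k : ℕ) : ⁅yEven j, yEven k⁆ = 0 := by
  apply CG_ext
  intro a b
  rw [lie_val]
  fin_cases a <;> fin_cases b <;>
    simp [yEven]

theorem hDiag_zero : hDiag 0 = h0 := by
  apply CG_ext
  intro a b
  fin_cases a <;> fin_cases b <;> simp [hDiag, h0]

theorem coeff_aeval_I (p : ℂ[X]) (d : ℕ) :
    (aeval (R := ℂ) (C Complex.I * X : ℂ[X]) p).coeff d = Complex.I ^ d * p.coeff d := by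
  have : aeval (R := ℂ) (C Complex.I * X : ℂ[X]) p = p.comp (C Complex.I * X) := rfl
  rw [this, comp_C_mul_X_coeff, mul_comm]

theorem eq_sum_of_coeff_eq_zero (p : ℂ[X]) (q r N : ℕ) (hr : r < q) (hN : p.natDegree < N)
    (h : ∀ d, d % q ≠ r → p.coeff d = 0) :
    p = ∑ k ∈ Finset.range N, p.coeff (q * k + r) • X ^ (q * k + r) := by
  ext d
  simp only [finsetSum_coeff, coeff_smul, coeff_X_pow, smul_eq_mul, mul_ite, mul_one, mul_zero]
  by_cases hd : d % q = r
  · have hd' : d = q * (d / q) + r := by rw [← hd, Nat.div_add_mod]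
    rw [Finset.sum_eq_single (d / q)]
    · rw [← hd', if_pos rfl]
    · intro b _ hb
      rw [if_neg]
      intro h'
      apply hb
      rw [h', Nat.mul_add_div (by omega), Nat.div_eq_of_lt hr, add_zero]
    · intro h'
      rw [if_pos hd', ← hd']
      apply coeff_eq_zero_of_natDegree_lt
      have : N ≤ d / q := by simpa using h'
      exact lt_of_lt_of_le hN (this.trans (Nat.div_le_self _ _))
  · rw [h d hd, Finset.sum_eq_zero]
    intro b _
    rw [if_neg]
    rintro rfl
    exact hd (by rw [Nat.mul_add_mod, Nat.mod_eq_of_lt hr])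

/-- The entries of an element of `𝔠𝔤`, as a linear map. -/
def entry (i j : Fin 3) : CG →ₗ[ℂ] ℂ[X] where
  toFun A := A.1 i j
  map_add' _ _ := rfl
  map_smul' _ _ := rfl

theorem entry_apply (i j : Fin 3) (A : CG) : entry i j A = A.1 i j := rfl

theorem I_pow_ne_one {d : ℕ} (h : d % 4 ≠ 0) : Complex.I ^ d ≠ 1 := by
  rw [Complex.I_pow_eq_pow_mod]
  have := Nat.mod_lt d (show 4 > 0 by norm_num)
  interval_cases d % 4
  · exact absurd rfl h
  · simp [Complex.ext_iff]
  · norm_num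
  · simp [Complex.ext_iff, pow_succ]

/-- Coefficientwise the twisting condition equates each entry with `± i^d` times its mirror image in
the antidiagonal. An entry on the antidiagonal thus survives only for suitable `d` modulo four, and
the other entries come in proportional pairs. -/
theorem CG_coeff (A : CG) (d : ℕ) :
    (A.1 0 0).coeff d + (A.1 1 1).coeff d + (A.1 2 2).coeff d = 0 ∧
    (d % 4 ≠ 0 → (A.1 2 0).coeff d = 0 ∧ (A.1 0 2).coeff d = 0) ∧
    (d % 2 ≠ 1 → (A.1 1 0).coeff d = 0 ∧ (A.1 0 1).coeff d = 0) ∧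
    (d % 2 ≠ 0 → (A.1 0 0).coeff d = 0) ∧
    (A.1 2 1).coeff d = Complex.I ^ d * (A.1 1 0).coeff d ∧
    (A.1 1 2).coeff d = Complex.I ^ d * (A.1 0 1).coeff d ∧
    (A.1 2 2).coeff d = -(Complex.I ^ d * (A.1 0 0).coeff d) := by
  obtain ⟨ht, hA⟩ := mem_currentAlg.1 A.2
  obtain ⟨h1, h2, h3, h4, h5, h6, h7, h8, h9⟩ := hA _ rfl
  apply_fun (fun p => p.coeff d) at ht h1 h2 h3 h4 h5 h6 h7 h8 h9
  simp only [coeff_add, coeff_neg, coeff_aeval_I, coeff_zero] at *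
  have hsq : Complex.I ^ d * Complex.I ^ d = (-1) ^ d := by
    rw [← mul_pow, Complex.I_mul_I]
  refine ⟨ht, fun h => ?_, fun h => ?_, fun h => ?_, h4, h8, h7⟩
  · have h' := sub_ne_zero.2 (I_pow_ne_one h)
    constructor
    · have : (Complex.I ^ d - 1) * (A.1 2 0).coeff d = 0 := by linear_combination -h1
      exact (mul_eq_zero.1 this).resolve_left h'
    · have : (Complex.I ^ d - 1) * (A.1 0 2).coeff d = 0 := by linear_combination -h9
      exact (mul_eq_zero.1 this).resolve_left h'
  · have hd : Even d := by rw [Nat.even_iff]; omega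
    rw [hd.neg_one_pow] at hsq
    rw [h4] at h2
    rw [h8] at h6
    constructor
    · linear_combination h2 / 2 - hsq * (A.1 1 0).coeff d / 2
    · linear_combination h6 / 2 - hsq * (A.1 0 1).coeff d / 2
  · have hd : Odd d := by rw [Nat.odd_iff]; omega
    rw [hd.neg_one_pow] at hsq
    rw [h7] at h3
    linear_combination h3 / 2 + hsq * (A.1 0 0).coeff d / 2

theorem CG_decomp (A : CG) : ∃ N : ℕ,
    A = ∑ k ∈ Finset.range N, ((A.1 0 1).coeff (2 * k + 1) • xOdd k +
      (A.1 0 2).coeff (4 * k + 0) • xEven k + (A.1 0 0).coeff (2 * k + 0) • hDiag k +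
      (A.1 1 0).coeff (2 * k + 1) • yOdd k + (A.1 2 0).coeff (4 * k + 0) • yEven k) := by
  refine ⟨(A.1 0 1).natDegree + (A.1 0 2).natDegree + (A.1 0 0).natDegree +
    (A.1 1 0).natDegree + (A.1 2 0).natDegree + 1, ?_⟩
  set N := (A.1 0 1).natDegree + (A.1 0 2).natDegree + (A.1 0 0).natDegree +
    (A.1 1 0).natDegree + (A.1 2 0).natDegree + 1 with hN
  have e01 := eq_sum_of_coeff_eq_zero (A.1 0 1) 2 1 N (by omega) (by omega)
    fun d h => ((CG_coeff A d).2.2.1 h).2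
  have e02 := eq_sum_of_coeff_eq_zero (A.1 0 2) 4 0 N (by omega) (by omega)
    fun d h => ((CG_coeff A d).2.1 h).2
  have e00 := eq_sum_of_coeff_eq_zero (A.1 0 0) 2 0 N (by omega) (by omega)
    fun d h => ((CG_coeff A d).2.2.2.1 h)
  have e10 := eq_sum_of_coeff_eq_zero (A.1 1 0) 2 1 N (by omega) (by omega)
    fun d h => ((CG_coeff A d).2.2.1 h).1
  have e20 := eq_sum_of_coeff_eq_zero (A.1 2 0) 4 0 N (by omega) (by omega)
    fun d h => ((CG_coeff A d).2.1 h).1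
  -- These five entries determine the element: the symmetry gives three of the others and
  -- tracelessness the middle one.
  have key : ∀ B : CG, B.1 0 1 = A.1 0 1 → B.1 0 2 = A.1 0 2 → B.1 0 0 = A.1 0 0 →
      B.1 1 0 = A.1 1 0 → B.1 2 0 = A.1 2 0 → A = B := by
    intro B h1 h2 h3 h4 h5
    apply CG_ext
    intro i j
    ext d
    obtain ⟨a1, -, -, -, a2, a3, a4⟩ := CG_coeff A d
    obtain ⟨b1, -, -, -, b2, b3, b4⟩ := CG_coeff B d
    rw [h1] at b3
    rw [h3] at b1 b4
    rw [h4] at b2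
    fin_cases i <;> fin_cases j
    · simp [h3]
    · simp [h1]
    · simp [h2]
    · simp [h4]
    · change (A.1 1 1).coeff d = (B.1 1 1).coeff d
      linear_combination a1 - b1 - a4 + b4
    · change (A.1 1 2).coeff d = (B.1 1 2).coeff d
      rw [a3, b3]
    · simp [h5]
    · change (A.1 2 1).coeff d = (B.1 2 1).coeff d
      rw [a2, b2]
    · change (A.1 2 2).coeff d = (B.1 2 2).coeff d
      rw [a4, b4]
  apply key
  · conv_rhs => rw [e01]
    change entry 0 1 _ = _
    rw [map_sum]
    refine Finset.sum_congr rfl fun k _ => ?_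
    simp [entry_apply, xOdd, xEven, hDiag, yOdd, yEven]
  · conv_rhs => rw [e02]
    change entry 0 2 _ = _
    rw [map_sum]
    refine Finset.sum_congr rfl fun k _ => ?_
    simp [entry_apply, xOdd, xEven, hDiag, yOdd, yEven]
  · conv_rhs => rw [e00]
    change entry 0 0 _ = _
    rw [map_sum]
    refine Finset.sum_congr rfl fun k _ => ?_
    simp [entry_apply, xOdd, xEven, hDiag, yOdd, yEven]
  · conv_rhs => rw [e10]
    change entry 1 0 _ = _
    rw [map_sum]
    refine Finset.sum_congr rfl fun k _ => ?_
    simp [entry_apply, xOdd, xEven, hDiag, yOdd, yEven]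
  · conv_rhs => rw [e20]
    change entry 2 0 _ = _
    rw [map_sum]
    refine Finset.sum_congr rfl fun k _ => ?_
    simp [entry_apply, xOdd, xEven, hDiag, yOdd, yEven]

theorem mem_of_basis (S : Submodule ℂ CG) (hx : ∀ k, xOdd k ∈ S) (he : ∀ k, xEven k ∈ S)
    (hh : ∀ k, hDiag k ∈ S) (hy : ∀ k, yOdd k ∈ S) (hf : ∀ k, yEven k ∈ S) (A : CG) : A ∈ S := by
  obtain ⟨N, hN⟩ := CG_decomp A
  rw [hN]
  exact Submodule.sum_mem _ fun k _ => S.add_mem (S.add_mem (S.add_mem (S.add_mem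
    (S.smul_mem _ (hx k)) (S.smul_mem _ (he k))) (S.smul_mem _ (hh k))) (S.smul_mem _ (hy k)))
    (S.smul_mem _ (hf k))

theorem mem_of_mem_nPlus (S : Submodule ℂ CG) (hx : ∀ k, xOdd k ∈ S) (he : ∀ k, xEven k ∈ S)
    {A : CG} (hA : A ∈ nPlus) : A ∈ S := by
  obtain ⟨N, hN⟩ := CG_decomp A
  rw [hN]
  refine Submodule.sum_mem _ fun k _ => ?_
  rw [hA 0 0 le_rfl, hA 1 0 (by simp), hA 2 0 (by simp)]
  simpa using S.add_mem (S.smul_mem _ (hx k)) (S.smul_mem _ (he k))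

theorem mem_of_mem_hPlus (S : Submodule ℂ CG) (hh : ∀ k, hDiag (k + 1) ∈ S)
    {A : CG} (hA : A ∈ hPlus) : A ∈ S := by
  obtain ⟨N, hN⟩ := CG_decomp A
  rw [hN]
  refine Submodule.sum_mem _ fun k _ => ?_
  rw [hA.1 0 1 (by simp), hA.1 0 2 (by simp), hA.1 1 0 (by simp), hA.1 2 0 (by simp)]
  rcases k with _ | k
  · simp [hA.2 0]
  · simpa using S.smul_mem _ (hh k)

theorem xOdd_mem_nPlus (k : ℕ) : xOdd k ∈ nPlus := by
  intro i j h
  fin_cases i <;> fin_cases j <;> first | rfl | (exfalso; revert h; decide)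

theorem xEven_mem_nPlus (k : ℕ) : xEven k ∈ nPlus := by
  intro i j h
  fin_cases i <;> fin_cases j <;> first | rfl | (exfalso; revert h; decide)

theorem hDiag_mem_hPlus (k : ℕ) : hDiag (k + 1) ∈ hPlus := by
  constructor
  · intro i j h
    fin_cases i <;> fin_cases j <;> first | rfl | (exfalso; revert h; decide)
  · intro i
    fin_cases i <;> simp [hDiag, mul_add, pow_add]

end

/-! ### Lowering and Cartan elements indexed by their degree. -/

theorem toU_lie (a b : CG) : toU ⁅a, b⁆ = toU a * toU b - toU b * toU a := by
  rw [toU, LieHom.map_lie, LieRing.of_associative_ring_bracket]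

theorem toU_zero : toU 0 = 0 := by rw [toU, map_zero]

theorem toU_smul (c : ℂ) (a : CG) : toU (c • a) = c • toU a := by rw [toU, map_smul]

/-- The elements `y_{r+1/2}`, indexed by their degree. -/
def yDeg (d : ℕ) : U := if d % 2 = 1 then toU (yOdd (d / 2)) else 0

/-- The elements `y_{2r}`, indexed by their degree. -/
def fDeg (d : ℕ) : U := if d % 4 = 0 then toU (yEven (d / 4)) else 0

/-- The diagonal elements of positive degree, indexed by their degree. -/
def hDeg (d : ℕ) : U := if d % 2 = 0 ∧ 0 < d then toU (hDiag (d / 2)) else 0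

theorem yDeg_odd (k : ℕ) : yDeg (2 * k + 1) = toU (yOdd k) := by
  rw [yDeg, if_pos (by omega), show (2 * k + 1) / 2 = k by omega]

theorem yDeg_even (k : ℕ) : yDeg (2 * k) = 0 := if_neg (by omega)

theorem fDeg_four (k : ℕ) : fDeg (4 * k) = toU (yEven k) := by
  rw [fDeg, if_pos (by omega), show (4 * k) / 4 = k by omega]

theorem fDeg_eq_zero {d : ℕ} (h : d % 4 ≠ 0) : fDeg d = 0 := if_neg h

theorem hDeg_even (k : ℕ) : hDeg (2 * (k + 1)) = toU (hDiag (k + 1)) := by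
  rw [hDeg, if_pos (by omega), show (2 * (k + 1)) / 2 = k + 1 by omega]

theorem hDeg_eq_zero {d : ℕ} (h : ¬(d % 2 = 0 ∧ 0 < d)) : hDeg d = 0 := if_neg h

/-- The coefficient in `[h, y]`. -/
def hyCoeff (i : ℕ) : ℂ := if i % 2 = 0 ∧ 0 < i then 2 - (-1) ^ (i / 2) else 0

/-- The coefficient in `[h, f]`. -/
def hfCoeff (i : ℕ) : ℂ := if i % 4 = 0 ∧ 0 < i then 2 else 0

theorem hDeg_yDeg (i j : ℕ) :
    hDeg i * yDeg j - yDeg j * hDeg i = -hyCoeff i • yDeg (i + j) := by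
  by_cases hi : i % 2 = 0 ∧ 0 < i
  · obtain ⟨m, rfl⟩ : ∃ m, i = 2 * (m + 1) := ⟨i / 2 - 1, by omega⟩
    rw [hyCoeff, if_pos hi, show 2 * (m + 1) / 2 = m + 1 by omega]
    rcases Nat.even_or_odd' j with ⟨k, rfl | rfl⟩
    · rw [yDeg_even, ← mul_add, yDeg_even]; simp
    · rw [yDeg_odd, hDeg_even, show 2 * (m + 1) + (2 * k + 1) = 2 * (k + (m + 1)) + 1 by ring,
        yDeg_odd, ← toU_lie, lie_hDiag_yOdd, toU_smul]
  · rw [hyCoeff, if_neg hi, hDeg_eq_zero hi]; simp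

theorem hDeg_fDeg (i j : ℕ) :
    hDeg i * fDeg j - fDeg j * hDeg i = -hfCoeff i • fDeg (i + j) := by
  by_cases hj : j % 4 = 0
  · obtain ⟨k, rfl⟩ : ∃ k, j = 4 * k := ⟨j / 4, by omega⟩
    by_cases hi : i % 2 = 0 ∧ 0 < i
    · obtain ⟨m, rfl⟩ : ∃ m, i = 2 * (m + 1) := ⟨i / 2 - 1, by omega⟩
      rw [fDeg_four, hDeg_even, ← toU_lie]
      rcases Nat.even_or_odd' (m + 1) with ⟨l, h | h⟩
      · rw [h, lie_hDiag_even_yEven, toU_smul, hfCoeff, if_pos (by omega),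
          show 2 * (2 * l) + 4 * k = 4 * (k + l) by ring, fDeg_four]
      · rw [h, lie_hDiag_odd_yEven, toU_zero, hfCoeff, if_neg (by omega)]; simp
    · rw [hfCoeff, if_neg (by omega), hDeg_eq_zero hi]; simp
  · rw [fDeg_eq_zero hj]
    by_cases hi : i % 4 = 0 ∧ 0 < i
    · rw [fDeg_eq_zero (by omega)]; simp
    · rw [hfCoeff, if_neg hi]; simp

/-- The coefficient in `[y, y]`. -/
def yyCoeff (i : ℕ) : ℂ := if i % 2 = 1 then 2 * Complex.I ^ i else 0

theorem yDeg_yDeg (i j : ℕ) :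
    yDeg i * yDeg j - yDeg j * yDeg i = yyCoeff i • fDeg (i + j) := by
  rcases Nat.even_or_odd' i with ⟨k, rfl | rfl⟩
  · rw [yDeg_even, yyCoeff, if_neg (by omega)]; simp
  rcases Nat.even_or_odd' j with ⟨l, rfl | rfl⟩
  · rw [yDeg_even, fDeg_eq_zero (by omega)]; simp
  rw [yDeg_odd, yDeg_odd, ← toU_lie, yyCoeff, if_pos (by omega)]
  rcases Nat.even_or_odd (k + l) with h | h
  · have := Nat.even_iff.1 h
    rw [lie_yOdd_yOdd_of_even _ _ h, toU_zero, fDeg_eq_zero (by omega), smul_zero]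
  · obtain ⟨m, hm⟩ := h
    rw [lie_yOdd_yOdd_of_odd k l (m + 1) (by omega), toU_smul,
      show 2 * k + 1 + (2 * l + 1) = 4 * (m + 1) by omega, fDeg_four]

theorem commute_fDeg_yDeg (i j : ℕ) : Commute (fDeg i) (yDeg j) := by
  rw [commute_iff_eq, ← sub_eq_zero]
  rw [fDeg, yDeg]
  split_ifs
  · rw [← toU_lie, lie_yEven_yOdd, toU_zero]
  all_goals simp

theorem commute_fDeg_fDeg (i j : ℕ) : Commute (fDeg i) (fDeg j) := by
  rw [commute_iff_eq, ← sub_eq_zero]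
  rw [fDeg, fDeg]
  split_ifs
  · rw [← toU_lie, lie_yEven_yEven, toU_zero]
  all_goals simp

theorem xOdd_zero_yDeg (j : ℕ) :
    toU (xOdd 0) * yDeg j - yDeg j * toU (xOdd 0) = hDeg (j + 1) := by
  rcases Nat.even_or_odd' j with ⟨k, rfl | rfl⟩
  · rw [yDeg_even, hDeg_eq_zero (by omega)]; simp
  · rw [yDeg_odd, ← toU_lie, lie_xOdd_yOdd, show 2 * k + 1 + 1 = 2 * (k + 1) by ring, hDeg_even,
      zero_add]

theorem xOdd_zero_fDeg (j : ℕ) :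
    toU (xOdd 0) * fDeg j - fDeg j * toU (xOdd 0) =
      if j % 4 = 0 then Complex.I • yDeg (j + 1) else 0 := by
  split_ifs with h
  · obtain ⟨k, rfl⟩ : ∃ k, j = 4 * k := ⟨j / 4, by omega⟩
    rw [fDeg_four, ← toU_lie, lie_xOdd_yEven, toU_smul,
      show 4 * k + 1 = 2 * (2 * k) + 1 by ring, yDeg_odd]
    simp
  · rw [fDeg_eq_zero h]; simp

/-! ### Generating series -/

abbrev US : Type := PowerSeries U

/-- The scalar `i - 1`. -/
def kap : ℂ := Complex.I - 1

/-- The scalar serves three identities at once: `(1 + i) kap = -2` gives `serX_serY`, `(1 + i) i =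
kap` gives `serX_serF`, and `kap² = -2i` gives `serR_serY`. -/
theorem kap_mul_kap : kap * kap = -2 * Complex.I := by
  have := Complex.I_mul_I
  rw [kap]; linear_combination this

theorem kap_ne_zero : kap ≠ 0 := by
  intro h
  have := kap_mul_kap
  rw [h] at this
  simp at this

/-- The generating series of the elements `y_{r+1/2}`. -/
def serY : US := PowerSeries.mk fun d => kap • yDeg d

/-- The generating series of the elements `y_{2r}`. -/
def serF : US := PowerSeries.mk fDeg

/-- The generating series of the elements of `𝔠𝔥₊`. -/
def serH : US := PowerSeries.mk fun d => (-2 : ℂ) • hDeg d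

/-- The part of `serY` in degrees congruent to one modulo four. -/
def serN : US := PowerSeries.mk fun d => if d % 4 = 1 then kap • yDeg d else 0

/-- A multiple of the element `x_{1/2}`, in degree one. -/
def serX : US := PowerSeries.mk fun d => if d = 1 then (1 + Complex.I) • toU (xOdd 0) else 0

/-- The Euler operator on power series. -/
def euler : US →ₗ[ℂ] US where
  toFun F := PowerSeries.mk fun d => (d : ℂ) • PowerSeries.coeff d F
  map_add' F G := by ext d; simp
  map_smul' c F := by
    ext d
    simp only [PowerSeries.coeff_mk, RingHom.id_apply, PowerSeries.coeff_smul]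
    rw [smul_comm]

theorem coeff_euler (d : ℕ) (F : US) :
    PowerSeries.coeff d (euler F) = (d : ℂ) • PowerSeries.coeff d F := by
  change PowerSeries.coeff d (PowerSeries.mk fun d => (d : ℂ) • PowerSeries.coeff d F) = _
  rw [PowerSeries.coeff_mk]

theorem euler_mul (F G : US) : euler (F * G) = euler F * G + F * euler G := by
  ext d
  simp only [coeff_euler, map_add, PowerSeries.coeff_mul, ← Finset.sum_add_distrib,
    Finset.smul_sum]
  refine Finset.sum_congr rfl fun p hp => ?_
  rw [← Finset.HasAntidiagonal.mem_antidiagonal.1 hp, Nat.cast_add, add_smul, smul_mul_assoc, mul_smul_comm]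

theorem coeff_commutator (a b : ℕ → U) (d : ℕ) :
    PowerSeries.coeff d (PowerSeries.mk a * PowerSeries.mk b - PowerSeries.mk b * PowerSeries.mk a)
      = ∑ p ∈ Finset.HasAntidiagonal.antidiagonal d, (a p.1 * b p.2 - b p.2 * a p.1) := by
  rw [map_sub, PowerSeries.coeff_mul, PowerSeries.coeff_mul,
    ← Finset.Nat.sum_antidiagonal_swap (n := d) (f := fun p =>
      PowerSeries.coeff p.1 (PowerSeries.mk b) * PowerSeries.coeff p.2 (PowerSeries.mk a)),
    ← Finset.sum_sub_distrib]
  simp [PowerSeries.coeff_mk]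

theorem commute_of_coeff {F G : US}
    (h : ∀ i j, Commute (PowerSeries.coeff i F) (PowerSeries.coeff j G)) : Commute F G := by
  have : F * G = G * F := by
    ext d
    rw [PowerSeries.coeff_mul, PowerSeries.coeff_mul,
      ← Finset.Nat.sum_antidiagonal_swap (n := d) (f := fun p =>
      PowerSeries.coeff p.1 G * PowerSeries.coeff p.2 F)]
    exact Finset.sum_congr rfl fun p _ => h _ _
  exact this

theorem serX_serY : serX * serY - serY * serX = serH := by
  ext d
  rw [serX, serY, coeff_commutator, serH, PowerSeries.coeff_mk]
  rcases d with _ | d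
  · simp [hDeg]
  · rw [Finset.sum_eq_single (1, d)]
    · rw [if_pos rfl, smul_mul_smul_comm, smul_mul_smul_comm, mul_comm kap, ← smul_sub,
        xOdd_zero_yDeg]
      congr 1
      have := Complex.I_mul_I
      rw [kap]; linear_combination this
    · rintro ⟨i, j⟩ hp hne
      rw [if_neg]
      · simp
      · rintro h
        simp only at h
        subst h
        apply hne
        have := Finset.HasAntidiagonal.mem_antidiagonal.1 hp
        simp only at this
        rw [Prod.mk.injEq]; omega
    · intro h
      exact absurd (Finset.HasAntidiagonal.mem_antidiagonal.2 (by simp only; omega)) h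

theorem serX_serF : serX * serF - serF * serX = serN := by
  ext d
  rw [serX, serF, coeff_commutator, serN, PowerSeries.coeff_mk]
  rcases d with _ | d
  · simp
  · rw [Finset.sum_eq_single (1, d)]
    · rw [if_pos rfl, smul_mul_assoc, mul_smul_comm, ← smul_sub, xOdd_zero_fDeg]
      by_cases h : d % 4 = 0
      · rw [if_pos h, if_pos (by omega), smul_smul]
        congr 1
        have := Complex.I_mul_I
        rw [kap]; linear_combination this
      · rw [if_neg h, if_neg (by omega), smul_zero]
    · rintro ⟨i, j⟩ hp hne
      rw [if_neg]
      · simp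
      · rintro h
        simp only at h
        subst h
        apply hne
        have := Finset.HasAntidiagonal.mem_antidiagonal.1 hp
        simp only at this
        rw [Prod.mk.injEq]; omega
    · intro h
      exact absurd (Finset.HasAntidiagonal.mem_antidiagonal.2 (by simp only; omega)) h

theorem sum_hyCoeff (m : ℕ) :
    ∑ i ∈ Finset.range (2 * m + 2), hyCoeff i = 2 * m + (1 - (-1) ^ m) / 2 := by
  induction m with
  | zero => simp [Finset.sum_range_succ, hyCoeff]
  | succ m ih =>
    rw [show 2 * (m + 1) + 2 = 2 * m + 2 + 1 + 1 by ring, Finset.sum_range_succ,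
      Finset.sum_range_succ, ih, hyCoeff, hyCoeff, if_pos (by omega), if_neg (by omega),
      show (2 * m + 2) / 2 = m + 1 by omega]
    push_cast
    ring

theorem sum_hfCoeff (m : ℕ) : ∑ i ∈ Finset.range (4 * m + 1), hfCoeff i = 2 * m := by
  induction m with
  | zero => simp [hfCoeff]
  | succ m ih =>
    rw [show 4 * (m + 1) + 1 = 4 * m + 1 + 1 + 1 + 1 + 1 by ring, Finset.sum_range_succ,
      Finset.sum_range_succ, Finset.sum_range_succ, Finset.sum_range_succ, ih]
    simp only [hfCoeff]
    rw [if_neg (by omega), if_neg (by omega), if_neg (by omega), if_pos (by omega)]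
    push_cast
    ring

/-- The bracket `[h_i, y_j]` is a scalar depending on `i` times `y_{i+j}`, so the coefficient of
degree `d` is `y_d` times a partial sum of scalars. For odd `d` that sum is `d`, except for `d ≡ 1`
modulo four, where it is `d - 1`; this is the correction `serN`. -/
theorem serH_serY : serH * serY - serY * serH = (2 : ℂ) • (euler serY - serN) := by
  ext d
  rw [serH, serY, coeff_commutator]
  have : ∀ p ∈ Finset.HasAntidiagonal.antidiagonal d, ((-2 : ℂ) • hDeg p.1 * kap • yDeg p.2 -
      kap • yDeg p.2 * (-2 : ℂ) • hDeg p.1) = (2 * hyCoeff p.1) • (kap • yDeg d) := by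
    intro p hp
    rw [smul_mul_smul_comm, smul_mul_smul_comm, mul_comm kap, ← smul_sub, hDeg_yDeg,
      Finset.HasAntidiagonal.mem_antidiagonal.1 hp, smul_smul, smul_smul]
    congr 1; ring
  rw [Finset.sum_congr rfl this, ← Finset.sum_smul, ← Finset.mul_sum,
    Finset.Nat.sum_antidiagonal_eq_sum_range_succ_mk]
  rw [PowerSeries.coeff_smul, map_sub, coeff_euler, serN, PowerSeries.coeff_mk,
    PowerSeries.coeff_mk]
  rcases Nat.even_or_odd' d with ⟨m, rfl | rfl⟩
  · rw [yDeg_even]; simp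
  · rw [show (2 * m + 1).succ = 2 * m + 2 by omega, sum_hyCoeff]
    rcases Nat.even_or_odd' m with ⟨k, rfl | rfl⟩
    · generalize kap • yDeg (2 * (2 * k) + 1) = z
      have h (c : ℂ) : c • z - z = (c - 1) • z := by rw [sub_smul, one_smul]
      rw [if_pos (by omega), h, smul_smul]
      congr 1
      push_cast [pow_mul]
      norm_num
    · rw [if_neg (by omega), sub_zero, smul_smul 2]
      congr 1
      push_cast [pow_mul, pow_succ]; norm_num

theorem serH_serF : serH * serF - serF * serH = euler serF := by
  ext d
  rw [serH, serF, coeff_commutator]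
  have : ∀ p ∈ Finset.HasAntidiagonal.antidiagonal d, ((-2 : ℂ) • hDeg p.1 * fDeg p.2 -
      fDeg p.2 * (-2 : ℂ) • hDeg p.1) = (2 * hfCoeff p.1) • fDeg d := by
    intro p hp
    rw [smul_mul_assoc, mul_smul_comm, ← smul_sub, hDeg_fDeg,
      Finset.HasAntidiagonal.mem_antidiagonal.1 hp, smul_smul]
    congr 1; ring
  rw [Finset.sum_congr rfl this, ← Finset.sum_smul, ← Finset.mul_sum,
    Finset.Nat.sum_antidiagonal_eq_sum_range_succ_mk, coeff_euler, PowerSeries.coeff_mk]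
  by_cases h : d % 4 = 0
  · obtain ⟨k, rfl⟩ : ∃ k, d = 4 * k := ⟨d / 4, by omega⟩
    rw [show (4 * k).succ = 4 * k + 1 by omega, sum_hfCoeff]
    congr 1
    push_cast; ring
  · rw [fDeg_eq_zero h]; simp

theorem sum_yyCoeff (m : ℕ) : ∑ i ∈ Finset.range (4 * m + 1),
    ((i : ℂ) - if i % 4 = 1 then 2 else 0) * (kap * kap * yyCoeff i) = -(16 * m) := by
  induction m with
  | zero => simp [yyCoeff]
  | succ m ih =>
    rw [show 4 * (m + 1) + 1 = 4 * m + 1 + 1 + 1 + 1 + 1 by ring, Finset.sum_range_succ,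
      Finset.sum_range_succ, Finset.sum_range_succ, Finset.sum_range_succ, ih, kap_mul_kap]
    simp only [yyCoeff]
    simp only [show (4 * m + 1) % 4 = 1 by omega, show (4 * m + 1) % 2 = 1 by omega,
      show (4 * m + 1 + 1) % 4 = 2 by omega, show (4 * m + 1 + 1) % 2 = 0 by omega,
      show (4 * m + 1 + 1 + 1) % 4 = 3 by omega, show (4 * m + 1 + 1 + 1) % 2 = 1 by omega,
      show (4 * m + 1 + 1 + 1 + 1) % 4 = 0 by omega, show (4 * m + 1 + 1 + 1 + 1) % 2 = 0 by omega]
    norm_num only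
    simp only [if_true, if_false]
    have h := Complex.I_mul_I
    have h1 : Complex.I ^ (4 * m + 1) = Complex.I := by
      rw [pow_succ, pow_mul, Complex.I_pow_four]; simp
    have h3 : Complex.I ^ (4 * m + 3) = -Complex.I := by
      rw [show 4 * m + 3 = 4 * m + 1 + 1 + 1 by ring, pow_succ, pow_succ, h1]; linear_combination Complex.I * h
    rw [h1, h3]
    push_cast
    linear_combination (16 : ℂ) * h

/-- With `R = euler serY - 2 serN` the previous commutator reads `[serH, serY] = euler serY + R`.
The present identity measures how far `R` is from commuting with `serY`; the defect commutes with
all of `serY` and `serF`. -/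
theorem serR_serY : (euler serY - (2 : ℂ) • serN) * serY - serY * (euler serY - (2 : ℂ) • serN) =
    (-4 : ℂ) • euler serF := by
  have hR : euler serY - (2 : ℂ) • serN = PowerSeries.mk fun d =>
      (((d : ℂ) - if d % 4 = 1 then 2 else 0) * kap) • yDeg d := by
    ext d
    rw [map_sub, coeff_euler, PowerSeries.coeff_smul, serN, serY, PowerSeries.coeff_mk,
      PowerSeries.coeff_mk, PowerSeries.coeff_mk]
    split_ifs
    · rw [smul_smul, smul_smul, ← sub_smul]; congr 1; ring
    · rw [smul_smul, smul_zero, sub_zero]; congr 1; ring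
  ext d
  rw [hR, serY, coeff_commutator]
  have : ∀ p ∈ Finset.HasAntidiagonal.antidiagonal d,
      ((((p.1 : ℂ) - if p.1 % 4 = 1 then 2 else 0) * kap) • yDeg p.1 * kap • yDeg p.2 -
      kap • yDeg p.2 * (((p.1 : ℂ) - if p.1 % 4 = 1 then 2 else 0) * kap) • yDeg p.1) =
      (((p.1 : ℂ) - if p.1 % 4 = 1 then 2 else 0) * (kap * kap * yyCoeff p.1)) • fDeg d := by
    intro p hp
    rw [smul_mul_smul_comm, smul_mul_smul_comm, mul_comm kap, ← smul_sub, yDeg_yDeg,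
      Finset.HasAntidiagonal.mem_antidiagonal.1 hp, smul_smul]
    congr 1; ring
  rw [Finset.sum_congr rfl this, ← Finset.sum_smul, Finset.Nat.sum_antidiagonal_eq_sum_range_succ_mk,
    PowerSeries.coeff_smul, coeff_euler, serF, PowerSeries.coeff_mk]
  by_cases h : d % 4 = 0
  · obtain ⟨k, rfl⟩ : ∃ k, d = 4 * k := ⟨d / 4, by omega⟩
    rw [show (4 * k).succ = 4 * k + 1 by omega, sum_yyCoeff, smul_smul]
    congr 1
    push_cast; ring
  · rw [fDeg_eq_zero h]; simp

/-- The components of `exp (serY + serF)` by the weight lowered; `garland (w + 4)` is the component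
for `w`. -/
def garland : ℕ → US
  | 0 => 0
  | 1 => 0
  | 2 => 0
  | 3 => 0
  | 4 => 1
  | w + 5 => ((w + 1 : ℂ)⁻¹) • (serY * garland (w + 4) + (2 : ℂ) • (serF * garland (w + 3)))

/-- Weight by weight this is the equation `z G' = (z Y + 2 z² F) G` for `G = exp (z Y + z² F)`,
valid because `F` commutes with `Y`. The initial zeros of `garland` absorb the boundary cases. -/
theorem garland_rec (w : ℕ) : ((w : ℂ) - 2) • garland (w + 2) =
    serY * garland (w + 1) + (2 : ℂ) • (serF * garland w) := by
  match w with
  | 0 => simp [garland]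
  | 1 => simp [garland]
  | 2 => simp [garland]
  | w + 3 =>
    have : (w : ℂ) + 1 ≠ 0 := Nat.cast_add_one_ne_zero w
    rw [show w + 3 + 2 = w + 5 from rfl, garland, smul_smul]
    push_cast
    rw [show ((w : ℂ) + 3 - 2) * (w + 1 : ℂ)⁻¹ = 1 by
      rw [show (w : ℂ) + 3 - 2 = w + 1 by ring]; exact mul_inv_cancel₀ this, one_smul]

theorem commute_serF_serY : Commute serF serY :=
  commute_of_coeff fun i j => by
    rw [serF, serY, PowerSeries.coeff_mk, PowerSeries.coeff_mk]
    exact (commute_fDeg_yDeg i j).smul_right _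

theorem commute_serF_serN : Commute serF serN :=
  commute_of_coeff fun i j => by
    rw [serF, serN, PowerSeries.coeff_mk, PowerSeries.coeff_mk]
    split_ifs
    · exact (commute_fDeg_yDeg i j).smul_right _
    · exact Commute.zero_right _

theorem commute_euler {F G : US}
    (h : ∀ i j, Commute (PowerSeries.coeff i F) (PowerSeries.coeff j G)) : Commute F (euler G) :=
  commute_of_coeff fun i j => by
    rw [coeff_euler]
    exact (h i j).smul_right _

theorem commute_serF_euler_serY : Commute serF (euler serY) :=
  commute_euler fun i j => by
    rw [serF, serY, PowerSeries.coeff_mk, PowerSeries.coeff_mk]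
    exact (commute_fDeg_yDeg i j).smul_right _

theorem commute_serY_euler_serF : Commute serY (euler serF) :=
  commute_euler fun i j => by
    rw [serF, serY, PowerSeries.coeff_mk, PowerSeries.coeff_mk]
    exact ((commute_fDeg_yDeg j i).smul_right _).symm

theorem commute_serF_euler_serF : Commute serF (euler serF) :=
  commute_euler fun i j => by
    rw [serF, PowerSeries.coeff_mk, PowerSeries.coeff_mk]
    exact commute_fDeg_fDeg i j

theorem euler_one : euler 1 = 0 := by
  ext d
  rw [coeff_euler, PowerSeries.coeff_one]
  split_ifs with h <;> simp [h]

/-! ### The exponential series on a highest weight vector. -/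

section Module

variable {M : Type} [AddCommGroup M] [Module U M]

/-- The series all of whose coefficients kill `v`. -/
def serAnn (v : M) : Submodule US US where
  carrier := {F | ∀ d, PowerSeries.coeff d F • v = 0}
  zero_mem' d := by simp
  add_mem' {F G} hF hG d := by rw [map_add, add_smul, hF d, hG d, add_zero]
  smul_mem' c F hF d := by
    rw [smul_eq_mul, PowerSeries.coeff_mul, Finset.sum_smul]
    exact Finset.sum_eq_zero fun p _ => by rw [mul_smul, hF, smul_zero]

theorem smul_mem_serAnn {v : M} {F : US} (c : ℂ) (h : F ∈ serAnn v) : c • F ∈ serAnn v := by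
  rw [Algebra.smul_def]
  exact (serAnn v).smul_mem _ h

theorem mem_serAnn_of_smul {v : M} {F : US} {c : ℂ} (hc : c ≠ 0) (h : c • F ∈ serAnn v) :
    F ∈ serAnn v := by
  have := smul_mem_serAnn c⁻¹ h
  rwa [smul_smul, inv_mul_cancel₀ hc, one_smul] at this

theorem serH_mem {v : M} (hv : ∀ j, toU (hDiag (j + 1)) • v = 0) : serH ∈ serAnn v := by
  intro d
  rw [serH, PowerSeries.coeff_mk, hDeg]
  split_ifs with h
  · obtain ⟨k, hk⟩ : ∃ k, d / 2 = k + 1 := ⟨d / 2 - 1, by omega⟩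
    rw [hk, Algebra.smul_def, mul_smul, hv, smul_zero]
  · rw [smul_zero, zero_smul]

theorem serX_mem {v : M} (hv : toU (xOdd 0) • v = 0) : serX ∈ serAnn v := by
  intro d
  rw [serX, PowerSeries.coeff_mk]
  split_ifs with h
  · rw [Algebra.smul_def, mul_smul, hv, smul_zero]
  · rw [zero_smul]

/-- The series `serH` is moved through the exponential until it meets `v`, which it kills. The
corrections close up into this form because `[R, serY]`, for `R = euler serY - 2 serN`, is a
multiple of `euler serF`, which commutes with `serY` and `serF`. -/
theorem serH_garland {v : M} (hv : ∀ j, toU (hDiag (j + 1)) • v = 0) (w : ℕ) :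
    serH * garland (w + 2) - (euler (garland (w + 2)) +
      (euler serY - (2 : ℂ) • serN) * garland (w + 1) + (2 : ℂ) • (euler serF * garland w)) ∈
      serAnn v := by
  induction w using Nat.strong_induction_on with
  | _ w ih =>
  match w, ih with
  | 0, _ => simp [garland]
  | 1, _ => simp [garland]
  | 2, _ => simpa [garland, euler_one] using serH_mem hv
  | w + 3, ih =>
    have h1 := ih (w + 2) (by omega)
    have h0 := ih (w + 1) (by omega)
    have hw : (w : ℂ) + 1 ≠ 0 := Nat.cast_add_one_ne_zero w
    -- Multiplication by the weight makes the recursion for `garland (w + 5)` applicable.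
    refine mem_serAnn_of_smul hw ?_
    have r4 := garland_rec (w + 3)
    have r3 := garland_rec (w + 2)
    have r2 := garland_rec (w + 1)
    have e4 := congrArg euler r4
    simp only [map_smul, map_add, euler_mul] at e4
    have c1 := serH_serY
    have c2 := serH_serF
    have c3 := serR_serY
    have c4 := commute_serF_serY.eq
    have c5 := commute_serF_serN.eq
    have c6 := commute_serF_euler_serY.eq
    have c7 := commute_serY_euler_serF.eq
    have c8 := commute_serF_euler_serF.eq
    simp only [show w + 3 + 2 = w + 5 from rfl, show w + 3 + 1 = w + 4 from rfl,
      show w + 2 + 1 = w + 3 from rfl, show w + 1 + 1 = w + 2 from rfl] at *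
    generalize garland (w + 5) = a4 at *
    generalize garland (w + 4) = a3 at *
    generalize garland (w + 3) = a2 at *
    generalize garland (w + 2) = a1 at *
    generalize garland (w + 1) = a0 at *
    generalize euler a4 = b4 at *
    generalize euler a3 = b3 at *
    generalize euler a2 = b2 at *
    generalize euler serF = e' at *
    generalize euler serY = P' at *
    generalize serF = e at *
    generalize serY = P at *
    generalize serN = N at *
    generalize serH = H at *
    -- The annihilator is a left ideal, so `P` times one earlier case plus `2 e` times the other
    -- lies in it; up to commutators this is the claim.
    have key := (serAnn v).add_mem ((serAnn v).smul_mem P h1)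
      (smul_mem_serAnn (2 : ℂ) ((serAnn v).smul_mem e h0))
    convert key using 1
    simp only [smul_eq_mul]
    push_cast at r4 r3 r2 e4
    rw [show (w : ℂ) + 3 - 2 = w + 1 by ring] at r4 e4
    rw [show (w : ℂ) + 2 - 2 = w by ring] at r3
    rw [show (w : ℂ) + 1 - 2 = w - 1 by ring] at r2
    have s3 : ((w : ℂ) + 1) • a3 = a3 + P * a2 + (2 : ℂ) • (e * a1) := by
      rw [add_smul, one_smul, r3]; abel
    have s2 : ((w : ℂ) + 1) • a2 = (2 : ℂ) • a2 + P * a1 + (2 : ℂ) • (e * a0) := by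
      rw [show (w : ℂ) + 1 = 2 + (w - 1) by ring, add_smul, r2]; abel
    have t1 : ((w : ℂ) + 1) • (H * a4) = H * (P * a3 + (2 : ℂ) • (e * a2)) := by
      rw [← mul_smul_comm, r4]
    have t2 : ((w : ℂ) + 1) • ((P' - (2 : ℂ) • N) * a3) =
        (P' - (2 : ℂ) • N) * (a3 + P * a2 + (2 : ℂ) • (e * a1)) := by
      rw [← mul_smul_comm, s3]
    have t3 : ((w : ℂ) + 1) • ((2 : ℂ) • (e' * a2)) =
        (2 : ℂ) • (e' * ((2 : ℂ) • a2 + P * a1 + (2 : ℂ) • (e * a0))) := by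
      rw [smul_comm, ← mul_smul_comm, s2]
    rw [smul_sub, smul_add, smul_add, t1, e4, t2, t3]
    have d1 : H * P = P * H + (2 : ℂ) • (P' - N) := by rw [← c1]; abel
    have d2 : H * e = e * H + e' := by rw [← c2]; abel
    have d3 : (P' - (2 : ℂ) • N) * P = P * (P' - (2 : ℂ) • N) + (-4 : ℂ) • e' := by rw [← c3]; abel
    have d3' : (P' - (2 : ℂ) • N) * e = e * (P' - (2 : ℂ) • N) := by
      rw [sub_mul, mul_sub, smul_mul_assoc, mul_smul_comm, c5, c6]
    have e1 : H * (P * a3) = P * (H * a3) + (2 : ℂ) • (P' * a3 - N * a3) := by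
      rw [← mul_assoc, d1, add_mul, smul_mul_assoc, sub_mul, mul_assoc]
    have e2 : H * (e * a2) = e * (H * a2) + e' * a2 := by
      rw [← mul_assoc, d2, add_mul, mul_assoc]
    have e3 : (P' - (2 : ℂ) • N) * (P * a2) =
        P * ((P' - (2 : ℂ) • N) * a2) + (-4 : ℂ) • (e' * a2) := by
      rw [← mul_assoc, d3, add_mul, smul_mul_assoc, mul_assoc]
    have e5 : (P' - (2 : ℂ) • N) * (e * a1) = e * ((P' - (2 : ℂ) • N) * a1) := by
      rw [← mul_assoc, d3', mul_assoc]
    have e6 : e' * (P * a1) = P * (e' * a1) := by rw [← mul_assoc, ← c7, mul_assoc]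
    have e7 : e' * (e * a0) = e * (e' * a0) := by rw [← mul_assoc, ← c8, mul_assoc]
    simp only [mul_add, mul_sub, mul_smul_comm, e1, e2, e3, e5, e6, e7]
    simp only [sub_mul, smul_mul_assoc, mul_sub, mul_smul_comm]
    module

/-- Moving `x_{1/2}` through a factor `serY` leaves `serH`, through `serF` it leaves `serN`. Once
`serH_garland` evaluates the former, the terms with `serN` cancel and only the Euler derivative
remains. -/
theorem serX_garland {v : M} (hx : toU (xOdd 0) • v = 0)
    (hv : ∀ j, toU (hDiag (j + 1)) • v = 0) (w : ℕ) :
    serX * garland (w + 1) - euler (garland w) ∈ serAnn v := by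
  induction w using Nat.strong_induction_on with
  | _ w ih =>
  match w, ih with
  | 0, _ => simp [garland]
  | 1, _ => simp [garland]
  | 2, _ => simp [garland]
  | 3, _ => simpa [garland] using serX_mem hx
  | w + 4, ih =>
    have h1 := ih (w + 3) (by omega)
    have h0 := ih (w + 2) (by omega)
    have hh := serH_garland hv (w + 2)
    have hw : (w : ℂ) + 1 ≠ 0 := Nat.cast_add_one_ne_zero w
    refine mem_serAnn_of_smul hw ?_
    have r4 := garland_rec (w + 3)
    have r3 := garland_rec (w + 2)
    have e3 := congrArg euler r3
    simp only [map_smul, map_add, euler_mul] at e3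
    have c1 := serX_serY
    have c2 := serX_serF
    simp only [show w + 3 + 2 = w + 5 from rfl, show w + 3 + 1 = w + 4 from rfl,
      show w + 2 + 1 = w + 3 from rfl] at *
    generalize garland (w + 5) = a4 at *
    generalize garland (w + 4) = a3 at *
    generalize garland (w + 3) = a2 at *
    generalize garland (w + 2) = a1 at *
    generalize euler a3 = b3 at *
    generalize euler a2 = b2 at *
    generalize euler a1 = b1 at *
    generalize euler serF = e' at *
    generalize euler serY = P' at *
    generalize serF = e at *
    generalize serY = P at *
    generalize serN = N at *
    generalize serH = H at *
    generalize serX = Z at *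
    have key := (serAnn v).add_mem ((serAnn v).add_mem ((serAnn v).smul_mem P h1)
      (smul_mem_serAnn (2 : ℂ) ((serAnn v).smul_mem e h0))) hh
    convert key using 1
    simp only [smul_eq_mul]
    push_cast at r4 r3 e3
    rw [show (w : ℂ) + 3 - 2 = w + 1 by ring] at r4
    rw [show (w : ℂ) + 2 - 2 = w by ring] at e3
    have s3 : ((w : ℂ) + 1) • b3 = b3 + (P' * a2 + P * b2) + (2 : ℂ) • (e' * a1 + e * b1) := by
      rw [add_smul, one_smul, e3]; abel
    rw [smul_sub, ← mul_smul_comm, r4, s3]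
    have d1 : Z * P = P * Z + H := by rw [← c1]; abel
    have d2 : Z * e = e * Z + N := by rw [← c2]; abel
    have e1 : Z * (P * a3) = P * (Z * a3) + H * a3 := by
      rw [← mul_assoc, d1, add_mul, mul_assoc]
    have e2 : Z * (e * a2) = e * (Z * a2) + N * a2 := by
      rw [← mul_assoc, d2, add_mul, mul_assoc]
    simp only [mul_add, mul_sub, mul_smul_comm, e1, e2, sub_mul, smul_mul_assoc]
    module

/-- The vector `x_{1/2}^(d) y₀^((w+d)/2) v` up to a scalar, as a sum of monomials in the `y`. -/
theorem coeff_garland_smul_eq_zero {v : M} {n : ℕ} (hx : toU (xOdd 0) • v = 0)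
    (hv : ∀ j, toU (hDiag (j + 1)) • v = 0) (hf : toU (yEven 0) ^ (n + 1) • v = 0)
    (d w : ℕ) (h : 2 * n < w + d) (hpar : Even (w + d)) :
    PowerSeries.coeff d (garland (w + 4)) • v = 0 := by
  induction d generalizing w with
  | zero =>
    -- In degree zero only `y₀` contributes, so the component of weight `2r` starts with a divided
    -- power of `y₀`.
    have h0 : ∀ r, PowerSeries.coeff 0 (garland (2 * r + 4)) =
        ((r.factorial : ℂ)⁻¹) • toU (yEven 0) ^ r := by
      intro r
      induction r with
      | zero => simp [garland]
      | succ r ih =>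
        have hr := congrArg (PowerSeries.coeff 0) (garland_rec (2 * r + 4))
        rw [PowerSeries.coeff_smul, map_add, PowerSeries.coeff_smul, PowerSeries.coeff_mul,
          PowerSeries.coeff_mul] at hr
        simp only [Finset.HasAntidiagonal.antidiagonal_zero,
          Finset.sum_singleton, ih] at hr
        rw [serY, serF, PowerSeries.coeff_mk, PowerSeries.coeff_mk,
          show yDeg 0 = 0 from yDeg_even 0, show fDeg 0 = toU (yEven 0) from fDeg_four 0,
          smul_zero, zero_mul, zero_add, mul_smul_comm, ← pow_succ'] at hr
        have hr0 : ((r : ℂ) + 1) ≠ 0 := Nat.cast_add_one_ne_zero r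
        have hr1 : (r.factorial : ℂ) ≠ 0 := Nat.cast_ne_zero.2 r.factorial_ne_zero
        push_cast at hr
        rw [show (2 : ℂ) * r + 4 - 2 = 2 * (r + 1) by ring, mul_smul] at hr
        have hr' := smul_right_injective U (two_ne_zero : (2 : ℂ) ≠ 0) hr
        rw [show 2 * (r + 1) + 4 = 2 * r + 4 + 2 by ring, ← one_smul ℂ (PowerSeries.coeff 0 _),
          ← inv_mul_cancel₀ hr0, mul_smul, hr', smul_smul]
        congr 1
        rw [Nat.factorial_succ]
        push_cast
        field_simp
    obtain ⟨r, hr⟩ := hpar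
    obtain rfl : w = 2 * r := by omega
    obtain ⟨s, rfl⟩ : ∃ s, r = s + (n + 1) := ⟨r - (n + 1), by omega⟩
    rw [h0, Algebra.smul_def, mul_smul, pow_add, mul_smul, hf, smul_zero, smul_zero]
  | succ d ih =>
    have h1 := ih (w + 1) (by omega) (by rwa [show w + 1 + d = w + (d + 1) by ring])
    -- In degree `d + 1`: `x_{1/2}` sends the coefficient of degree `d` and weight `w + 1`, applied
    -- to `v`, to a nonzero multiple of that of degree `d + 1` and weight `w`. The sum of degree and
    -- weight is unchanged.
    have h2 := serX_garland hx hv (w + 4) (d + 1)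
    rw [map_sub, sub_smul, sub_eq_zero, coeff_euler, PowerSeries.coeff_mul,
      Finset.sum_eq_single (1, d)] at h2
    · rw [serX, PowerSeries.coeff_mk, if_pos rfl, mul_smul,
        show w + 4 + 1 = w + 1 + 4 by ring, h1, smul_zero, Algebra.smul_def, mul_smul] at h2
      have hd : ((d + 1 : ℕ) : ℂ) ≠ 0 := Nat.cast_ne_zero.2 (by omega)
      rw [← one_smul U (PowerSeries.coeff (d + 1) (garland (w + 4)) • v),
        ← map_one (algebraMap ℂ U), ← inv_mul_cancel₀ hd, map_mul, mul_smul, ← h2, smul_zero]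
    · rintro ⟨i, j⟩ hp hne
      rw [serX, PowerSeries.coeff_mk, if_neg, zero_mul]
      rintro h
      simp only at h
      subst h
      apply hne
      have := Finset.HasAntidiagonal.mem_antidiagonal.1 hp
      simp only at this
      rw [Prod.mk.injEq]; omega
    · intro h
      exact absurd (Finset.HasAntidiagonal.mem_antidiagonal.2 (by simp only; omega)) h

end Module

/-! ### Normal ordering of the exponential series at degree `2k`. -/

/-- The part of `serY` of degree less than `2k`. -/
def serLow (k : ℕ) : US := PowerSeries.mk fun d => if d < 2 * k then kap • yDeg d else 0

/-- The part of `serY` of degree at least `2k`. -/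
def serTop (k : ℕ) : US := PowerSeries.mk fun d => if d < 2 * k then 0 else kap • yDeg d

/-- The coefficients of the commutator of `serTop` and `serLow`. -/
def topLowCoeff (k d : ℕ) : ℂ := ∑ p ∈ Finset.HasAntidiagonal.antidiagonal d,
  if 2 * k ≤ p.1 ∧ p.2 < 2 * k then kap * kap * yyCoeff p.1 else 0

theorem serTop_serLow (k : ℕ) : serTop k * serLow k - serLow k * serTop k =
    PowerSeries.mk fun d => topLowCoeff k d • fDeg d := by
  ext d
  rw [serTop, serLow, coeff_commutator, PowerSeries.coeff_mk, topLowCoeff, Finset.sum_smul]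
  refine Finset.sum_congr rfl fun p hp => ?_
  by_cases h1 : p.1 < 2 * k
  · simp [h1, not_le.2 h1]
  · rw [if_neg h1]
    by_cases h2 : p.2 < 2 * k
    · rw [if_pos h2, if_pos (by omega), smul_mul_smul_comm, smul_mul_smul_comm, ← smul_sub,
        yDeg_yDeg, smul_smul, Finset.HasAntidiagonal.mem_antidiagonal.1 hp]
    · rw [if_neg h2, if_neg (by omega)]; simp

theorem serY_eq (k : ℕ) : serY = serLow k + serTop k := by
  ext d
  rw [serY, serLow, serTop, map_add, PowerSeries.coeff_mk, PowerSeries.coeff_mk,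
    PowerSeries.coeff_mk]
  split_ifs <;> simp

theorem commute_of_fDeg_coeff (z : ℕ → ℂ) : Commute serY (PowerSeries.mk fun d => z d • fDeg d) ∧
    Commute serF (PowerSeries.mk fun d => z d • fDeg d) := by
  constructor
  · refine commute_of_coeff fun i j => ?_
    rw [serY, PowerSeries.coeff_mk, PowerSeries.coeff_mk]
    exact (((commute_fDeg_yDeg j i).symm.smul_left _).smul_right _)
  · refine commute_of_coeff fun i j => ?_
    rw [serF, PowerSeries.coeff_mk, PowerSeries.coeff_mk]
    exact (commute_fDeg_fDeg i j).smul_right _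

theorem garland_mem_of_commute (Z : US) (hY : Commute serY Z) (hF : Commute serF Z) (w : ℕ) :
    Commute (garland w) Z := by
  induction w using Nat.strong_induction_on with
  | _ w ih =>
  match w, ih with
  | 0, _ => simp [garland]
  | 1, _ => simp [garland]
  | 2, _ => simp [garland]
  | 3, _ => simp [garland]
  | 4, _ => simp [garland]
  | w + 5, ih =>
    rw [garland]
    exact ((hY.mul_left (ih _ (by omega))).add_left
      ((hF.mul_left (ih _ (by omega))).smul_left _)).smul_left _

/-- As `serY = serLow + serTop`, the commutator of `serY` with `serLow k` is `[serTop, serLow]`. It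
is a series in the elements `fDeg`, hence central among the lowering operators, and so it factors
out of the commutator with the exponential. -/
theorem garland_commutator (k w : ℕ) : garland (w + 1) * serLow k - serLow k * garland (w + 1) =
    (serTop k * serLow k - serLow k * serTop k) * garland w := by
  have hZ := serTop_serLow k
  obtain ⟨hY, hF⟩ := commute_of_fDeg_coeff (topLowCoeff k)
  rw [← hZ] at hY hF
  have hPL : serY * serLow k =
      serLow k * serY + (serTop k * serLow k - serLow k * serTop k) := by
    rw [serY_eq k]; noncomm_ring
  have heL : serF * serLow k = serLow k * serF := by
    refine (commute_of_coeff fun i j => ?_ : Commute serF (serLow k))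
    rw [serF, serLow, PowerSeries.coeff_mk, PowerSeries.coeff_mk]
    split_ifs
    · exact (commute_fDeg_yDeg i j).smul_right _
    · exact Commute.zero_right _
  generalize serTop k * serLow k - serLow k * serTop k = Z at *
  induction w using Nat.strong_induction_on with
  | _ w ih =>
  match w, ih with
  | 0, _ => simp [garland]
  | 1, _ => simp [garland]
  | 2, _ => simp [garland]
  | 3, _ => simp [garland]
  | w + 4, ih =>
    have h1 := ih (w + 3) (by omega)
    have h0 := ih (w + 2) (by omega)
    have hw : (w : ℂ) + 1 ≠ 0 := Nat.cast_add_one_ne_zero w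
    have r4 := garland_rec (w + 3)
    have r3 := garland_rec (w + 2)
    simp only [show w + 3 + 2 = w + 5 from rfl, show w + 3 + 1 = w + 4 from rfl,
      show w + 2 + 1 = w + 3 from rfl] at *
    generalize garland (w + 5) = a4 at *
    generalize garland (w + 4) = a3 at *
    generalize garland (w + 3) = a2 at *
    generalize garland (w + 2) = a1 at *
    generalize serF = e at *
    generalize serY = P at *
    generalize serLow k = L at *
    push_cast at r4 r3
    rw [show (w : ℂ) + 3 - 2 = w + 1 by ring] at r4
    rw [show (w : ℂ) + 2 - 2 = w by ring] at r3
    have s3 : ((w : ℂ) + 1) • a3 = a3 + P * a2 + (2 : ℂ) • (e * a1) := by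
      rw [add_smul, one_smul, r3]; abel
    refine smul_right_injective US hw ?_
    change ((w : ℂ) + 1) • _ = ((w : ℂ) + 1) • _
    have t3 : ((w : ℂ) + 1) • (Z * a3) = Z * (a3 + P * a2 + (2 : ℂ) • (e * a1)) := by
      rw [← mul_smul_comm, s3]
    rw [smul_sub, ← smul_mul_assoc, ← mul_smul_comm, r4, t3]
    have d1 : a3 * L = L * a3 + Z * a2 := by rw [← h1]; abel
    have d0 : a2 * L = L * a2 + Z * a1 := by rw [← h0]; abel
    have e1 : P * a3 * L = L * (P * a3) + Z * a3 + Z * (P * a2) := by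
      rw [mul_assoc, d1, mul_add, ← mul_assoc, hPL, ← mul_assoc P, hY.eq]; noncomm_ring
    have e2 : e * a2 * L = L * (e * a2) + Z * (e * a1) := by
      rw [mul_assoc, d0, mul_add, ← mul_assoc, heL, ← mul_assoc e, hF.eq]; noncomm_ring
    simp only [add_mul, mul_add, smul_mul_assoc, mul_smul_comm, e1, e2]
    module

/-- The coefficients of the even part of the splitting of the exponential series. -/
def splitCoeff (k d : ℕ) : ℂ := 2 + topLowCoeff k d

/-- Odd operators of degree at least `2k` go to the right and the others to the left; the price is a
change of the even series. On the right, a truncated vector kills nearly all of them. -/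
theorem garland_split (k w : ℕ) : ((w : ℂ) - 2) • garland (w + 2) =
    garland (w + 1) * serTop k + serLow k * garland (w + 1) +
      (PowerSeries.mk fun d => splitCoeff k d • fDeg d) * garland w := by
  have h1 := garland_commutator k w
  have hY : Commute (garland (w + 1)) serY :=
    garland_mem_of_commute _ (Commute.refl _) commute_serF_serY _
  have h2 : (PowerSeries.mk fun d => splitCoeff k d • fDeg d) =
      (2 : ℂ) • serF + (serTop k * serLow k - serLow k * serTop k) := by
    rw [serTop_serLow]
    ext d
    rw [PowerSeries.coeff_mk, map_add, PowerSeries.coeff_smul, serF, PowerSeries.coeff_mk,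
      PowerSeries.coeff_mk, splitCoeff, add_smul]
  rw [garland_rec, h2, add_mul, ← h1, smul_mul_assoc, ← hY.eq, serY_eq k]
  noncomm_ring

theorem sum_yyCoeff_range (k m : ℕ) : ∑ i ∈ Finset.range (2 * m), yyCoeff (2 * k + 1 + i) =
    2 * Complex.I ^ (2 * k + 1) * ∑ i ∈ Finset.range m, (-1) ^ i := by
  induction m with
  | zero => simp
  | succ m ih =>
    rw [show 2 * (m + 1) = 2 * m + 1 + 1 by ring, Finset.sum_range_succ, Finset.sum_range_succ, ih,
      Finset.sum_range_succ, yyCoeff, yyCoeff, if_pos (by omega), if_neg (by omega), pow_add _ _ (2 * m),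
      pow_mul _ 2 m, Complex.I_sq]
    ring

/-- The brackets contribute an alternating sum of `k` signs. The value is `2` for even `k` and `2 -
4 = -2` for odd `k`. -/
theorem splitCoeff_ne_zero (k : ℕ) : splitCoeff k (4 * k) ≠ 0 := by
  rw [splitCoeff, topLowCoeff, Finset.Nat.sum_antidiagonal_eq_sum_range_succ_mk]
  rw [show (4 * k).succ = (2 * k + 1) + 2 * k by omega, Finset.sum_range_add,
    Finset.sum_eq_zero, zero_add]
  · have : ∀ x ∈ Finset.range (2 * k), (if 2 * k ≤ 2 * k + 1 + x ∧ 4 * k - (2 * k + 1 + x) < 2 * k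
        then kap * kap * yyCoeff (2 * k + 1 + x) else 0) =
        kap * kap * yyCoeff (2 * k + 1 + x) := by
      intro x hx
      have := Finset.mem_range.1 hx
      rw [if_pos (by omega)]
    rw [Finset.sum_congr rfl this, ← Finset.mul_sum, sum_yyCoeff_range, kap_mul_kap,
      neg_one_geom_sum]
    split_ifs with h
    · simp
    · have h' : (-1 : ℂ) ^ k = -1 := (Nat.not_even_iff_odd.1 h).neg_one_pow
      rw [pow_succ, pow_mul, Complex.I_sq, h']
      have := Complex.I_mul_I
      rw [show 2 + -2 * Complex.I * (2 * (-1 * Complex.I) * 1) =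
        2 + 4 * (Complex.I * Complex.I) by ring, this]
      norm_num
  · intro x hx
    have := Finset.mem_range.1 hx
    rw [if_neg (by omega)]

theorem commute_coeff_garland_fDeg (w d i : ℕ) :
    Commute (PowerSeries.coeff d (garland w)) (fDeg i) := by
  have := garland_mem_of_commute (PowerSeries.C (fDeg i))
    (commute_of_coeff fun a b => by
      rw [serY, PowerSeries.coeff_mk, PowerSeries.coeff_C]
      split_ifs
      · exact (commute_fDeg_yDeg i a).symm.smul_left _
      · exact Commute.zero_right _)
    (commute_of_coeff fun a b => by
      rw [serF, PowerSeries.coeff_mk, PowerSeries.coeff_C]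
      split_ifs
      · exact commute_fDeg_fDeg a i
      · exact Commute.zero_right _) w
  have h := congrArg (PowerSeries.coeff d) this.eq
  rwa [PowerSeries.coeff_mul_C, PowerSeries.coeff_C_mul] at h

section Module

variable {M : Type} [AddCommGroup M] [Module U M] [Module ℂ M] [IsScalarTower ℂ U M]

/-- Among the odd operators that stand on the right only `yOdd k` does not kill `u`. Even operators
commute with the series, so those of degree above `4k` also reach `u` and vanish, and the one of
degree `4k` may be placed on the right. -/
theorem garland_step (k w d : ℕ) (u : M) (hO : ∀ j, k < j → toU (yOdd j) • u = 0)
    (hE : ∀ j, k < j → toU (yEven j) • u = 0) :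
    (w : ℂ) • (PowerSeries.coeff d (garland (w + 4)) • u) =
      (if 2 * k + 1 ≤ d then kap • (PowerSeries.coeff (d - (2 * k + 1)) (garland (w + 3)) •
        toU (yOdd k) • u) else 0) +
      (∑ p ∈ Finset.HasAntidiagonal.antidiagonal d, if p.1 < 2 * k then
        kap • yDeg p.1 • PowerSeries.coeff p.2 (garland (w + 3)) • u else 0) +
      ((if 4 * k ≤ d then splitCoeff k (4 * k) • (PowerSeries.coeff (d - 4 * k) (garland (w + 2)) •
        toU (yEven k) • u) else 0) +
      ∑ p ∈ Finset.HasAntidiagonal.antidiagonal d, if p.1 < 4 * k then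
        splitCoeff k p.1 • fDeg p.1 • PowerSeries.coeff p.2 (garland (w + 2)) • u else 0) := by
  have h := congrArg (fun F => PowerSeries.coeff d F • u) (garland_split k (w + 2))
  simp only [map_add, PowerSeries.coeff_smul, add_smul, smul_assoc] at h
  rw [show ((w + 2 : ℕ) : ℂ) - 2 = w by push_cast; ring] at h
  rw [h]
  clear h
  congr 1
  congr 1
  · rw [PowerSeries.coeff_mul, Finset.sum_smul]
    have h0 : ∀ p ∈ Finset.HasAntidiagonal.antidiagonal d, p.2 ≠ 2 * k + 1 →
        (PowerSeries.coeff p.1 (garland (w + 2 + 1)) * PowerSeries.coeff p.2 (serTop k)) • u = 0 := by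
      intro p _ hp
      rw [mul_smul, serTop, PowerSeries.coeff_mk]
      split_ifs
      · simp
      · rcases Nat.even_or_odd' p.2 with ⟨j, hj | hj⟩
        · rw [hj, yDeg_even]; simp
        · rw [hj, yDeg_odd, smul_assoc, hO j (by omega)]; simp
    split_ifs with hd
    · rw [Finset.sum_eq_single (d - (2 * k + 1), 2 * k + 1)]
      · rw [mul_smul, serTop, PowerSeries.coeff_mk, if_neg (by omega), yDeg_odd, smul_assoc,
          ← algebraMap_smul U kap (toU (yOdd k) • u), ← mul_smul, ← Algebra.commutes, mul_smul,
          algebraMap_smul]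
      · intro p hp hne
        refine h0 p hp fun h' => hne ?_
        have := Finset.HasAntidiagonal.mem_antidiagonal.1 hp
        exact Prod.ext (by simp only; omega) h'
      · intro h'
        exact absurd (Finset.HasAntidiagonal.mem_antidiagonal.2 (by simp only; omega)) h'
    · refine Finset.sum_eq_zero fun p hp => h0 p hp ?_
      have := Finset.HasAntidiagonal.mem_antidiagonal.1 hp
      omega
  · rw [PowerSeries.coeff_mul, Finset.sum_smul]
    refine Finset.sum_congr rfl fun p _ => ?_
    rw [serLow, PowerSeries.coeff_mk]
    split_ifs
    · rw [smul_mul_assoc, smul_assoc, mul_smul]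
    · rw [zero_mul, zero_smul]
  · rw [PowerSeries.coeff_mul, Finset.sum_smul]
    have h1 : ∀ p : ℕ × ℕ, 4 * k < p.1 → fDeg p.1 • PowerSeries.coeff p.2 (garland (w + 2)) • u = 0 := by
      intro p hp
      rw [← mul_smul, ← (commute_coeff_garland_fDeg _ _ _).eq, mul_smul]
      by_cases h4 : p.1 % 4 = 0
      · obtain ⟨j, hj⟩ : ∃ j, p.1 = 4 * j := ⟨p.1 / 4, by omega⟩
        rw [hj, fDeg_four, hE j (by omega), smul_zero]
      · rw [fDeg_eq_zero h4]; simp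
    have h2 : ∀ p ∈ Finset.HasAntidiagonal.antidiagonal d,
        (PowerSeries.coeff p.1 (PowerSeries.mk fun d => splitCoeff k d • fDeg d) *
          PowerSeries.coeff p.2 (garland (w + 2))) • u =
        (if p.1 = 4 * k then splitCoeff k (4 * k) • fDeg (4 * k) •
          PowerSeries.coeff p.2 (garland (w + 2)) • u else 0) + if p.1 < 4 * k then
        splitCoeff k p.1 • fDeg p.1 • PowerSeries.coeff p.2 (garland (w + 2)) • u else 0 := by
      intro p _
      rw [PowerSeries.coeff_mk, smul_mul_assoc, smul_assoc, mul_smul]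
      rcases lt_trichotomy p.1 (4 * k) with h | h | h
      · rw [if_neg (by omega), if_pos h, zero_add]
      · rw [if_pos h, if_neg (by omega), add_zero, h]
      · rw [if_neg (by omega), if_neg (by omega), h1 p h, smul_zero, add_zero]
    rw [Finset.sum_congr rfl h2, Finset.sum_add_distrib]
    congr 1
    split_ifs with hd
    · rw [Finset.sum_eq_single (4 * k, d - 4 * k)]
      · rw [if_pos rfl, ← mul_smul (fDeg _), ← (commute_coeff_garland_fDeg _ _ _).eq, mul_smul,
          fDeg_four]
      · intro p hp hne
        refine if_neg fun h' => hne ?_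
        have := Finset.HasAntidiagonal.mem_antidiagonal.1 hp
        exact Prod.ext h' (by simp only; omega)
      · intro h'
        exact absurd (Finset.HasAntidiagonal.mem_antidiagonal.2 (by simp only; omega)) h'
    · refine Finset.sum_eq_zero fun p hp => if_neg ?_
      have := Finset.HasAntidiagonal.mem_antidiagonal.1 hp
      omega

end Module

/-! ### Primitive vectors and the extreme lowering operators. -/

section Module

variable {M : Type} [AddCommGroup M] [Module U M] [Module ℂ M] [IsScalarTower ℂ U M]

theorem smul_smul_comm' (c : ℂ) (u : U) (m : M) : u • c • m = c • u • m := by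
  rw [← algebraMap_smul U c m, ← mul_smul, ← Algebra.commutes, mul_smul, algebraMap_smul]

theorem toU_smul_smul (a b : CG) (m : M) :
    toU a • toU b • m = toU b • toU a • m + toU ⁅a, b⁆ • m := by
  rw [toU_lie, sub_smul, mul_smul, mul_smul]; abel

theorem toU_smul_of_lie_eq {a b z : CG} {c : ℂ} (h : ⁅a, b⁆ = c • z) (m : M) :
    toU a • toU b • m = toU b • toU a • m + c • toU z • m := by
  rw [toU_smul_smul, h, toU_smul, smul_assoc]

/-- A vector killed by `𝔠𝔫⁺` and `𝔠𝔥₊`, of weight `μ`. -/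
structure IsPrim (μ : ℂ) (v : M) : Prop where
  xOdd : ∀ k, toU (xOdd k) • v = 0
  xEven : ∀ k, toU (xEven k) • v = 0
  hDiag : ∀ k, toU (hDiag (k + 1)) • v = 0
  weight : toU h0 • v = μ • v

/-- A generator of an integrable module with weight `n`. -/
structure IsHW (n : ℕ) (v : M) : Prop extends IsPrim (n : ℂ) v where
  integrable : toU (yEven 0) ^ (n + 1) • v = 0

/-- A vector killed by the lowering operators beyond the index `k`. -/
structure Trunc (k : ℕ) (v : M) : Prop where
  odd : ∀ j, k < j → toU (yOdd j) • v = 0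
  even : ∀ j, k < j → toU (yEven j) • v = 0

theorem Trunc.mono {k l : ℕ} {v : M} (h : Trunc k v) (hkl : k ≤ l) : Trunc l v :=
  ⟨fun j hj => h.odd j (by omega), fun j hj => h.even j (by omega)⟩

/-- The brackets with `hDiag 1` and `hDiag 2`, which kill `v`, raise the index of `yOdd` and of
`yEven` by one, so one vanishing propagates upwards. -/
theorem IsPrim.trunc {μ : ℂ} {v : M} (hv : IsPrim μ v) {k : ℕ}
    (ho : toU (yOdd (k + 1)) • v = 0) (he : toU (yEven (k + 1)) • v = 0) : Trunc k v := by
  constructor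
  · intro j hj
    obtain ⟨i, rfl⟩ : ∃ i, j = k + 1 + i := ⟨j - (k + 1), by omega⟩
    induction i with
    | zero => exact ho
    | succ i ih =>
      have := toU_smul_of_lie_eq (lie_hDiag_yOdd 1 (k + 1 + i)) v
      rw [ih (by omega), smul_zero, hv.hDiag 0, smul_zero, zero_add] at this
      have h3 : (-(2 - (-1) ^ 1) : ℂ) ≠ 0 := by norm_num
      exact (smul_eq_zero.1 this.symm).resolve_left h3
  · intro j hj
    obtain ⟨i, rfl⟩ : ∃ i, j = k + 1 + i := ⟨j - (k + 1), by omega⟩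
    induction i with
    | zero => exact he
    | succ i ih =>
      have := toU_smul_of_lie_eq (lie_hDiag_even_yEven 1 (k + 1 + i)) v
      rw [ih (by omega), smul_zero, hv.hDiag 1, smul_zero, zero_add] at this
      exact (smul_eq_zero.1 this.symm).resolve_left (by norm_num)

theorem Trunc.yOdd_smul {k : ℕ} {u : M} (T : Trunc k u) : Trunc k (toU (yOdd k) • u) := by
  constructor
  · intro j hj
    rcases Nat.even_or_odd (j + k) with h | ⟨m, hm⟩
    · rw [toU_smul_smul, lie_yOdd_yOdd_of_even _ _ h, toU_zero, zero_smul, T.odd j hj, smul_zero,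
        add_zero]
    · rw [toU_smul_of_lie_eq (lie_yOdd_yOdd_of_odd j k (m + 1) (by omega)), T.odd j hj, smul_zero,
        T.even (m + 1) (by omega), smul_zero, add_zero]
  · intro j hj
    rw [toU_smul_smul, lie_yEven_yOdd, toU_zero, zero_smul, T.even j hj, smul_zero, add_zero]

theorem Trunc.yEven_smul {k i : ℕ} {u : M} (T : Trunc k u) : Trunc k (toU (yEven i) • u) := by
  constructor
  · intro j hj
    rw [toU_smul_smul, ← lie_skew, lie_yEven_yOdd, neg_zero, toU_zero, zero_smul, T.odd j hj,
      smul_zero, add_zero]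
  · intro j hj
    rw [toU_smul_smul, lie_yEven_yEven, toU_zero, zero_smul, T.even j hj, smul_zero, add_zero]

/-- The brackets of `𝔠𝔫⁺` and `𝔠𝔥₊` with `yOdd k` are multiples of Cartan elements of positive
degree, of raising elements, or of some `yOdd j` with `j > k`. All of these kill `u`. -/
theorem IsPrim.yOdd_smul {k : ℕ} {μ : ℂ} {u : M} (hu : IsPrim μ u)
    (hodd : ∀ j, k < j → toU (yOdd j) • u = 0) :
    IsPrim (μ - 1) (toU (yOdd k) • u) := by
  constructor
  · intro j
    rw [toU_smul_smul, lie_xOdd_yOdd, hu.xOdd, smul_zero, zero_add, hu.hDiag]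
  · intro j
    rw [toU_smul_of_lie_eq (lie_xEven_yOdd j k), hu.xOdd, hu.xEven, smul_zero, smul_zero, add_zero]
  · intro j
    rw [toU_smul_of_lie_eq (lie_hDiag_yOdd (j + 1) k), hu.hDiag, hodd _ (by omega), smul_zero,
      smul_zero, add_zero]
  · have := toU_smul_of_lie_eq (lie_hDiag_yOdd 0 k) u
    rw [hDiag_zero, add_zero] at this
    rw [this, hu.weight, smul_smul_comm', ← add_smul]
    congr 1
    norm_num
    ring

/-- The condition `0 < k` keeps the bracket of `xEven j` with `yEven k` in positive degree, away
from `h0`. -/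
theorem IsPrim.yEven_smul {k : ℕ} {μ : ℂ} {u : M} (hu : IsPrim μ u) (T : Trunc k u) (hk : 0 < k) :
    IsPrim (μ - 2) (toU (yEven k) • u) := by
  constructor
  · intro j
    rw [toU_smul_of_lie_eq (lie_xOdd_yEven j k), hu.xOdd, T.odd _ (by omega), smul_zero, smul_zero,
      add_zero]
  · intro j
    obtain ⟨i, hi⟩ : ∃ i, 2 * (j + k) = i + 1 := ⟨2 * (j + k) - 1, by omega⟩
    rw [toU_smul_smul, lie_xEven_yEven, hi, hu.hDiag, hu.xEven, smul_zero, add_zero]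
  · intro j
    rcases Nat.even_or_odd' (j + 1) with ⟨l, h | h⟩
    · have := hu.hDiag j
      rw [h] at this ⊢
      rw [toU_smul_of_lie_eq (lie_hDiag_even_yEven l k), this, T.even _ (by omega), smul_zero,
        smul_zero, add_zero]
    · have := hu.hDiag j
      rw [h] at this ⊢
      rw [toU_smul_smul, lie_hDiag_odd_yEven, toU_zero, zero_smul, this, smul_zero, add_zero]
  · have := toU_smul_of_lie_eq (lie_hDiag_even_yEven 0 k) u
    rw [mul_zero, hDiag_zero, add_zero] at this
    rw [this, hu.weight, smul_smul_comm', ← add_smul]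
    congr 1

/-- The monomial vectors in the two extreme lowering operators. -/
def mon (k b c : ℕ) (v : M) : M := toU (yEven k) ^ b • toU (yOdd k) ^ c • v

theorem mon_zero_left (k c : ℕ) (v : M) : mon k 0 c v = toU (yOdd k) ^ c • v := by
  rw [mon, pow_zero, one_smul]

theorem mon_zero_right (k b : ℕ) (v : M) : mon k b 0 v = toU (yEven k) ^ b • v := by
  rw [mon, pow_zero, one_smul]

theorem commute_yEven_yOdd (i j : ℕ) : Commute (toU (yEven i)) (toU (yOdd j)) := by
  have := commute_fDeg_yDeg (4 * i) (2 * j + 1)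
  rwa [fDeg_four, yDeg_odd] at this

theorem commute_yEven_yEven (i j : ℕ) : Commute (toU (yEven i)) (toU (yEven j)) := by
  have := commute_fDeg_fDeg (4 * i) (4 * j)
  rwa [fDeg_four, fDeg_four] at this

theorem yEven_smul_mon (k b c : ℕ) (v : M) : toU (yEven k) • mon k b c v = mon k (b + 1) c v := by
  rw [mon, mon, ← mul_smul, ← pow_succ']

theorem yOdd_smul_mon (k b c : ℕ) (v : M) : toU (yOdd k) • mon k b c v = mon k b (c + 1) v := by
  rw [mon, mon, ← mul_smul, ← ((commute_yEven_yOdd k k).pow_left b).eq, mul_smul, ← mul_smul _ _ v,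
    ← pow_succ']

theorem Trunc.yOdd_pow_smul {k : ℕ} {v : M} (T : Trunc k v) (c : ℕ) :
    Trunc k (toU (yOdd k) ^ c • v) := by
  induction c with
  | zero => simpa using T
  | succ c ih => rw [pow_succ', mul_smul]; exact ih.yOdd_smul

theorem Trunc.yEven_pow_smul {k : ℕ} {v : M} (T : Trunc k v) (i b : ℕ) :
    Trunc k (toU (yEven i) ^ b • v) := by
  induction b with
  | zero => simpa using T
  | succ b ih => rw [pow_succ', mul_smul]; exact ih.yEven_smul

theorem Trunc.mon {k : ℕ} {v : M} (T : Trunc k v) (b c : ℕ) : Trunc k (mon k b c v) :=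
  (T.yOdd_pow_smul c).yEven_pow_smul k b

theorem IsPrim.yOdd_pow_smul {k : ℕ} {μ : ℂ} {v : M} (hv : IsPrim μ v) (T : Trunc k v) (c : ℕ) :
    IsPrim (μ - c) (toU (yOdd k) ^ c • v) := by
  induction c with
  | zero => simpa using hv
  | succ c ih =>
    rw [pow_succ', mul_smul]
    have := ih.yOdd_smul (T.yOdd_pow_smul c).odd
    push_cast
    rwa [← sub_sub]

theorem IsPrim.yEven_pow_smul {k : ℕ} {μ : ℂ} {v : M} (hv : IsPrim μ v) (T : Trunc k v)
    (hk : 0 < k) (b : ℕ) : IsPrim (μ - 2 * b) (toU (yEven k) ^ b • v) := by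
  induction b with
  | zero => simpa using hv
  | succ b ih =>
    rw [pow_succ', mul_smul]
    have := ih.yEven_smul (T.yEven_pow_smul k b) hk
    push_cast
    rwa [mul_add, mul_one, ← sub_sub]

theorem IsPrim.h0_smul_pow {μ : ℂ} {v : M} (hv : IsPrim μ v) (m : ℕ) :
    toU h0 • toU (yEven 0) ^ m • v = (μ - 2 * m) • toU (yEven 0) ^ m • v := by
  induction m with
  | zero => simpa using hv.weight
  | succ m ih =>
    have := toU_smul_of_lie_eq (lie_hDiag_even_yEven 0 0) (toU (yEven 0) ^ m • v)
    rw [mul_zero, hDiag_zero, add_zero] at this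
    rw [pow_succ', mul_smul, this, ih, smul_smul_comm', ← add_smul]
    congr 1
    push_cast; ring

theorem IsPrim.xEven_smul_pow {μ : ℂ} {v : M} (hv : IsPrim μ v) (m : ℕ) :
    toU (HyperspecialA22.xEven 0) • toU (yEven 0) ^ (m + 1) • v =
      ((m + 1) * (μ - m)) • toU (yEven 0) ^ m • v := by
  induction m with
  | zero =>
    rw [zero_add, pow_one, pow_zero, one_smul, toU_smul_smul, hv.xEven, smul_zero, zero_add,
      lie_xEven_yEven, add_zero, mul_zero, hDiag_zero, hv.weight]
    simp
  | succ m ih =>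
    rw [pow_succ', mul_smul, toU_smul_smul, ih, lie_xEven_yEven, add_zero, mul_zero, hDiag_zero,
      hv.h0_smul_pow, smul_smul_comm', ← mul_smul, ← pow_succ', ← add_smul]
    congr 1
    push_cast; ring

/-- Applying `xEven 0` to `y₀^(m+1) v` gives `(m+1)(μ-m) y₀^m v`, so a vanishing exponent can be
lowered as long as it does not cross `μ`. -/
theorem IsPrim.pow_smul_eq_zero {μ : ℂ} {v : M} (hv : IsPrim μ v) {m l : ℕ}
    (hm : toU (yEven 0) ^ m • v = 0) (hl : ∀ i, l ≤ i → i < m → μ ≠ i) (hlm : l ≤ m) :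
    toU (yEven 0) ^ l • v = 0 := by
  induction m with
  | zero => rwa [Nat.le_zero.1 hlm]
  | succ m ih =>
    rcases Nat.lt_or_ge m l with h | h
    · rwa [show l = m + 1 by omega]
    · refine ih ?_ (fun i h1 h2 => hl i h1 (by omega)) h
      have := hv.xEven_smul_pow m
      rw [hm, smul_zero] at this
      refine (smul_eq_zero.1 this.symm).resolve_left (mul_ne_zero (Nat.cast_add_one_ne_zero m) ?_)
      exact sub_ne_zero.2 (hl m h (by omega))

theorem IsPrim.isHW {n : ℕ} {v : M} (hv : IsPrim (n : ℂ) v) {m : ℕ}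
    (hm : toU (yEven 0) ^ m • v = 0) : IsHW n v := by
  refine ⟨hv, ?_⟩
  rcases Nat.lt_or_ge m (n + 1) with h | h
  · rw [show n + 1 = (n + 1 - m) + m by omega, pow_add, mul_smul, hm, smul_zero]
  · refine hv.pow_smul_eq_zero hm (fun i h1 _ h2 => ?_) h
    have : n = i := by exact_mod_cast h2
    omega

theorem IsHW.yOdd_pow_smul {k n : ℕ} {v : M} (hv : IsHW n v) (T : Trunc k v) {c : ℕ} (hc : c ≤ n) :
    IsHW (n - c) (toU (yOdd k) ^ c • v) := by
  refine IsPrim.isHW (m := n + 1) ?_ ?_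
  · rw [Nat.cast_sub hc]
    exact hv.toIsPrim.yOdd_pow_smul T c
  · rw [← mul_smul, ((commute_yEven_yOdd 0 k).pow_pow _ _).eq, mul_smul, hv.integrable, smul_zero]

theorem IsHW.yEven_pow_smul {k n : ℕ} {v : M} (hv : IsHW n v) (T : Trunc k v) (hk : 0 < k) {b : ℕ}
    (hb : 2 * b ≤ n) : IsHW (n - 2 * b) (toU (yEven k) ^ b • v) := by
  refine IsPrim.isHW (m := n + 1) ?_ ?_
  · rw [Nat.cast_sub hb]
    have := hv.toIsPrim.yEven_pow_smul T hk b
    push_cast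
    exact this
  · rw [← mul_smul, ((commute_yEven_yEven 0 k).pow_pow _ _).eq, mul_smul, hv.integrable, smul_zero]

/-- Otherwise the vector would be primitive of negative weight `n - c` and killed by a power of
`y₀`. -/
theorem IsHW.yOdd_pow_smul_eq_zero {k n : ℕ} {v : M} (hv : IsHW n v) (T : Trunc k v) {c : ℕ}
    (hc : n < c) : toU (yOdd k) ^ c • v = 0 := by
  have h1 := hv.toIsPrim.yOdd_pow_smul T c
  have h2 : toU (yEven 0) ^ (n + 1) • toU (yOdd k) ^ c • v = 0 := by
    rw [← mul_smul, ((commute_yEven_yOdd 0 k).pow_pow _ _).eq, mul_smul, hv.integrable, smul_zero]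
  have := h1.pow_smul_eq_zero (l := 0) h2 (fun i _ _ h => ?_) (by omega)
  · simpa using this
  · have : n = i + c := by
      have h' : (n : ℂ) = ((i + c : ℕ) : ℂ) := by push_cast; rw [← h]; ring
      exact_mod_cast h'
    omega

/-! ### Leading terms -/

/-- Call the degree of an operator minus `2k` times its drop in weight its excess. It is `1` for
`yOdd k`, `0` for `yEven k`, at most `-1` for the odd operators left in front and at most `-4` for
the even ones. Counting those in `mon k b c`, the total drop is `W` and the total excess is `R`. A
word ending in `mon k b' c' v` has a factor of drop `W - c' - 2b'` in front, whence `R ≤ c' - (W -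
c' - 2b')`; so only the monomials admitted in the hypothesis can occur. -/
theorem coeff_garland_mon_eq_zero {k : ℕ} {v : M} (T : Trunc k v) (w : ℕ) :
    ∀ (d b c : ℕ) (W R : ℤ), R = d - 2 * k * w + c → W = w + c + 2 * b →
    (∀ b' c' : ℕ, b ≤ b' → c ≤ c' → R ≤ c' → (c' + 2 * b' : ℤ) ≤ W → W + R ≤ 2 * c' + 2 * b' →
      mon k b' c' v = 0) →
    PowerSeries.coeff d (garland (w + 4)) • mon k b c v = 0 := by
  induction w using Nat.strong_induction_on with
  | _ w ih =>
  intro d b c W R hR hW hvan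
  rcases w with _ | w
  · rw [zero_add, garland, PowerSeries.coeff_one]
    split_ifs with hd
    · subst hd
      rw [one_smul]
      refine hvan b c le_rfl le_rfl ?_ ?_ ?_ <;> push_cast at * <;> linarith
    · rw [zero_smul]
  · have hw : ((w + 1 : ℕ) : ℂ) ≠ 0 := Nat.cast_ne_zero.2 (by omega)
    have hT := T.mon b c
    refine (smul_eq_zero.1 ?_).resolve_left hw
    have low : ∀ i j : ℕ, i + j = d → i < 4 * k →
        fDeg i • PowerSeries.coeff j (garland (w + 3)) • mon k b c v = 0 := by
      intro i j hij hi
      rcases w with _ | w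
      · simp [garland]
      · by_cases h4 : i % 4 = 0
        · rw [ih w (by omega) j b c (W - 2) (R + 4 * k - i), smul_zero]
          · rw [hR, ← hij]; push_cast; ring
          · rw [hW]; push_cast; ring
          · intro b' c' h1 h2 h3 h5 h6
            refine hvan b' c' h1 h2 ?_ ?_ ?_ <;> omega
        · rw [fDeg_eq_zero h4, zero_smul]
    rw [garland_step k (w + 1) d _ hT.odd hT.even, yEven_smul_mon, yOdd_smul_mon]
    rw [show w + 1 + 3 = w + 4 from rfl, show w + 1 + 2 = w + 3 from rfl]
    have t1 : (if 2 * k + 1 ≤ d then kap • PowerSeries.coeff (d - (2 * k + 1)) (garland (w + 4)) •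
        mon k b (c + 1) v else 0) = 0 := by
      split_ifs with hd
      · rw [ih w (by omega) _ b (c + 1) W R, smul_zero]
        · rw [hR]; push_cast [hd]; ring
        · rw [hW]; push_cast; ring
        · intro b' c' h1 h2
          exact hvan b' c' h1 (by omega)
      · rfl
    have t2 : (∑ p ∈ Finset.HasAntidiagonal.antidiagonal d, if p.1 < 2 * k then
        kap • yDeg p.1 • PowerSeries.coeff p.2 (garland (w + 4)) • mon k b c v else 0) = 0 := by
      refine Finset.sum_eq_zero fun p hp => ?_
      have hp := Finset.HasAntidiagonal.mem_antidiagonal.1 hp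
      split_ifs with h
      · rw [ih w (by omega) p.2 b c (W - 1) (R + 2 * k - p.1), smul_zero, smul_zero]
        · rw [hR, ← hp]; push_cast; ring
        · rw [hW]; push_cast; ring
        · intro b' c' h1 h2 h3 h5 h6
          refine hvan b' c' h1 h2 ?_ ?_ ?_ <;> omega
      · rfl
    have t3 : (if 4 * k ≤ d then splitCoeff k (4 * k) • PowerSeries.coeff (d - 4 * k)
        (garland (w + 3)) • mon k (b + 1) c v else 0) = 0 := by
      split_ifs with hd
      · rcases w with _ | w
        · simp [garland]
        · rw [ih w (by omega) _ (b + 1) c W R, smul_zero]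
          · rw [hR]; push_cast [hd]; ring
          · rw [hW]; push_cast; ring
          · intro b' c' h1 h2
            exact hvan b' c' (by omega) h2
      · rfl
    rw [t1, t2, t3, add_zero, zero_add, zero_add]
    refine Finset.sum_eq_zero fun p hp => ?_
    have hp := Finset.HasAntidiagonal.mem_antidiagonal.1 hp
    split_ifs with h
    · rw [low p.1 p.2 hp h, smul_zero]
    · rfl

/-- The coefficients of the exponential function. -/
def expCoeff (z : ℂ) (m : ℕ) : ℂ := z ^ m / m.factorial

theorem expCoeff_succ (z : ℂ) (m : ℕ) : z * expCoeff z m = (m + 1) * expCoeff z (m + 1) := by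
  have h1 : (m.factorial : ℂ) ≠ 0 := Nat.cast_ne_zero.2 m.factorial_ne_zero
  have h2 : (m : ℂ) + 1 ≠ 0 := Nat.cast_add_one_ne_zero m
  rw [expCoeff, expCoeff, Nat.factorial_succ, pow_succ]
  push_cast
  field_simp

theorem expCoeff_ne_zero {z : ℂ} (hz : z ≠ 0) (m : ℕ) : expCoeff z m ≠ 0 :=
  div_ne_zero (pow_ne_zero _ hz) (Nat.cast_ne_zero.2 m.factorial_ne_zero)

/-- Here `W = c₀ + 2b₀` and `R = c₀`. A candidate `mon k b' c'` then has `c' ≥ c₀` and `b' + c' ≥ b₀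
+ c₀`, and for `c' = c₀` also `b' = b₀`; the others vanish by assumption. The scalars are those of
the exponential of `kap O + (splitCoeff / 2) E`. -/
theorem coeff_garland_mon {k b₀ c₀ : ℕ} {v : M} (T : Trunc k v)
    (hvan : ∀ b' c' : ℕ, c₀ < c' → b₀ + c₀ ≤ b' + c' → mon k b' c' v = 0) (w : ℕ) :
    ∀ r s b c : ℕ, w = r + 2 * s → b + s = b₀ → c + r = c₀ →
    PowerSeries.coeff ((2 * k + 1) * r + 4 * k * s) (garland (w + 4)) • mon k b c v =
      (expCoeff kap r * expCoeff (splitCoeff k (4 * k) / 2) s) • mon k b₀ c₀ v := by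
  induction w using Nat.strong_induction_on with
  | _ w ih =>
  intro r s b c hw hb hc
  rcases w with _ | w
  · obtain rfl : r = 0 := by omega
    obtain rfl : s = 0 := by omega
    rw [zero_add, garland, PowerSeries.coeff_one, if_pos (by simp), one_smul, ← hb, ← hc]
    simp [expCoeff]
  · have hw0 : ((w + 1 : ℕ) : ℂ) ≠ 0 := Nat.cast_ne_zero.2 (by omega)
    have hT := T.mon b c
    have hwz : (w : ℤ) + 1 = r + 2 * s := by exact_mod_cast hw
    have hbz : (b : ℤ) + s = b₀ := by exact_mod_cast hb
    have hcz : (c : ℤ) + r = c₀ := by exact_mod_cast hc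
    have hkw : (k : ℤ) * (w + 1) = k * r + 2 * (k * s) := by rw [hwz]; ring
    refine smul_right_injective M hw0 ?_
    change ((w + 1 : ℕ) : ℂ) • _ = ((w + 1 : ℕ) : ℂ) • _
    set d := (2 * k + 1) * r + 4 * k * s with hd
    have hdz : (d : ℤ) = (2 * k + 1) * r + 4 * k * s := by rw [hd]; push_cast; ring
    rw [garland_step k (w + 1) d _ hT.odd hT.even, yEven_smul_mon, yOdd_smul_mon]
    rw [show w + 1 + 3 = w + 4 from rfl, show w + 1 + 2 = w + 3 from rfl]
    have t1 : (if 2 * k + 1 ≤ d then kap • PowerSeries.coeff (d - (2 * k + 1)) (garland (w + 4)) •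
        mon k b (c + 1) v else 0) =
        (r * (expCoeff kap r * expCoeff (splitCoeff k (4 * k) / 2) s)) • mon k b₀ c₀ v := by
      rcases r with _ | r
      · rw [Nat.cast_zero, zero_mul, zero_smul]
        split_ifs with hd'
        · rw [coeff_garland_mon_eq_zero T w _ b (c + 1) (c₀ + 2 * b₀) c₀, smul_zero]
          · push_cast [hd']; rw [hdz]; linarith
          · push_cast; linarith
          · intro b' c' h1 h2 h3 h4 h5
            refine hvan b' c' ?_ ?_ <;> omega
        · rfl
      · have h1 : (2 * k + 1) * (r + 1) + 4 * k * s - (2 * k + 1) = (2 * k + 1) * r + 4 * k * s := by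
          rw [mul_add]; omega
        rw [if_pos (by rw [hd, mul_add]; omega), hd, h1,
          ih w (by omega) r s b (c + 1) (by omega) hb (by omega), smul_smul]
        congr 1
        have := expCoeff_succ kap r
        push_cast
        linear_combination expCoeff (splitCoeff k (4 * k) / 2) s * this
    have t2 : (∑ p ∈ Finset.HasAntidiagonal.antidiagonal d, if p.1 < 2 * k then
        kap • yDeg p.1 • PowerSeries.coeff p.2 (garland (w + 4)) • mon k b c v else 0) = 0 := by
      refine Finset.sum_eq_zero fun p hp => ?_
      have hp := Finset.HasAntidiagonal.mem_antidiagonal.1 hp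
      have hpz : (p.1 : ℤ) + p.2 = d := by exact_mod_cast hp
      split_ifs with h
      · rw [coeff_garland_mon_eq_zero T w p.2 b c (c₀ + 2 * b₀ - 1) (c₀ + 2 * k - p.1), smul_zero,
          smul_zero]
        · linarith
        · push_cast; linarith
        · intro b' c' h1 h2 h3 h5 h6
          refine hvan b' c' ?_ ?_ <;> omega
      · rfl
    have t3 : (if 4 * k ≤ d then splitCoeff k (4 * k) • PowerSeries.coeff (d - 4 * k)
        (garland (w + 3)) • mon k (b + 1) c v else 0) =
        (2 * s * (expCoeff kap r * expCoeff (splitCoeff k (4 * k) / 2) s)) • mon k b₀ c₀ v := by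
      rcases s with _ | s
      · rw [Nat.cast_zero, mul_zero, zero_mul, zero_smul]
        split_ifs with hd'
        · rcases w with _ | w
          · simp [garland]
          · rw [coeff_garland_mon_eq_zero T w _ (b + 1) c (c₀ + 2 * b₀) c₀, smul_zero]
            · push_cast [hd'] at *; rw [hdz]; linarith
            · push_cast at *; linarith
            · intro b' c' h1 h2 h3 h4 h5
              omega
        · rfl
      · rcases w with _ | w
        · omega
        · have h1 : (2 * k + 1) * r + 4 * k * (s + 1) - 4 * k = (2 * k + 1) * r + 4 * k * s := by
            rw [mul_add (4 * k)]; omega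
          rw [if_pos (by rw [hd, mul_add (4 * k)]; omega), hd, h1,
            ih w (by omega) r s (b + 1) c (by omega) (by omega) hc, smul_smul]
          congr 1
          have := expCoeff_succ (splitCoeff k (4 * k) / 2) s
          push_cast
          linear_combination 2 * expCoeff kap r * this
    have t4 : (∑ p ∈ Finset.HasAntidiagonal.antidiagonal d, if p.1 < 4 * k then
        splitCoeff k p.1 • fDeg p.1 • PowerSeries.coeff p.2 (garland (w + 3)) • mon k b c v
        else 0) = 0 := by
      refine Finset.sum_eq_zero fun p hp => ?_
      have hp := Finset.HasAntidiagonal.mem_antidiagonal.1 hp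
      have hpz : (p.1 : ℤ) + p.2 = d := by exact_mod_cast hp
      split_ifs with h
      · rcases w with _ | w
        · simp [garland]
        by_cases h4 : p.1 % 4 = 0
        · rw [coeff_garland_mon_eq_zero T w p.2 b c (c₀ + 2 * b₀ - 2) (c₀ + 4 * k - p.1), smul_zero,
            smul_zero]
          · push_cast at *; linarith
          · push_cast at *; linarith
          · intro b' c' h1 h2 h3 h5 h6
            refine hvan b' c' ?_ ?_ <;> omega
        · rw [fDeg_eq_zero h4, zero_smul, smul_zero]
      · rfl
    rw [t1, t2, t3, t4, add_zero, add_zero, ← add_smul, smul_smul, hw]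
    congr 1
    push_cast
    ring

/-- The component of weight `c + 2b` and degree `(2k+1)c + 4kb` has weight plus degree `2((k+1)c +
(2k+1)b) > 2n`. It kills `v`, and it is a nonzero multiple of the monomial. -/
theorem mon_eq_zero {k n b c : ℕ} {v : M} (hv : IsHW n v) (T : Trunc k v)
    (h : n < (k + 1) * c + (2 * k + 1) * b)
    (hvan : ∀ b' c' : ℕ, c < c' → b + c ≤ b' + c' → mon k b' c' v = 0) : mon k b c v = 0 := by
  have h1 := coeff_garland_mon T hvan (c + 2 * b) c b 0 0 rfl (by omega) (by omega)
  have e : c + 2 * b + ((2 * k + 1) * c + 4 * k * b) = 2 * ((k + 1) * c + (2 * k + 1) * b) := by ring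
  rw [mon, pow_zero, pow_zero, one_smul, one_smul, coeff_garland_smul_eq_zero (hv.xOdd 0) hv.hDiag
    hv.integrable _ _ (by rw [e]; omega) (by rw [e]; exact even_two_mul _)] at h1
  refine (smul_eq_zero.1 h1.symm).resolve_left (mul_ne_zero (expCoeff_ne_zero kap_ne_zero _)
    (expCoeff_ne_zero (div_ne_zero (splitCoeff_ne_zero k) two_ne_zero) _))

end Module

section Module

variable {M : Type} [AddCommGroup M] [Module U M] [Module ℂ M] [IsScalarTower ℂ U M]

/-! ### Leading terms when the odd root vector of top degree acts by zero -/

theorem yOdd_smul_yEven_pow_smul {k : ℕ} {v : M} (hO : toU (yOdd k) • v = 0) (b : ℕ) :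
    toU (yOdd k) • toU (yEven k) ^ b • v = 0 := by
  rw [← mul_smul, ← ((commute_yEven_yOdd k k).pow_left b).eq, mul_smul, hO, smul_zero]

/-- With `yOdd k` gone every operator has excess at most `0`, which gives the second alternative. At
most `y - b` further factors `yEven k` can act; the rest of the weight, at least `w - 2(y - b)`, has
excess at most `-1` per unit, which gives the first. -/
theorem coeff_garland_yEven_pow_smul_eq_zero {k y : ℕ} {v : M} (T : Trunc k v)
    (hO : toU (yOdd k) • v = 0) (hE : toU (yEven k) ^ (y + 1) • v = 0) (w : ℕ) :
    ∀ d b : ℕ, b ≤ y → ((2 * k * w : ℤ) - d < w - 2 * (y - b) ∨ (2 * k * w : ℤ) < d) →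
    PowerSeries.coeff d (garland (w + 4)) • toU (yEven k) ^ b • v = 0 := by
  induction w using Nat.strong_induction_on with
  | _ w ih =>
  intro d b hb h
  rcases w with _ | w
  · rw [zero_add, garland, PowerSeries.coeff_one]
    split_ifs with hd
    · subst hd
      push_cast at h
      omega
    · rw [zero_smul]
  · have hw : ((w + 1 : ℕ) : ℂ) ≠ 0 := Nat.cast_ne_zero.2 (by omega)
    have hT := T.yEven_pow_smul k b
    refine (smul_eq_zero.1 ?_).resolve_left hw
    rw [garland_step k (w + 1) d _ hT.odd hT.even, yOdd_smul_yEven_pow_smul hO, smul_zero,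
      smul_zero, ite_self, zero_add]
    rw [show w + 1 + 3 = w + 4 from rfl, show w + 1 + 2 = w + 3 from rfl]
    have e : (2 * k * ((w + 1 : ℕ) : ℤ) : ℤ) = 2 * k * w + 2 * k := by push_cast; ring
    rw [e] at h
    push_cast at h
    have t2 : (∑ p ∈ Finset.HasAntidiagonal.antidiagonal d, if p.1 < 2 * k then
        kap • yDeg p.1 • PowerSeries.coeff p.2 (garland (w + 4)) • toU (yEven k) ^ b • v else 0)
        = 0 := by
      refine Finset.sum_eq_zero fun p hp => ?_
      have hp := Finset.HasAntidiagonal.mem_antidiagonal.1 hp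
      split_ifs with h'
      · rw [ih w (by omega) p.2 b hb (by omega), smul_zero, smul_zero]
      · rfl
    rw [t2, zero_add]
    rcases w with _ | w
    · simp [garland]
    have e : (2 * k * ((w + 1 : ℕ) : ℤ) : ℤ) = 2 * k * w + 2 * k := by push_cast; ring
    rw [e] at h
    push_cast at h
    have t3 : (if 4 * k ≤ d then splitCoeff k (4 * k) • PowerSeries.coeff (d - 4 * k)
        (garland (w + 1 + 3)) • toU (yEven k) • toU (yEven k) ^ b • v else 0) = 0 := by
      split_ifs with hd
      · rw [← mul_smul (toU (yEven k)), ← pow_succ']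
        rcases hb.eq_or_lt with rfl | hb
        · rw [hE, smul_zero, smul_zero]
        · rw [ih w (by omega) (d - 4 * k) (b + 1) hb (by push_cast [hd]; omega), smul_zero]
      · rfl
    rw [t3, zero_add]
    refine Finset.sum_eq_zero fun p hp => ?_
    have hp := Finset.HasAntidiagonal.mem_antidiagonal.1 hp
    split_ifs with h'
    · by_cases h4 : p.1 % 4 = 0
      · rw [ih w (by omega) p.2 b hb (by omega), smul_zero, smul_zero]
      · rw [fDeg_eq_zero h4, zero_smul, smul_zero]
    · rfl

/-- This is the boundary of the previous estimate, for the index `k + 1`: the deficit in degree is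
exactly `s`. The only words left consist of `β` factors `yEven (k+1)` and of `s` factors `yOdd k`,
whose degree `2k + 1` is the largest odd one below `2(k+1)`. -/
theorem coeff_garland_yEven_pow_smul {k y : ℕ} {v : M} (T : Trunc (k + 1) v)
    (hO : toU (yOdd (k + 1)) • v = 0) (hE : toU (yEven (k + 1)) ^ (y + 1) • v = 0) (w : ℕ) :
    ∀ s β b : ℕ, w = s + 2 * β → b + β = y →
    PowerSeries.coeff ((2 * k + 1) * s + 4 * (k + 1) * β) (garland (w + 4)) •
      toU (yEven (k + 1)) ^ b • v =
      (expCoeff kap s * expCoeff (splitCoeff (k + 1) (4 * (k + 1)) / 2) β) •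
        toU (yOdd k) ^ s • toU (yEven (k + 1)) ^ y • v := by
  induction w using Nat.strong_induction_on with
  | _ w ih =>
  intro s β b hw hb
  rcases w with _ | w
  · obtain rfl : s = 0 := by omega
    obtain rfl : β = 0 := by omega
    rw [zero_add, garland, PowerSeries.coeff_one, if_pos (by simp), one_smul, ← hb]
    simp [expCoeff]
  · have hw0 : ((w + 1 : ℕ) : ℂ) ≠ 0 := Nat.cast_ne_zero.2 (by omega)
    have hT := T.yEven_pow_smul (k + 1) b
    have hbz : (b : ℤ) + β = y := by exact_mod_cast hb
    have hwz : (w : ℤ) + 1 = s + 2 * β := by exact_mod_cast hw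
    have hkw : (k : ℤ) * (w + 1) = k * s + 2 * (k * β) := by rw [hwz]; ring
    refine smul_right_injective M hw0 ?_
    change ((w + 1 : ℕ) : ℂ) • _ = ((w + 1 : ℕ) : ℂ) • _
    set d := (2 * k + 1) * s + 4 * (k + 1) * β with hd
    have hdz : (d : ℤ) = 2 * (k * s) + s + 4 * (k * β) + 4 * β := by rw [hd]; push_cast; ring
    have hz1 : (2 * ((k + 1 : ℕ) : ℤ) * w : ℤ) = 2 * (k * (w + 1)) - 2 * k + 2 * w := by
      push_cast; ring
    rw [garland_step (k + 1) (w + 1) d _ hT.odd hT.even, yOdd_smul_yEven_pow_smul hO, smul_zero,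
      smul_zero, ite_self, zero_add]
    rw [show w + 1 + 3 = w + 4 from rfl, show w + 1 + 2 = w + 3 from rfl]
    have t2 : (∑ p ∈ Finset.HasAntidiagonal.antidiagonal d, if p.1 < 2 * (k + 1) then
        kap • yDeg p.1 • PowerSeries.coeff p.2 (garland (w + 4)) • toU (yEven (k + 1)) ^ b • v
        else 0) =
        (s * (expCoeff kap s * expCoeff (splitCoeff (k + 1) (4 * (k + 1)) / 2) β)) •
        toU (yOdd k) ^ s • toU (yEven (k + 1)) ^ y • v := by
      have hz : ∀ p ∈ Finset.HasAntidiagonal.antidiagonal d, p.1 ≠ 2 * k + 1 →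
          (if p.1 < 2 * (k + 1) then
            kap • yDeg p.1 • PowerSeries.coeff p.2 (garland (w + 4)) • toU (yEven (k + 1)) ^ b • v
            else 0) = 0 := by
        intro p hp hne
        have hp := Finset.HasAntidiagonal.mem_antidiagonal.1 hp
        split_ifs with h'
        · rw [coeff_garland_yEven_pow_smul_eq_zero T hO hE w p.2 b (by omega) (by
            left; rw [hz1]; omega), smul_zero, smul_zero]
        · rfl
      rcases s with _ | s
      · rw [Nat.cast_zero, zero_mul, zero_smul]
        refine Finset.sum_eq_zero fun p hp => ?_
        by_cases hp1 : p.1 = 2 * k + 1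
        · have hp := Finset.HasAntidiagonal.mem_antidiagonal.1 hp
          rw [coeff_garland_yEven_pow_smul_eq_zero T hO hE w p.2 b (by omega) (by
            right; rw [hz1]; push_cast at *; omega), smul_zero, smul_zero, ite_self]
        · exact hz p hp hp1
      · have hd' : (2 * k + 1) + ((2 * k + 1) * s + 4 * (k + 1) * β) = d := by
          rw [hd]; ring
        rw [Finset.sum_eq_single (2 * k + 1, (2 * k + 1) * s + 4 * (k + 1) * β)]
        · rw [if_pos (by dsimp only; omega), ih w (by omega) s β b (by omega) hb]
          dsimp only
          rw [yDeg_odd, smul_smul_comm', ← mul_smul (toU (yOdd k)), ← pow_succ', smul_smul]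
          congr 1
          have := expCoeff_succ kap s
          push_cast
          linear_combination expCoeff (splitCoeff (k + 1) (4 * (k + 1)) / 2) β * this
        · rintro ⟨p, q⟩ hp hne
          refine hz _ hp fun h => hne ?_
          have hp := Finset.HasAntidiagonal.mem_antidiagonal.1 hp
          dsimp only at h hp
          rw [Prod.mk.injEq]
          omega
        · intro h
          exact absurd (Finset.HasAntidiagonal.mem_antidiagonal.2 hd') h
    rw [t2]
    have t3 : (if 4 * (k + 1) ≤ d then splitCoeff (k + 1) (4 * (k + 1)) •
        PowerSeries.coeff (d - 4 * (k + 1)) (garland (w + 3)) •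
        toU (yEven (k + 1)) • toU (yEven (k + 1)) ^ b • v else 0) =
        (2 * β * (expCoeff kap s * expCoeff (splitCoeff (k + 1) (4 * (k + 1)) / 2) β)) •
        toU (yOdd k) ^ s • toU (yEven (k + 1)) ^ y • v := by
      rw [← mul_smul (toU (yEven (k + 1))), ← pow_succ']
      rcases β with _ | β
      · rw [show b = y by omega, hE]
        simp
      · rcases w with _ | w
        · omega
        · have h1 : (2 * k + 1) * s + 4 * (k + 1) * (β + 1) - 4 * (k + 1) =
              (2 * k + 1) * s + 4 * (k + 1) * β := by
            rw [mul_add (4 * (k + 1))]; omega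
          rw [if_pos (by rw [hd, mul_add (4 * (k + 1))]; omega), hd, h1,
            ih w (by omega) s β (b + 1) (by omega) (by omega), smul_smul]
          congr 1
          have := expCoeff_succ (splitCoeff (k + 1) (4 * (k + 1)) / 2) β
          push_cast
          linear_combination 2 * expCoeff kap s * this
    have t4 : (∑ p ∈ Finset.HasAntidiagonal.antidiagonal d, if p.1 < 4 * (k + 1) then
        splitCoeff (k + 1) p.1 • fDeg p.1 • PowerSeries.coeff p.2 (garland (w + 3)) •
        toU (yEven (k + 1)) ^ b • v else 0) = 0 := by
      refine Finset.sum_eq_zero fun p hp => ?_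
      have hp := Finset.HasAntidiagonal.mem_antidiagonal.1 hp
      split_ifs with h
      · rcases w with _ | w
        · simp [garland]
        by_cases h4 : p.1 % 4 = 0
        · have hz2 : (2 * ((k + 1 : ℕ) : ℤ) * w : ℤ) = 2 * (k * (w + 1 + 1)) - 4 * k + 2 * w := by
            push_cast; ring
          push_cast at hkw hwz
          rw [coeff_garland_yEven_pow_smul_eq_zero T hO hE w p.2 b (by omega) (by
            left; rw [hz2]; omega), smul_zero, smul_zero]
        · rw [fDeg_eq_zero h4, zero_smul, smul_zero]
      · rfl
    rw [t3, t4, add_zero, ← add_smul]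
    generalize toU (yOdd k) ^ s • toU (yEven (k + 1)) ^ y • v = z
    rw [smul_smul, hw]
    congr 1
    push_cast
    ring

theorem yOdd_pow_smul_yEven_pow_smul_eq_zero {k n y s : ℕ} {v : M} (hv : IsHW n v)
    (T : Trunc (k + 1) v) (hO : toU (yOdd (k + 1)) • v = 0)
    (hE : toU (yEven (k + 1)) ^ (y + 1) • v = 0) (h : n < (k + 1) * s + (2 * k + 3) * y) :
    toU (yOdd k) ^ s • toU (yEven (k + 1)) ^ y • v = 0 := by
  have h1 := coeff_garland_yEven_pow_smul T hO hE (s + 2 * y) s y 0 rfl (by omega)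
  have e : s + 2 * y + ((2 * k + 1) * s + 4 * (k + 1) * y) =
      2 * ((k + 1) * s + (2 * k + 3) * y) := by ring
  rw [pow_zero, one_smul, coeff_garland_smul_eq_zero (hv.xOdd 0) hv.hDiag
    hv.integrable _ _ (by rw [e]; omega) (by rw [e]; exact even_two_mul _)] at h1
  exact (smul_eq_zero.1 h1.symm).resolve_left (mul_ne_zero (expCoeff_ne_zero kap_ne_zero _)
    (expCoeff_ne_zero (div_ne_zero (splitCoeff_ne_zero _) two_ne_zero) _))

/-! ### Vanishing of monomials -/

/-- Descending induction on `c`, starting at `c₀`: the larger monomials required by `mon_eq_zero`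
have `b' + c' ≥ b + c ≥ s` and are already known to vanish. -/
theorem mon_eq_zero_of_yOdd_pow {k n c₀ s : ℕ} {v : M} (hv : IsHW n v) (T : Trunc k v)
    (hc₀ : toU (yOdd k) ^ c₀ • v = 0)
    (h : ∀ b c, c < c₀ → s ≤ b + c → n < (k + 1) * c + (2 * k + 1) * b) (b c : ℕ)
    (hs : s ≤ b + c) : mon k b c v = 0 := by
  have key : ∀ i c, c₀ ≤ c + i → ∀ b, s ≤ b + c → mon k b c v = 0 := by
    intro i
    induction i with
    | zero =>
      intro c hc b _
      rw [mon, ← Nat.sub_add_cancel (show c₀ ≤ c by omega), pow_add, mul_smul, hc₀, smul_zero,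
        smul_zero]
    | succ i ih =>
      intro c hc b hb
      by_cases hcc : c < c₀
      · exact mon_eq_zero hv T (h b c hcc hb) fun b' c' h1 h2 => ih c' (by omega) b' (by omega)
      · exact ih c (by omega) b hb
  exact key c₀ c (by omega) b hs

theorem yOdd_pow_smul_eq_zero_of_lt {k n c : ℕ} {v : M} (hv : IsHW n v) (T : Trunc k v)
    (h : n < (k + 1) * c) : toU (yOdd k) ^ c • v = 0 := by
  have key : ∀ i c, n < c + i → n < (k + 1) * c → toU (yOdd k) ^ c • v = 0 := by
    intro i
    induction i with
    | zero => intro c hc _; exact hv.yOdd_pow_smul_eq_zero T (by omega)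
    | succ i ih =>
      intro c hc hn
      rw [← mon_zero_left]
      refine mon_eq_zero hv T (by omega) fun b' c' h1 _ => ?_
      rw [mon, ih c' (by omega) (hn.trans_le (Nat.mul_le_mul_left _ h1.le)), smul_zero]
  exact key (n + 1) c (by omega) h

/-- The case `b + c = y + 1` covers the relation on the even root vector and the kernel of the
projection that kills the highest surviving power of the odd one. -/
theorem mon_eq_zero_of_state {k n x a y : ℕ} {v : M} (hv : IsHW n v) (T : Trunc k v)
    (hn : n = k * x + a + y) (ha : a ≤ k) (hxy : x ≤ 2 * y)
    (hO : toU (yOdd k) ^ (2 * y - x + 1) • v = 0) (b c : ℕ) (h : y + 1 ≤ b + c) :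
    mon k b c v = 0 := by
  refine mon_eq_zero_of_yOdd_pow hv T hO (fun b c hc hb => ?_) b c h
  zify at hn ha hxy hc hb ⊢
  rw [Nat.cast_sub (by omega)] at hc
  push_cast at hc
  nlinarith

/-- From `b ≥ y - c` and `c ≤ 2y - x - 1` one gets `(k+1)c + (2k+1)b ≥ kx + y + k`, which exceeds
`n` because `a < k`. -/
theorem mon_eq_zero_of_state' {k n x a y : ℕ} {v : M} (hv : IsHW n v) (T : Trunc k v)
    (hn : n = k * x + a + y) (ha : a < k) (hxy : x + 1 ≤ 2 * y)
    (hO : toU (yOdd k) ^ (2 * y - x) • v = 0) (b c : ℕ) (h : y ≤ b + c) :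
    mon k b c v = 0 := by
  refine mon_eq_zero_of_yOdd_pow hv T hO (fun b c hc hb => ?_) b c h
  zify at hn ha hxy hc hb ⊢
  rw [Nat.cast_sub (by omega)] at hc
  push_cast at hc
  nlinarith

/-! ### The local Weyl module -/

/-- In weight one the exponential is `serY`, and its coefficient of degree `2k + 1` has weight plus
degree `2k + 2 > 2n`. -/
theorem IsHW.yOdd_smul_eq_zero {n : ℕ} {v : M} (hv : IsHW n v) {k : ℕ} (hk : n ≤ k) :
    toU (yOdd k) • v = 0 := by
  have h := coeff_garland_smul_eq_zero (hv.xOdd 0) hv.hDiag hv.integrable (2 * k + 1) 1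
    (by omega) ⟨k + 1, by ring⟩
  have h2 : garland (1 + 4) = serY := by
    have h3 := garland_rec 3
    simp only [garland, mul_one, mul_zero, smul_zero, add_zero] at h3 ⊢
    simp
  rw [h2, serY, PowerSeries.coeff_mk, yDeg_odd, smul_assoc] at h
  exact (smul_eq_zero.1 h).resolve_left kap_ne_zero

/-- For weight `n + 1` the vector `yOdd n v` is again of highest weight, now `n`, and so is killed
by `yOdd (n + 1)`. As `yOdd (n + 1)` also kills `v`, their bracket, a multiple of `yEven (n + 1)`,
does too. -/
theorem IsHW.yEven_smul_eq_zero {n : ℕ} {v : M} (hv : IsHW n v) {k : ℕ} (hk : n ≤ k) :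
    toU (yEven k) • v = 0 := by
  have hstep : ∀ i j, toU (yEven i) • v = 0 → toU (yEven (i + (j + 1))) • v = 0 := by
    intro i j hi
    have := toU_smul_of_lie_eq (lie_hDiag_even_yEven (j + 1) i) v
    rw [hi, smul_zero, show 2 * (j + 1) = 2 * j + 1 + 1 by ring, hv.hDiag, smul_zero,
      zero_add] at this
    exact (smul_eq_zero.1 this.symm).resolve_left (by norm_num)
  have hn : toU (yEven n) • v = 0 := by
    rcases n with _ | n
    · simpa using hv.integrable
    · have hp := hv.toIsPrim.yOdd_smul (k := n) fun j hj => hv.yOdd_smul_eq_zero hj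
      have hw : IsHW n (toU (yOdd n) • v) := by
        refine IsPrim.isHW (m := n + 1 + 1) ?_ ?_
        · convert hp using 1
          push_cast; ring
        · rw [← mul_smul, ((commute_yEven_yOdd 0 n).pow_left _).eq, mul_smul, hv.integrable,
            smul_zero]
      have h0 := hw.yOdd_smul_eq_zero (k := n + 1) (by omega)
      rw [toU_smul_of_lie_eq (lie_yOdd_yOdd_of_odd (n + 1) n (n + 1) (by omega)),
        hv.yOdd_smul_eq_zero le_rfl, smul_zero, zero_add] at h0
      refine (smul_eq_zero.1 h0).resolve_left (mul_ne_zero two_ne_zero (pow_ne_zero _ Complex.I_ne_zero))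
  rcases hk.eq_or_lt with rfl | hk
  · exact hn
  · obtain ⟨i, rfl⟩ : ∃ i, k = n + (i + 1) := ⟨k - n - 1, by omega⟩
    exact hstep n i hn

end Module

/-! ### Degrees and weights in `U` -/

theorem one_mem_Udeg : (1 : U) ∈ Udeg 0 :=
  Submodule.subset_span ⟨[], by simp, by simp, by simp⟩

theorem mul_mem_Udeg {a b : ℤ} {u w : U} (hu : u ∈ Udeg a) (hw : w ∈ Udeg b) :
    u * w ∈ Udeg (a + b) := by
  have h : Udeg a * Udeg b ≤ Udeg (a + b) := by
    rw [Udeg, Udeg, Submodule.span_mul_span, Submodule.span_le]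
    rintro _ ⟨_, ⟨l, hl, hla, rfl⟩, _, ⟨l', hl', hlb, rfl⟩, rfl⟩
    refine Submodule.subset_span ⟨l ++ l', ?_, ?_, ?_⟩
    · intro a ha
      rcases List.mem_append.1 ha with h | h
      exacts [hl a h, hl' a h]
    · rw [List.map_append, List.sum_append, ← hla, ← hlb]; push_cast; rfl
    · rw [List.map_append, List.prod_append]
  exact h (Submodule.mul_mem_mul hu hw)

theorem pow_mem_Udeg {a : ℤ} {u : U} (hu : u ∈ Udeg a) (c : ℕ) : u ^ c ∈ Udeg (c * a) := by
  induction c with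
  | zero => simpa using one_mem_Udeg
  | succ c ih =>
    rw [pow_succ]
    convert mul_mem_Udeg ih hu using 1
    push_cast; ring

theorem toU_mem_Udeg {d : ℕ} {z : CG} (hz : z ∈ CGdeg d) : toU z ∈ Udeg d :=
  Submodule.subset_span ⟨[(d, z)], by simpa using hz, by simp, by simp⟩

theorem yOdd_mem_CGdeg (k : ℕ) : yOdd k ∈ CGdeg (2 * k + 1) := by
  intro i j l hl
  have h : (Polynomial.C (Complex.I ^ (2 * k + 1)) * Polynomial.X ^ (2 * k + 1) :
      Polynomial ℂ).coeff l = 0 := by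
    rw [Polynomial.coeff_C_mul_X_pow, if_neg hl]
  fin_cases i <;> fin_cases j <;> simp [yOdd, Polynomial.coeff_X_pow, hl] <;> simpa using h

theorem yEven_mem_CGdeg (k : ℕ) : yEven k ∈ CGdeg (4 * k) := by
  intro i j l hl
  fin_cases i <;> fin_cases j <;> simp [yEven, Polynomial.coeff_X_pow, hl]

/-- The element `u` has weight `w` for the adjoint action of `h₀`. -/
def HasWt (w : ℤ) (u : U) : Prop := toU h0 * u = u * toU h0 + (w : ℂ) • u

theorem HasWt.one : HasWt 0 1 := by simp [HasWt]

theorem HasWt.mul {a b : ℤ} {u w : U} (hu : HasWt a u) (hw : HasWt b w) : HasWt (a + b) (u * w) := by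
  rw [HasWt] at *
  rw [← mul_assoc, hu, add_mul, mul_assoc, hw, mul_add, smul_mul_assoc, mul_smul_comm]
  push_cast
  rw [add_smul, mul_assoc]
  abel

theorem HasWt.pow {a : ℤ} {u : U} (hu : HasWt a u) (c : ℕ) : HasWt (c * a) (u ^ c) := by
  induction c with
  | zero => simpa using HasWt.one
  | succ c ih =>
    rw [pow_succ]
    convert ih.mul hu using 1
    push_cast; ring

theorem hasWt_of_lie {a : ℤ} {z : CG} (h : ⁅h0, z⁆ = (a : ℂ) • z) : HasWt a (toU z) := by
  have := toU_lie h0 z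
  rw [h, toU_smul] at this
  rw [HasWt, this]
  abel

theorem hasWt_yOdd (k : ℕ) : HasWt (-1) (toU (yOdd k)) := by
  refine hasWt_of_lie ?_
  rw [← hDiag_zero, lie_hDiag_yOdd, add_zero]
  congr 1
  norm_num

theorem hasWt_yEven (k : ℕ) : HasWt (-2) (toU (yEven k)) := by
  refine hasWt_of_lie ?_
  have := lie_hDiag_even_yEven 0 k
  rw [mul_zero, hDiag_zero, add_zero] at this
  rw [this]
  congr 1
  norm_num

/-! ### The defining ideals -/

/-- The relations of a local Weyl module. -/
def baseRel (n : ℕ) : Set U :=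
  {u | ∃ z ∈ nPlus ∪ hPlus, u = toU z} ∪ {toU h0 - algebraMap ℂ U n, toU (yEven 0) ^ (n + 1)}

/-- The relations of a quotient of a local Weyl module by powers of extreme lowering operators. -/
def stRel (n k i j : ℕ) : Set U :=
  baseRel n ∪ {toU (yEven (k + 1)), toU (yOdd (k + 1)), toU (yEven k) ^ (i + 1),
    toU (yOdd k) ^ (j + 1)}

/-- The left ideal generated by `stRel n k i j`. -/
def stIdeal (n k i j : ℕ) : Submodule U U := Submodule.span U (stRel n k i j)

section Module

variable {M : Type} [AddCommGroup M] [Module U M] [Module ℂ M] [IsScalarTower ℂ U M]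

/-- The vector `v` satisfies the relations `stRel n k i j`. -/
structure St (n k i j : ℕ) (v : M) : Prop where
  hw : IsHW n v
  trunc : Trunc k v
  even : toU (yEven k) ^ (i + 1) • v = 0
  odd : toU (yOdd k) ^ (j + 1) • v = 0

theorem span_smul_eq_zero {S : Set U} {v : M} (h : ∀ u ∈ S, u • v = 0) {u : U}
    (hu : u ∈ Submodule.span U S) : u • v = 0 := by
  have : Submodule.span U S ≤ LinearMap.ker (LinearMap.toSpanSingleton U M v) :=
    Submodule.span_le.2 fun u hu => h u hu
  exact this hu

theorem baseRel_iff {n : ℕ} {v : M} : (∀ u ∈ baseRel n, u • v = 0) ↔ IsHW n v := by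
  constructor
  · intro h
    refine ⟨⟨fun k => h _ (Or.inl ⟨_, Or.inl (xOdd_mem_nPlus k), rfl⟩),
      fun k => h _ (Or.inl ⟨_, Or.inl (xEven_mem_nPlus k), rfl⟩),
      fun k => h _ (Or.inl ⟨_, Or.inr (hDiag_mem_hPlus k), rfl⟩), ?_⟩, h _ (Or.inr (Or.inr rfl))⟩
    have := h _ (Or.inr (Or.inl rfl))
    rwa [sub_smul, algebraMap_smul, sub_eq_zero] at this
  · rintro h u (⟨z, hz, rfl⟩ | rfl | rfl)
    · let S : Submodule ℂ CG :=
        { carrier := {z | toU z • v = 0}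
          zero_mem' := by rw [Set.mem_ofPred_eq, toU_zero, zero_smul]
          add_mem' := fun {a b} ha hb => by
            rw [Set.mem_ofPred_eq] at *
            rw [toU, map_add, add_smul, ha, hb, add_zero]
          smul_mem' := fun c a ha => by
            rw [Set.mem_ofPred_eq] at *
            rw [toU_smul, smul_assoc, ha, smul_zero] }
      rcases hz with hz | hz
      · exact mem_of_mem_nPlus S h.xOdd h.xEven hz
      · exact mem_of_mem_hPlus S h.hDiag hz
    · rw [sub_smul, algebraMap_smul, h.weight, sub_self]
    · exact h.integrable

theorem stIdeal_smul_iff {n k i j : ℕ} {v : M} :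
    (∀ u ∈ stIdeal n k i j, u • v = 0) ↔ St n k i j v := by
  constructor
  · intro h
    have h' : ∀ u ∈ stRel n k i j, u • v = 0 := fun u hu => h u (Submodule.subset_span hu)
    have hw := baseRel_iff.1 fun u hu => h' u (Or.inl hu)
    refine ⟨hw, hw.toIsPrim.trunc (h' _ ?_) (h' _ ?_), h' _ ?_, h' _ ?_⟩ <;> simp [stRel]
  · intro h u hu
    refine span_smul_eq_zero ?_ hu
    rintro u (hu | rfl | rfl | rfl | rfl)
    · exact baseRel_iff.2 h.hw u hu
    · exact h.trunc.even _ (by omega)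
    · exact h.trunc.odd _ (by omega)
    · exact h.even
    · exact h.odd

theorem smul_mk_one {J : Submodule U U} (u : U) :
    u • (Submodule.Quotient.mk 1 : U ⧸ J) = Submodule.Quotient.mk u := by
  rw [← Submodule.Quotient.mk_smul, smul_eq_mul, mul_one]

theorem smul_mk_one_eq_zero {J : Submodule U U} (u : U) :
    u • (Submodule.Quotient.mk 1 : U ⧸ J) = 0 ↔ u ∈ J := by
  rw [smul_mk_one, Submodule.Quotient.mk_eq_zero]

theorem stIdeal_le_iff {n k i j : ℕ} {J : Submodule U U} :
    stIdeal n k i j ≤ J ↔ St n k i j (Submodule.Quotient.mk 1 : U ⧸ J) := by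
  rw [← stIdeal_smul_iff]
  simp only [smul_mk_one_eq_zero]
  rfl

/-! ### States -/

/-- The relations of the module indexed by the partition `((x+1)^a, x^p, y)`. -/
abbrev Stt (x a p y : ℕ) (v : M) : Prop := St (a * (x + 1) + p * x + y) (a + p) y (2 * y - x) v

theorem Trunc.of_yOdd_yEven {k : ℕ} {v : M} (T : Trunc (k + 1) v) (ho : toU (yOdd (k + 1)) • v = 0)
    (he : toU (yEven (k + 1)) • v = 0) : Trunc k v := by
  constructor <;> intro j hj <;> rcases (Nat.succ_le_of_lt hj).eq_or_lt with rfl | h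
  exacts [ho, T.odd j h, he, T.even j h]

theorem yEven_pow_smul_eq_zero_of_state {k n x a y : ℕ} {v : M} (hv : IsHW n v) (T : Trunc k v)
    (hn : n = k * x + a + y) (ha : a ≤ k) (hxy : x ≤ 2 * y)
    (hO : toU (yOdd k) ^ (2 * y - x + 1) • v = 0) : toU (yEven k) ^ (y + 1) • v = 0 := by
  rw [← mon_zero_right]
  exact mon_eq_zero_of_state hv T hn ha hxy hO _ _ (by omega)

/-- When the last part equals `x` the power relations are automatic, because `n < (a + p + 1)(x +
1)`. -/
theorem stt_self {x a p : ℕ} {v : M} (hv : IsHW (a * (x + 1) + p * x + x) v)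
    (T : Trunc (a + p) v) : Stt x a p x v := by
  have hO : toU (yOdd (a + p)) ^ (2 * x - x + 1) • v = 0 := by
    refine yOdd_pow_smul_eq_zero_of_lt hv T ?_
    rw [show 2 * x - x = x by omega]
    nlinarith
  exact ⟨hv, T, yEven_pow_smul_eq_zero_of_state (x := x) (a := a) hv T (by ring) (by omega)
    (by omega) hO, hO⟩

/-- For an empty last part the power relations say that both extreme operators kill `v`. The
truncation index then drops by one, and a part `x` takes the role of the last part. -/
theorem stt_zero_iff {x a p : ℕ} {v : M} : Stt x a (p + 1) 0 v ↔ Stt x a p x v := by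
  constructor
  · intro h
    have h1 := h.even
    have h2 := h.odd
    rw [zero_add, pow_one] at h1
    rw [mul_zero, Nat.zero_sub, zero_add, pow_one] at h2
    have hw := h.hw
    rw [show a * (x + 1) + (p + 1) * x + 0 = a * (x + 1) + p * x + x by ring] at hw
    exact stt_self hw (h.trunc.of_yOdd_yEven h2 h1)
  · intro h
    have hw := h.hw
    rw [show a * (x + 1) + p * x + x = a * (x + 1) + (p + 1) * x + 0 by ring] at hw
    refine ⟨hw, h.trunc.mono (by omega), ?_, ?_⟩
    · rw [zero_add, pow_one]; exact h.trunc.even _ (by omega)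
    · rw [mul_zero, Nat.zero_sub, zero_add, pow_one]; exact h.trunc.odd _ (by omega)

theorem pow_smul_eq_zero_of_le {u : U} {v : M} {a b : ℕ} (h : a ≤ b) (ha : u ^ a • v = 0) :
    u ^ b • v = 0 := by
  rw [← Nat.sub_add_cancel h, pow_add, mul_smul, ha, smul_zero]

/-- The vector `O ^ (2y - x) v`, with `O` the extreme odd lowering operator. -/
theorem St.yOdd_pow_smul {x a k y n n' j : ℕ} {v : M} (h : St n k y (2 * y - x) v) (ha : a ≤ k)
    (hn : n = k * x + a + y) (hn' : n' + (2 * y - x) = n) (hxy : x ≤ 2 * y) (hy : y ≤ x) :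
    St n' k (x - y) j (toU (yOdd k) ^ (2 * y - x) • v) := by
  have hw := h.hw.yOdd_pow_smul h.trunc (c := 2 * y - x) (by omega)
  rw [show n - (2 * y - x) = n' by omega] at hw
  refine ⟨hw, h.trunc.yOdd_pow_smul _, ?_, ?_⟩
  · exact mon_eq_zero_of_state h.hw h.trunc hn ha hxy h.odd _ _ (by omega)
  · rw [← mul_smul, ← pow_add]
    exact pow_smul_eq_zero_of_le (by omega) h.odd

/-- The companion of the previous statement when `O^(2y-x)` already kills `v`: the next lower power
generates the submodule. The strict bound `a < k` is what `mon_eq_zero_of_state'` needs. -/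
theorem St.yOdd_pow_smul' {x a k y n n' j : ℕ} {v : M} (h : St n k y (2 * y - x - 1) v) (ha : a < k)
    (hn : n = k * x + a + y) (hn' : n' + (2 * y - x - 1) = n) (hxy : x + 2 ≤ 2 * y) (hy : y ≤ x) :
    St n' k (x - y) j (toU (yOdd k) ^ (2 * y - x - 1) • v) := by
  have hw := h.hw.yOdd_pow_smul h.trunc (c := 2 * y - x - 1) (by omega)
  rw [show n - (2 * y - x - 1) = n' by omega] at hw
  have ho := h.odd
  rw [show 2 * y - x - 1 + 1 = 2 * y - x by omega] at ho
  refine ⟨hw, h.trunc.yOdd_pow_smul _, ?_, ?_⟩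
  · exact mon_eq_zero_of_state' h.hw h.trunc hn ha (by omega) ho _ _ (by omega)
  · rw [← mul_smul, ← pow_add]
    exact pow_smul_eq_zero_of_le (by omega) ho

/-- Killing `O ^ (2y - x - 1) v` also kills `E ^ y v`. -/
theorem yEven_pow_smul_eq_zero_of_state' {k n x a y : ℕ} {v : M} (hv : IsHW n v) (T : Trunc k v)
    (hn : n = k * x + a + y) (ha : a < k) (hxy : x + 1 ≤ 2 * y)
    (hO : toU (yOdd k) ^ (2 * (y - 1) - x + 1) • v = 0) : toU (yEven k) ^ y • v = 0 := by
  rw [← mon_zero_right]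
  rcases hxy.eq_or_lt with h | h
  · exact mon_eq_zero_of_state' hv T hn ha h.le (pow_smul_eq_zero_of_le (by omega) hO) _ _ (by omega)
  · exact mon_eq_zero_of_state' hv T hn ha hxy (pow_smul_eq_zero_of_le (by omega) hO) _ _ (by omega)

/-- Since `yOdd (k+1)` kills `v` and `E^(y+1) v = 0`, the vector `E^y v` is truncated already at
`k`. The bound on powers of `yOdd k` comes from the leading term computed in that situation, and it
implies the even relation. -/
theorem St.yEven_pow_smul {x a k y n n' : ℕ} {v : M} (h : St n (k + 1) y 0 v) (ha : a ≤ k)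
    (hn : n = (k + 1) * x + a + y) (hn' : n' + 2 * y = n) (hxy : 2 * y ≤ x) :
    St n' k (x - y) (x - 2 * y) (toU (yEven (k + 1)) ^ y • v) := by
  have hw := h.hw.yEven_pow_smul h.trunc (b := y) (by omega) (by omega)
  rw [show n - 2 * y = n' by omega] at hw
  have ho := h.odd
  rw [zero_add, pow_one] at ho
  have T : Trunc k (toU (yEven (k + 1)) ^ y • v) := by
    refine (h.trunc.yEven_pow_smul _ _).of_yOdd_yEven (yOdd_smul_yEven_pow_smul ho y) ?_
    rw [← mul_smul, ← pow_succ']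
    exact h.even
  have hO : toU (yOdd k) ^ (x - 2 * y + 1) • toU (yEven (k + 1)) ^ y • v = 0 := by
    refine yOdd_pow_smul_yEven_pow_smul_eq_zero h.hw h.trunc ho h.even ?_
    obtain ⟨z, rfl⟩ := Nat.exists_eq_add_of_le hxy
    rw [show 2 * y + z - 2 * y = z by omega]
    nlinarith
  refine ⟨hw, T, ?_, hO⟩
  refine yEven_pow_smul_eq_zero_of_state (x := x) (a := a) hw T ?_ ha (by omega) ?_
  · have : (k + 1) * x = k * x + x := by ring
    omega
  · rwa [show 2 * (x - y) - x = x - 2 * y by omega]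

end Module

/-! ### Characters of the states and their additivity. -/

open LaurentPolynomial in
/-- Characters of `sl₂`-modules. -/
abbrev Ch : Type := ℤ[T;T⁻¹]

/-- The sum of the characters of the first `k` irreducible `sl₂`-modules. -/
def chS : ℕ → Ch
  | 0 => 0
  | 1 => 1
  -- The Clebsch–Gordan rule summed over the first `k + 1` irreducibles; the trivial module is not
  -- of the form `V(j+1)`, hence the summand `1`.
  | k + 2 => 1 + (LaurentPolynomial.T 1 + LaurentPolynomial.T (-1)) * chS (k + 1) - chS k

/-- With `F(y) = chS (x+1) chS (y+1) - chS (x+2) chS y` this evaluates `F(y+1) - F(y)`. The result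
is antisymmetric under `y ↦ x - 1 - y`. -/
theorem chS_step (y : ℕ) : ∀ x, y ≤ x → chS (x + 1) * chS (y + 2) - chS (x + 2) * chS (y + 1) -
    (chS (x + 1) * chS (y + 1) - chS (x + 2) * chS y) = chS (x - y) - chS (y + 1) := by
  induction y with
  | zero =>
    intro x _
    simp only [chS, Nat.sub_zero]
    ring
  | succ y ih =>
    intro x hx
    obtain ⟨x, rfl⟩ : ∃ z, x = z + 1 := ⟨x - 1, by omega⟩
    have h := ih x (by omega)
    rw [show x + 1 - (y + 1) = x - y by omega]
    have e1 : chS (x + 1 + 2) = 1 + (LaurentPolynomial.T 1 + LaurentPolynomial.T (-1)) *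
      chS (x + 2) - chS (x + 1) := by rw [chS]
    have e2 : chS (y + 1 + 2) = 1 + (LaurentPolynomial.T 1 + LaurentPolynomial.T (-1)) *
      chS (y + 2) - chS (y + 1) := by rw [chS]
    have e3 : chS (y + 2) = 1 + (LaurentPolynomial.T 1 + LaurentPolynomial.T (-1)) *
      chS (y + 1) - chS y := by rw [chS]
    rw [e1, e2, show y + 1 + 1 = y + 2 from rfl, show x + 1 + 1 = x + 2 from rfl]
    linear_combination h - chS (x + 2) * e3

/-- By the antisymmetry in `chS_step` the difference `F(y) - F(x-y)` does not depend on `y`. It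
changes sign under `y ↦ x - y`, so it is zero. -/
theorem chS_symm {x y : ℕ} (h : y ≤ x) : chS (x + 1) * chS (y + 1) - chS (x + 2) * chS y =
    chS (x + 1) * chS (x - y + 1) - chS (x + 2) * chS (x - y) := by
  have key : ∀ y, y ≤ x → chS (x + 1) * chS (y + 1) - chS (x + 2) * chS y -
      (chS (x + 1) * chS (x - y + 1) - chS (x + 2) * chS (x - y)) =
      chS (x + 1) * chS (0 + 1) - chS (x + 2) * chS 0 -
      (chS (x + 1) * chS (x - 0 + 1) - chS (x + 2) * chS (x - 0)) := by
    intro y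
    induction y with
    | zero => intro _; rfl
    | succ y ih =>
      intro hy
      rw [← ih (by omega)]
      have h1 := chS_step y x (by omega)
      have h2 := chS_step (x - (y + 1)) x (by omega)
      rw [show x - (y + 1) + 2 = x - y + 1 by omega, show x - (y + 1) + 1 = x - y by omega,
        show x - (x - (y + 1)) = y + 1 by omega] at h2
      rw [show x - (y + 1) + 1 = x - y by omega]
      linear_combination h1 + h2
  have h0 := key x le_rfl
  have h1 := key y h
  rw [Nat.sub_self, Nat.sub_zero] at h0
  have h2 : (2 : ℤ) • (chS (x + 1) * chS (0 + 1) - chS (x + 2) * chS 0 -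
      (chS (x + 1) * chS (x - 0 + 1) - chS (x + 2) * chS (x - 0))) = 0 := by
    rw [Nat.sub_zero, zsmul_eq_mul]
    push_cast
    linear_combination -h0
  have h3 := (smul_eq_zero.1 h2).resolve_left two_ne_zero
  rw [h3] at h1
  exact sub_eq_zero.1 h1

theorem chS_succ_sub (y : ℕ) : chS (y + 1) - chS y =
    ∑ b ∈ Finset.range (y + 1), LaurentPolynomial.T ((y : ℤ) - 2 * b) := by
  have hX : ∀ y : ℕ, (LaurentPolynomial.T 1 + LaurentPolynomial.T (-1) : Ch) *
      ∑ b ∈ Finset.range (y + 2), LaurentPolynomial.T (((y + 1 : ℕ) : ℤ) - 2 * b) =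
      (∑ b ∈ Finset.range (y + 3), LaurentPolynomial.T (((y + 2 : ℕ) : ℤ) - 2 * b)) +
      ∑ b ∈ Finset.range (y + 1), LaurentPolynomial.T ((y : ℤ) - 2 * b) := by
    intro y
    rw [add_mul, Finset.mul_sum, Finset.mul_sum, Finset.sum_range_succ _ (y + 2)]
    have h1 : ∀ b : ℕ, (LaurentPolynomial.T 1 * LaurentPolynomial.T (((y + 1 : ℕ) : ℤ) - 2 * b) : Ch) =
        LaurentPolynomial.T (((y + 2 : ℕ) : ℤ) - 2 * b) := by
      intro b
      rw [← LaurentPolynomial.T_add]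
      congr 1
      push_cast; ring
    have h2 : ∀ b : ℕ, (LaurentPolynomial.T (-1) * LaurentPolynomial.T (((y + 1 : ℕ) : ℤ) - 2 * b) :
        Ch) = LaurentPolynomial.T ((y : ℤ) - 2 * b) := by
      intro b
      rw [← LaurentPolynomial.T_add]
      congr 1
      push_cast; ring
    simp only [h1, h2]
    rw [Finset.sum_range_succ (fun b : ℕ => (LaurentPolynomial.T ((y : ℤ) - 2 * b) : Ch)) (y + 1),
      show ((y + 2 : ℕ) : ℤ) - 2 * ((y + 2 : ℕ) : ℤ) = (y : ℤ) - 2 * ((y + 1 : ℕ) : ℤ) by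
        push_cast; ring]
    ring
  induction y using Nat.strong_induction_on with
  | _ y ih =>
  match y with
  | 0 => simp [chS]
  | 1 => simp [chS, Finset.sum_range_succ]
  | y + 2 =>
    have h1 := ih y (by omega)
    have h2 := ih (y + 1) (by omega)
    have h3 := hX y
    rw [← h1, ← h2] at h3
    have e1 : chS (y + 2 + 1) = 1 + (LaurentPolynomial.T 1 + LaurentPolynomial.T (-1)) *
      chS (y + 2) - chS (y + 1) := by rw [chS]
    have e2 : chS (y + 2) = 1 + (LaurentPolynomial.T 1 + LaurentPolynomial.T (-1)) *
      chS (y + 1) - chS y := by rw [chS]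
    rw [e1, show y + 2 + 1 = y + 3 from rfl]
    rw [show y + 1 + 1 = y + 2 from rfl] at h3
    linear_combination h3 - e2

/-- The character attached to `(x, y)`. -/
def chD (x y : ℕ) : Ch := chS (y + 1) - chS (min (x - y) y)

/-- The character attached to the partition `((x+1)^a, x^p, y)`. -/
def ch (x a p y : ℕ) : Ch := chS (x + 2) ^ a * chS (x + 1) ^ p * chD x y

theorem ch_zero (x a p : ℕ) : ch x a (p + 1) 0 = ch x a p x := by
  simp [ch, chD, chS, pow_succ, mul_assoc]

/-- This identity and the following ones express additivity of characters along the extensions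
constructed below. This one amounts to `chS_step`; those with larger `y` amount to `chS_symm`. -/
theorem ch_of_two_mul_le {x a p y : ℕ} (h : 2 * (y + 1) ≤ x) :
    ch x a (p + 1) (y + 1) = ch x a p (x - (y + 1)) + ch x (a + 1) p y := by
  have h1 := chS_step y x (by omega)
  rw [ch, ch, ch, chD, chD, chD, min_eq_right (by omega), min_eq_left (by omega),
    min_eq_right (by omega), show x - (y + 1) + 1 = x - y by omega,
    show x - (x - (y + 1)) = y + 1 by omega, pow_succ, pow_succ]
  linear_combination chS (x + 2) ^ a * chS (x + 1) ^ p * h1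

theorem ch_of_two_mul_eq {x a p y : ℕ} (h : 2 * (y + 1) = x + 1) :
    ch x a (p + 1) (y + 1) = ch x a (p + 1) (x - (y + 1)) + ch x (a + 1) p y := by
  have h1 := chS_symm (x := x) (y := y + 1) (by omega)
  rw [show x - (y + 1) = y by omega] at *
  rw [ch, ch, ch, chD, chD, min_eq_left (by omega), min_eq_right (by omega),
    show x - (y + 1) = y by omega, pow_succ, pow_succ]
  linear_combination chS (x + 2) ^ a * chS (x + 1) ^ p * h1

theorem ch_of_lt_two_mul {x a p y : ℕ} (h : x ≤ 2 * y) (hy : y + 1 ≤ x) :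
    ch x a (p + 1) (y + 1) = ch x a (p + 1) (x - (y + 1)) +
      (ch x (a + 1) p (x - (y + 1)) + ch x (a + 1) p y) := by
  have h1 := chS_symm (x := x) (y := y + 1) (by omega)
  rw [ch, ch, ch, ch, chD, chD, chD, min_eq_left (by omega), min_eq_right (by omega),
    min_eq_left (by omega), show x - y = x - (y + 1) + 1 by omega, pow_succ, pow_succ]
  linear_combination chS (x + 2) ^ a * chS (x + 1) ^ p * h1

theorem ch_succ_of_lt {x a y : ℕ} (h : x + 1 ≤ 2 * y) (hy : y ≤ x) :
    ch x a 0 y = ch (x + 1) 0 a (x - y) + ch (x + 1) 0 a y := by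
  rw [ch, ch, ch, chD, chD, chD, min_eq_left (by omega), min_eq_right (by omega),
    min_eq_left (by omega), show x + 1 - y = x - y + 1 by omega]
  ring

theorem ch_succ_of_le {x a y : ℕ} (h : 2 * y ≤ x) : ch x a 0 y = ch (x + 1) 0 a y := by
  rw [ch, ch, chD, chD, min_eq_right (by omega), min_eq_right (by omega)]
  ring

/-- The dimension attached to a character. -/
def chDim : Ch →+* ℤ := (AddMonoidAlgebra.lift ℤ ℤ ℤ (1 : Multiplicative ℤ →* ℤ)).toRingHom

theorem chDim_T (k : ℤ) : chDim (LaurentPolynomial.T k) = 1 := by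
  change AddMonoidAlgebra.lift ℤ ℤ ℤ (1 : Multiplicative ℤ →* ℤ) (AddMonoidAlgebra.single k 1) = 1
  rw [AddMonoidAlgebra.lift_single, MonoidHom.one_apply, one_smul]

theorem two_mul_chDim_chS (k : ℕ) : 2 * chDim (chS k) = k * (k + 1) := by
  induction k using Nat.strong_induction_on with
  | _ k ih =>
  match k with
  | 0 => simp [chS]
  | 1 => simp [chS]
  | k + 2 =>
    have h1 := ih k (by omega)
    have h2 := ih (k + 1) (by omega)
    rw [chS, map_sub, map_add, map_mul, map_add, chDim_T, chDim_T, map_one]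
    push_cast at *
    linear_combination 2 * h2 - h1

theorem chDim_chS_pos {k : ℕ} (hk : 0 < k) : 0 < chDim (chS k) := by
  have := two_mul_chDim_chS k
  have h2 : (0 : ℤ) < k * (k + 1) := by positivity
  omega

theorem chDim_chD_pos (x y : ℕ) : 0 < chDim (chD x y) := by
  have h1 := two_mul_chDim_chS (y + 1)
  have h2 := two_mul_chDim_chS (min (x - y) y)
  have h3 : min (x - y) y ≤ y := min_le_right _ _
  rw [chD, map_sub]
  generalize min (x - y) y = z at *
  zify at h3
  push_cast at h1
  nlinarith

theorem chDim_ch_pos (x a p y : ℕ) : 0 < chDim (ch x a p y) := by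
  rw [ch, map_mul, map_mul, map_pow, map_pow]
  have := chDim_chD_pos x y
  have := chDim_chS_pos (k := x + 2) (by omega)
  have := chDim_chS_pos (k := x + 1) (by omega)
  positivity

/-! ### Extensions between states. -/

/-- The quotient of `U ⧸ J` by the submodule generated by the class of `g` is `U ⧸ J₂`, and that
submodule is a quotient of `U ⧸ J'`. -/
structure Ext (n n' : ℕ) (J J' J₂ : Submodule U U) (g : U) : Prop where
  colon : ∀ u ∈ J', u * g ∈ J
  sup : J₂ = J ⊔ Submodule.span U {g}
  deg : ∃ s : ℕ, g ∈ Udeg s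
  wt : HasWt ((n' : ℤ) - n) g
  lt : n' < n

/-- The ideal attached to the partition `((x+1)^a, x^p, y)`. -/
def stI (x a p y : ℕ) : Submodule U U :=
  stIdeal (a * (x + 1) + p * x + y) (a + p) y (2 * y - x)

theorem stI_eq {x a p y n k : ℕ} (hn : n = a * (x + 1) + p * x + y) (hk : k = a + p) :
    stI x a p y = stIdeal n k y (2 * y - x) := by
  rw [hn, hk, stI]

theorem st_mk_one (n k i j : ℕ) :
    St n k i j (Submodule.Quotient.mk 1 : U ⧸ stIdeal n k i j) :=
  stIdeal_le_iff.1 le_rfl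

theorem mul_mem_of_st {n k i j : ℕ} {J : Submodule U U} {g : U}
    (h : St n k i j (g • (Submodule.Quotient.mk 1 : U ⧸ J))) :
    ∀ u ∈ stIdeal n k i j, u * g ∈ J := by
  intro u hu
  have := stIdeal_smul_iff.2 h u hu
  rwa [← mul_smul, smul_mk_one_eq_zero] at this

/-- Each inclusion is tested on the class of `1` in the quotient by the larger ideal, so only
implications between relations on a vector are needed. -/
theorem eq_sup_of_st {n k i j i₂ j₂ : ℕ} {g : U}
    (h1 : ∀ (M : Type) [AddCommGroup M] [Module U M] [Module ℂ M] [IsScalarTower ℂ U M] (v : M),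
      St n k i j v → g • v = 0 → St n k i₂ j₂ v)
    (h2 : ∀ (M : Type) [AddCommGroup M] [Module U M] [Module ℂ M] [IsScalarTower ℂ U M] (v : M),
      St n k i₂ j₂ v → St n k i j v ∧ g • v = 0) :
    stIdeal n k i₂ j₂ = stIdeal n k i j ⊔ Submodule.span U {g} := by
  apply le_antisymm
  · rw [stIdeal_le_iff]
    refine h1 _ _ (stIdeal_le_iff.1 le_sup_left) ?_
    rw [smul_mk_one_eq_zero]
    exact Submodule.mem_sup_right (Submodule.mem_span_singleton_self g)
  · have := h2 _ _ (st_mk_one n k i₂ j₂)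
    refine sup_le (stIdeal_le_iff.2 this.1) ?_
    rw [Submodule.span_le, Set.singleton_subset_iff]
    exact (smul_mk_one_eq_zero g).1 this.2

theorem stIdeal_congr {n k i j n' k' i' j' : ℕ}
    (h : ∀ (M : Type) [AddCommGroup M] [Module U M] [Module ℂ M] [IsScalarTower ℂ U M] (v : M),
      St n k i j v ↔ St n' k' i' j' v) : stIdeal n k i j = stIdeal n' k' i' j' :=
  le_antisymm (stIdeal_le_iff.2 ((h _ _).2 (st_mk_one _ _ _ _)))
    (stIdeal_le_iff.2 ((h _ _).1 (st_mk_one _ _ _ _)))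

theorem deg_yOdd_pow (k c : ℕ) : ∃ s : ℕ, toU (yOdd k) ^ c ∈ Udeg s :=
  ⟨c * (2 * k + 1), by exact_mod_cast pow_mem_Udeg (toU_mem_Udeg (yOdd_mem_CGdeg k)) c⟩

theorem deg_yEven_pow (k c : ℕ) : ∃ s : ℕ, toU (yEven k) ^ c ∈ Udeg s :=
  ⟨c * (4 * k), by exact_mod_cast pow_mem_Udeg (toU_mem_Udeg (yEven_mem_CGdeg k)) c⟩

theorem wt_yOdd_pow (k : ℕ) {c n n' : ℕ} (h : n' + c = n) :
    HasWt ((n' : ℤ) - n) (toU (yOdd k) ^ c) := by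
  convert (hasWt_yOdd k).pow c using 1
  rw [← h]; push_cast; ring

theorem wt_yEven_pow (k : ℕ) {c n n' : ℕ} (h : n' + 2 * c = n) :
    HasWt ((n' : ℤ) - n) (toU (yEven k) ^ c) := by
  convert (hasWt_yEven k).pow c using 1
  rw [← h]; push_cast; ring

theorem stI_zero (x a p : ℕ) : stI x a (p + 1) 0 = stI x a p x :=
  stIdeal_congr fun _ _ _ _ _ _ => stt_zero_iff

theorem stI_succ_of_le {x a y : ℕ} (h : 2 * y ≤ x) : stI x a 0 y = stI (x + 1) 0 a y := by
  rw [stI, stI, show 2 * y - x = 2 * y - (x + 1) by omega]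
  congr 1 <;> ring

/-- The weight of the generator. -/
abbrev wt (x a p y : ℕ) : ℕ := a * (x + 1) + p * x + y

theorem wt_eq (x a p y : ℕ) : wt x a p y = (a + p) * x + a + y := by
  rw [wt]; ring

/-- As `2(y+1) ≤ x`, the operator `O` kills the generator, and passing to the last part `y` only
lowers the exponent of `E`. By `St.yEven_pow_smul` the new relator generates a module with one part
`x` less. -/
theorem ext_of_two_mul_le {x a p y : ℕ} (h : 2 * (y + 1) ≤ x) :
    Ext (wt x a (p + 1) (y + 1)) (wt x a p (x - (y + 1))) (stI x a (p + 1) (y + 1))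
      (stI x a p (x - (y + 1))) (stI x (a + 1) p y) (toU (yEven (a + p + 1)) ^ (y + 1)) := by
  have hn := wt_eq x a (p + 1) (y + 1)
  have hn' : wt x a p (x - (y + 1)) + 2 * (y + 1) = wt x a (p + 1) (y + 1) := by
    rw [hn, wt_eq]
    have : (a + (p + 1)) * x = (a + p) * x + x := by ring
    omega
  have hk : a + p + 1 = a + (p + 1) := rfl
  have h0 : 2 * (y + 1) - x = 0 := by omega
  refine ⟨?_, ?_, deg_yEven_pow _ _, wt_yEven_pow _ hn', by omega⟩
  · rw [stI, stI]
    apply mul_mem_of_st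
    have hst := st_mk_one (wt x a (p + 1) (y + 1)) (a + p + 1) (y + 1) 0
    rw [h0, show 2 * (x - (y + 1)) - x = x - 2 * (y + 1) by omega]
    exact hst.yEven_pow_smul (a := a) (by omega) hn hn' h
  · rw [stI_eq (n := wt x a (p + 1) (y + 1)) (k := a + p + 1) (by rw [hn]; ring) (by ring),
      show stI x a (p + 1) (y + 1) = _ from rfl, stI, h0, show 2 * y - x = 0 by omega]
    refine eq_sup_of_st ?_ ?_
    · intro M _ _ _ _ v hv hg
      exact ⟨hv.hw, hv.trunc, hg, hv.odd⟩
    · intro M _ _ _ _ v hv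
      exact ⟨⟨hv.hw, hv.trunc, pow_smul_eq_zero_of_le (by omega) hv.even, hv.odd⟩, hv.even⟩

/-- In this boundary case `O v = 0` already forces `E^(y+1) v = 0`, so a single odd relator
suffices. -/
theorem ext_of_two_mul_eq {x a p y : ℕ} (h : 2 * (y + 1) = x + 1) :
    Ext (wt x a (p + 1) (y + 1)) (wt x a (p + 1) (x - (y + 1))) (stI x a (p + 1) (y + 1))
      (stI x a (p + 1) (x - (y + 1))) (stI x (a + 1) p y) (toU (yOdd (a + p + 1)) ^ 1) := by
  have hn := wt_eq x a (p + 1) (y + 1)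
  have hn' : wt x a (p + 1) (x - (y + 1)) + 1 = wt x a (p + 1) (y + 1) := by
    rw [hn, wt_eq]
    omega
  have h0 : 2 * (y + 1) - x = 1 := by omega
  refine ⟨?_, ?_, deg_yOdd_pow _ _, wt_yOdd_pow _ hn', by omega⟩
  · rw [stI, stI]
    apply mul_mem_of_st
    have hst := st_mk_one (wt x a (p + 1) (y + 1)) (a + p + 1) (y + 1) (2 * (y + 1) - x)
    have := hst.yOdd_pow_smul (a := a) (j := 2 * (x - (y + 1)) - x) (by omega) hn
      (by rw [h0]; exact hn') (by omega) (by omega)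
    rw [h0] at *
    exact this
  · rw [stI_eq (n := wt x a (p + 1) (y + 1)) (k := a + p + 1) (by rw [hn]; ring) (by ring),
      show stI x a (p + 1) (y + 1) = _ from rfl, stI, h0]
    refine eq_sup_of_st ?_ ?_
    · intro M _ _ _ _ v hv hg
      have hO : toU (yOdd (a + p + 1)) ^ (2 * y - x + 1) • v = 0 :=
        pow_smul_eq_zero_of_le (by omega) hg
      exact ⟨hv.hw, hv.trunc, yEven_pow_smul_eq_zero_of_state' (a := a) (x := x) hv.hw hv.trunc hn
        (by omega) (by omega) hO, hO⟩
    · intro M _ _ _ _ v hv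
      have hO := hv.odd
      rw [show 2 * y - x + 1 = 1 by omega] at hO
      exact ⟨⟨hv.hw, hv.trunc, pow_smul_eq_zero_of_le (by omega) hv.even,
        pow_smul_eq_zero_of_le (by omega) hO⟩, hO⟩

/-- For `x ≤ 2y` the exponent of `O` has to drop by two. The first half of the drop leads to an
ideal that is not a state. -/
theorem ext_of_lt_two_mul {x a p y : ℕ} (h : x ≤ 2 * y) (hy : y + 1 ≤ x) :
    Ext (wt x a (p + 1) (y + 1)) (wt x a (p + 1) (x - (y + 1))) (stI x a (p + 1) (y + 1))
      (stI x a (p + 1) (x - (y + 1))) (stIdeal (wt x a (p + 1) (y + 1)) (a + p + 1) (y + 1)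
        (2 * (y + 1) - x - 1)) (toU (yOdd (a + p + 1)) ^ (2 * (y + 1) - x)) := by
  have hn := wt_eq x a (p + 1) (y + 1)
  have hn' : wt x a (p + 1) (x - (y + 1)) + (2 * (y + 1) - x) = wt x a (p + 1) (y + 1) := by
    rw [hn, wt_eq]
    omega
  refine ⟨?_, ?_, deg_yOdd_pow _ _, wt_yOdd_pow _ hn', by omega⟩
  · rw [stI, stI]
    apply mul_mem_of_st
    have hst := st_mk_one (wt x a (p + 1) (y + 1)) (a + p + 1) (y + 1) (2 * (y + 1) - x)
    exact hst.yOdd_pow_smul (a := a) (by omega) hn hn' (by omega) (by omega)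
  · rw [show stI x a (p + 1) (y + 1) = _ from rfl, stI]
    refine eq_sup_of_st ?_ ?_
    · intro M _ _ _ _ v hv hg
      exact ⟨hv.hw, hv.trunc, hv.even, by rwa [show 2 * (y + 1) - x - 1 + 1 = 2 * (y + 1) - x by omega]⟩
    · intro M _ _ _ _ v hv
      have hO := hv.odd
      rw [show 2 * (y + 1) - x - 1 + 1 = 2 * (y + 1) - x by omega] at hO
      exact ⟨⟨hv.hw, hv.trunc, hv.even, pow_smul_eq_zero_of_le (by omega) hO⟩, hO⟩

/-- The second half of the drop, which also brings the even relation. The inequality `a < a + p +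
1`, a part `x` that absorbs the box, enters here. -/
theorem ext_of_lt_two_mul' {x a p y : ℕ} (h : x ≤ 2 * y) (hy : y + 1 ≤ x) :
    Ext (wt x a (p + 1) (y + 1)) (wt x (a + 1) p (x - (y + 1)))
      (stIdeal (wt x a (p + 1) (y + 1)) (a + p + 1) (y + 1) (2 * (y + 1) - x - 1))
      (stI x (a + 1) p (x - (y + 1))) (stI x (a + 1) p y)
      (toU (yOdd (a + p + 1)) ^ (2 * (y + 1) - x - 1)) := by
  have hn := wt_eq x a (p + 1) (y + 1)
  have hk : a + 1 + p = a + (p + 1) := by ring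
  have hn' : wt x (a + 1) p (x - (y + 1)) + (2 * (y + 1) - x - 1) = wt x a (p + 1) (y + 1) := by
    rw [hn, wt_eq, hk]
    omega
  refine ⟨?_, ?_, deg_yOdd_pow _ _, wt_yOdd_pow _ hn', by omega⟩
  · rw [stI_eq rfl (show a + p + 1 = a + 1 + p by ring)]
    apply mul_mem_of_st
    have hst := st_mk_one (wt x a (p + 1) (y + 1)) (a + p + 1) (y + 1) (2 * (y + 1) - x - 1)
    exact hst.yOdd_pow_smul' (a := a) (by omega) hn hn' (by omega) (by omega)
  · rw [stI_eq (n := wt x a (p + 1) (y + 1)) (k := a + p + 1) (by rw [hn]; ring) (by ring)]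
    refine eq_sup_of_st ?_ ?_
    · intro M _ _ _ _ v hv hg
      rw [show 2 * (y + 1) - x - 1 = 2 * y - x + 1 by omega] at hg
      exact ⟨hv.hw, hv.trunc, yEven_pow_smul_eq_zero_of_state' (a := a) (x := x) hv.hw hv.trunc hn
        (by omega) (by omega) hg, hg⟩
    · intro M _ _ _ _ v hv
      have hO := hv.odd
      rw [show 2 * y - x + 1 = 2 * (y + 1) - x - 1 by omega] at hO
      exact ⟨⟨hv.hw, hv.trunc, pow_smul_eq_zero_of_le (by omega) hv.even,
        pow_smul_eq_zero_of_le (by omega) hO⟩, hO⟩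

/-- Without parts equal to `x` the same partition can be read with `x + 1` in place of `x`. Weight
and truncation stay, and only the exponent of `O` drops, by one. -/
theorem ext_succ {x a y : ℕ} (h : x + 1 ≤ 2 * y) (hy : y ≤ x) :
    Ext (wt x a 0 y) (wt (x + 1) 0 a (x - y)) (stI x a 0 y) (stI (x + 1) 0 a (x - y))
      (stI (x + 1) 0 a y) (toU (yOdd a) ^ (2 * y - x)) := by
  have hn := wt_eq x a 0 y
  rw [add_zero] at hn
  have hn' : wt (x + 1) 0 a (x - y) + (2 * y - x) = wt x a 0 y := by
    rw [hn, wt_eq, show (0 + a) * (x + 1) = a * x + a by ring]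
    omega
  refine ⟨?_, ?_, deg_yOdd_pow _ _, wt_yOdd_pow _ hn', by omega⟩
  · rw [stI_eq rfl (show a = 0 + a by ring), stI_eq (x := x) rfl (add_zero a).symm]
    apply mul_mem_of_st
    have hst := st_mk_one (wt x a 0 y) a y (2 * y - x)
    exact hst.yOdd_pow_smul (a := a) le_rfl hn hn' (by omega) (by omega)
  · rw [stI_eq (n := wt x a 0 y) (k := a) (by rw [hn]; ring) (by ring),
      stI_eq (x := x) rfl (add_zero a).symm]
    refine eq_sup_of_st ?_ ?_
    · intro M _ _ _ _ v hv hg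
      exact ⟨hv.hw, hv.trunc, hv.even, by rwa [show 2 * y - (x + 1) + 1 = 2 * y - x by omega]⟩
    · intro M _ _ _ _ v hv
      have hO := hv.odd
      rw [show 2 * y - (x + 1) + 1 = 2 * y - x by omega] at hO
      exact ⟨⟨hv.hw, hv.trunc, hv.even, pow_smul_eq_zero_of_le (by omega) hO⟩, hO⟩

/-! ### Filtrations by Demazure modules -/

/-- `Flt m n J c`: iterated quotients reduce `U ⧸ J` to Demazure modules of level `m`. -/
inductive Flt (m : ℕ) : ℕ → Submodule U U → Ch → Prop
  | leaf (p y : ℕ) (hy : y ≤ m) : Flt m (wt m 0 p y) (stI m 0 p y) (ch m 0 p y)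
  | ext {n n' : ℕ} {J J' J₂ : Submodule U U} {g : U} {c c₂ : Ch} (h : Ext n n' J J' J₂ g)
      (h' : Flt m n' J' c) (h₂ : Flt m n J₂ c₂) : Flt m n J (c + c₂)

/-- Submodules in the extensions have smaller `n`. Quotients keep `n` and have smaller `p`; at `p =
0` the number `x` grows by one and `i = m - x` falls. At `x = m` there must be no part `m + 1` left,
which is the last condition. -/
theorem flt_state (m : ℕ) (n : ℕ) : ∀ i x a p y : ℕ, wt x a p y = n → y ≤ x → x + i = m →
    (0 < a → 0 < i) → Flt m n (stI x a p y) (ch x a p y) := by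
  induction n using Nat.strong_induction_on with
  | _ n ihn =>
  intro i
  induction i with
  | zero =>
    intro x a p y hn hy hx ha
    obtain rfl : a = 0 := by omega
    obtain rfl : x = m := by omega
    rw [← hn]
    exact Flt.leaf p y hy
  | succ i ihi =>
    intro x a p
    induction p generalizing a with
    | zero =>
      intro y hn hy hx _
      have hw : wt (x + 1) 0 a y = n := by rw [← hn, wt_eq, wt_eq]; ring
      have h2 := ihi (x + 1) 0 a y hw (by omega) (by omega) (by omega)
      rcases Nat.lt_or_ge x (2 * y) with h | h
      · have he := ext_succ (a := a) h hy
        have hlt := he.lt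
        rw [ch_succ_of_lt h hy]
        rw [hn] at he hlt
        exact Flt.ext he (ihn _ hlt i _ _ _ _ rfl (by omega) (by omega) (by omega)) h2
      · rw [stI_succ_of_le h, ch_succ_of_le h]
        exact h2
    | succ p ihp =>
      intro y hn hy hx _
      rcases y with _ | y
      · rw [stI_zero, ch_zero]
        exact ihp a x (by rw [← hn, wt_eq, wt_eq]; ring) le_rfl hx (by omega)
      · have hw : wt x (a + 1) p y = n := by rw [← hn, wt_eq, wt_eq]; ring
        have h2 := ihp (a + 1) y hw (by omega) hx (by omega)
        rcases lt_trichotomy (2 * (y + 1)) (x + 1) with h | h | h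
        · have he := ext_of_two_mul_le (a := a) (p := p) (Nat.lt_succ_iff.1 h)
          have hlt := he.lt
          rw [ch_of_two_mul_le (Nat.lt_succ_iff.1 h)]
          rw [hn] at he hlt
          exact Flt.ext he (ihn _ hlt (i + 1) _ _ _ _ rfl (by omega) (by omega) (by omega)) h2
        · have he := ext_of_two_mul_eq (a := a) (p := p) h
          have hlt := he.lt
          rw [ch_of_two_mul_eq h]
          rw [hn] at he hlt
          exact Flt.ext he (ihn _ hlt (i + 1) _ _ _ _ rfl (by omega) (by omega) (by omega)) h2
        · have he := ext_of_lt_two_mul (a := a) (p := p) (x := x) (y := y) (by omega) hy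
          have he' := ext_of_lt_two_mul' (a := a) (p := p) (x := x) (y := y) (by omega) hy
          have hlt := he.lt
          have hlt' := he'.lt
          rw [ch_of_lt_two_mul (by omega) hy]
          rw [hn] at he hlt he' hlt'
          exact Flt.ext he (ihn _ hlt (i + 1) _ _ _ _ rfl (by omega) (by omega) (by omega))
            (Flt.ext he' (ihn _ hlt' (i + 1) _ _ _ _ rfl (by omega) (by omega) (by omega)) h2)

/-! ### Generation of `U` by `𝔠𝔤` -/

/-- The map `𝔠𝔤 → S` lifts to `U → S`, and its composite with the inclusion is the identity by the
universal property. -/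
theorem subalgebra_eq_top (S : Subalgebra ℂ U) (h : ∀ z, toU z ∈ S) : S = ⊤ := by
  let f : CG →ₗ⁅ℂ⁆ S :=
    { toFun := fun z => ⟨toU z, h z⟩
      map_add' := fun a b => Subtype.ext (map_add _ a b)
      map_smul' := fun c a => Subtype.ext (map_smul _ c a)
      map_lie' := fun {a b} => Subtype.ext (toU_lie a b) }
  have hf : S.val.comp (UniversalEnvelopingAlgebra.lift ℂ f) = AlgHom.id ℂ U := by
    apply UniversalEnvelopingAlgebra.hom_ext
    ext z : 1
    change S.val (UniversalEnvelopingAlgebra.lift ℂ f (UniversalEnvelopingAlgebra.ι ℂ z)) = toU z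
    rw [UniversalEnvelopingAlgebra.lift_ι_apply]
    rfl
  refine eq_top_iff.2 fun u _ => ?_
  have := congrArg (fun F : U →ₐ[ℂ] U => F u) hf
  change ((UniversalEnvelopingAlgebra.lift ℂ f u : S) : U) = u at this
  rw [← this]
  exact Subtype.property _

section Module

variable {M : Type} [AddCommGroup M] [Module U M] [Module ℂ M] [IsScalarTower ℂ U M]

/-- A subspace stable under `𝔠𝔤` is stable under `U`. -/
theorem smul_mem_of_toU_smul_mem {W : Submodule ℂ M} (h : ∀ z, ∀ w ∈ W, toU z • w ∈ W) (u : U)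
    {w : M} (hw : w ∈ W) : u • w ∈ W := by
  let S : Subalgebra ℂ U :=
    { carrier := {u | ∀ w ∈ W, u • w ∈ W}
      mul_mem' := fun {a b} ha hb w hw => by rw [mul_smul]; exact ha _ (hb w hw)
      add_mem' := fun {a b} ha hb w hw => by rw [add_smul]; exact W.add_mem (ha w hw) (hb w hw)
      algebraMap_mem' := fun r w hw => by rw [algebraMap_smul]; exact W.smul_mem r hw }
  have : u ∈ S := by
    rw [subalgebra_eq_top S h]
    trivial
  exact this w hw

/-- The version of `smul_mem_of_toU_smul_mem` for the basis of `𝔠𝔤`. -/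
theorem smul_mem_of_basis {W : Submodule ℂ M} (hx : ∀ k, ∀ w ∈ W, toU (xOdd k) • w ∈ W)
    (he : ∀ k, ∀ w ∈ W, toU (xEven k) • w ∈ W) (hh : ∀ k, ∀ w ∈ W, toU (hDiag k) • w ∈ W)
    (hy : ∀ k, ∀ w ∈ W, toU (yOdd k) • w ∈ W) (hf : ∀ k, ∀ w ∈ W, toU (yEven k) • w ∈ W) (u : U)
    {w : M} (hw : w ∈ W) : u • w ∈ W := by
  refine smul_mem_of_toU_smul_mem (fun z => ?_) u hw
  let S : Submodule ℂ CG :=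
    { carrier := {z | ∀ w ∈ W, toU z • w ∈ W}
      zero_mem' := fun w _ => by rw [toU_zero, zero_smul]; exact W.zero_mem
      add_mem' := fun {a b} ha hb w hw => by
        rw [toU, map_add, add_smul]; exact W.add_mem (ha w hw) (hb w hw)
      smul_mem' := fun c a ha w hw => by
        rw [toU_smul, smul_assoc]; exact W.smul_mem c (ha w hw) }
  exact mem_of_basis S hx he hh hy hf z

/-! ### Modules for large level -/

/-- Truncation at `0` with `y_{1/2} v = 0` makes every basis element of positive degree act by zero
on the string `y₀^b v`, so only `sl₂` acts. -/
theorem St.smul_mem_span {n : ℕ} {v : M} (hv : St n 0 n 0 v) (u : U) :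
    u • v ∈ Submodule.span ℂ (Set.range fun b : Fin (n + 1) => toU (yEven 0) ^ (b : ℕ) • v) := by
  set W := Submodule.span ℂ (Set.range fun b : Fin (n + 1) => toU (yEven 0) ^ (b : ℕ) • v)
  have hmem : ∀ b : ℕ, toU (yEven 0) ^ b • v ∈ W := by
    intro b
    rcases Nat.lt_or_ge b (n + 1) with h | h
    · exact Submodule.subset_span ⟨⟨b, h⟩, rfl⟩
    · rw [pow_smul_eq_zero_of_le h hv.hw.integrable]
      exact W.zero_mem
  have hyo : ∀ k, toU (yOdd k) • v = 0 := by
    intro k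
    rcases k with _ | k
    · simpa using hv.odd
    · exact hv.trunc.odd _ (by omega)
  have hy : ∀ k b, toU (yOdd k) • toU (yEven 0) ^ b • v = 0 := by
    intro k b
    rw [← mul_smul, ← ((commute_yEven_yOdd 0 k).pow_left b).eq, mul_smul, hyo, smul_zero]
  have hf : ∀ k b, toU (yEven (k + 1)) • toU (yEven 0) ^ b • v = 0 := by
    intro k b
    rw [← mul_smul, ((commute_yEven_yEven (k + 1) 0).pow_right b).eq, mul_smul,
      hv.trunc.even _ (by omega), smul_zero]
  have hx : ∀ k b, toU (xOdd k) • toU (yEven 0) ^ b • v = 0 := by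
    intro k b
    induction b with
    | zero => simpa using hv.hw.xOdd k
    | succ b ih =>
      rw [pow_succ', mul_smul, toU_smul_of_lie_eq (lie_xOdd_yEven k 0), ih, hy, smul_zero, smul_zero,
        add_zero]
  have hh : ∀ k b, toU (hDiag (k + 1)) • toU (yEven 0) ^ b • v = 0 := by
    intro k b
    induction b with
    | zero => simpa using hv.hw.hDiag k
    | succ b ih =>
      rw [pow_succ', mul_smul]
      rcases Nat.even_or_odd' (k + 1) with ⟨l, h | h⟩
      · rw [h] at ih ⊢
        obtain ⟨l, rfl⟩ : ∃ i, l = i + 1 := ⟨l - 1, by omega⟩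
        rw [toU_smul_of_lie_eq (lie_hDiag_even_yEven (l + 1) 0), ih, zero_add, hf, smul_zero,
          smul_zero, add_zero]
      · rw [h] at ih ⊢
        rw [toU_smul_smul, lie_hDiag_odd_yEven, toU_zero, zero_smul, ih, smul_zero, add_zero]
  have he : ∀ k b, toU (xEven (k + 1)) • toU (yEven 0) ^ b • v = 0 := by
    intro k b
    induction b with
    | zero => simpa using hv.hw.xEven (k + 1)
    | succ b ih =>
      rw [pow_succ', mul_smul, toU_smul_smul, ih, lie_xEven_yEven,
        show 2 * (k + 1 + 0) = 2 * k + 1 + 1 by ring, hh, smul_zero, add_zero]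
  have hgen : ∀ z : CG, (∀ b : ℕ, toU z • toU (yEven 0) ^ b • v ∈ W) →
      ∀ w ∈ W, toU z • w ∈ W := by
    intro z hz w hw
    induction hw using Submodule.span_induction with
    | mem w hw =>
      obtain ⟨b, rfl⟩ := hw
      exact hz b
    | zero => rw [smul_zero]; exact W.zero_mem
    | add a b _ _ ha hb => rw [smul_add]; exact W.add_mem ha hb
    | smul c a _ ha => rw [smul_smul_comm']; exact W.smul_mem c ha
  refine smul_mem_of_basis (fun k => hgen _ fun b => ?_) (fun k => hgen _ fun b => ?_)
    (fun k => hgen _ fun b => ?_) (fun k => hgen _ fun b => ?_) (fun k => hgen _ fun b => ?_) u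
    (by simpa using hmem 0)
  · rw [hx]; exact W.zero_mem
  · rcases k with _ | k
    · rcases b with _ | b
      · rw [pow_zero, one_smul, hv.hw.xEven]; exact W.zero_mem
      · rw [hv.hw.toIsPrim.xEven_smul_pow]
        exact W.smul_mem _ (hmem b)
    · rw [he]; exact W.zero_mem
  · rcases k with _ | k
    · rw [hDiag_zero, hv.hw.toIsPrim.h0_smul_pow]
      exact W.smul_mem _ (hmem b)
    · rw [hh]; exact W.zero_mem
  · rw [hy]; exact W.zero_mem
  · rcases k with _ | k
    · rw [← mul_smul, ← pow_succ']
      exact hmem (b + 1)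
    · rw [hf]; exact W.zero_mem

end Module

/-! ### Spanning families of weight vectors -/

/-- The module `U ⧸ J` has a spanning family of weight vectors with character `c`; the weights are
counted from the weight `n` of the generator. -/
def Spanned (n : ℕ) (J : Submodule U U) (c : Ch) : Prop :=
  ∃ (ι : Type) (_ : Fintype ι) (u : ι → U) (w : ι → ℤ), (∀ i, HasWt (w i - n) (u i)) ∧
    (∀ z : U, ∃ a : ι → ℂ, z - ∑ i, a i • u i ∈ J) ∧ ∑ i, LaurentPolynomial.T (w i) = c

/-- A spanning family of `U ⧸ J'` multiplied by `g` and lifts of one of `U ⧸ J₂` span together. Only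
the inclusion `J' g ⊆ J` is used, so this gives an upper bound. -/
theorem Ext.spanned {n n' : ℕ} {J J' J₂ : Submodule U U} {g : U} {c c₂ : Ch}
    (h : Ext n n' J J' J₂ g) (h' : Spanned n' J' c) (h₂ : Spanned n J₂ c₂) :
    Spanned n J (c + c₂) := by
  obtain ⟨ι, _, u, w, hw, hs, rfl⟩ := h'
  obtain ⟨κ, _, u₂, w₂, hw₂, hs₂, rfl⟩ := h₂
  refine ⟨ι ⊕ κ, inferInstance, Sum.elim (fun i => u i * g) u₂, Sum.elim w w₂, ?_, ?_, ?_⟩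
  · rintro (i | i)
    · have := (hw i).mul h.wt
      rwa [show w i - n' + ((n' : ℤ) - n) = w i - n by ring] at this
    · exact hw₂ i
  · intro z
    obtain ⟨a₂, ha₂⟩ := hs₂ z
    rw [h.sup, Submodule.mem_sup] at ha₂
    obtain ⟨j, hj, r, hr, hjr⟩ := ha₂
    obtain ⟨q, rfl⟩ := Submodule.mem_span_singleton.1 hr
    obtain ⟨a, ha⟩ := hs q
    refine ⟨Sum.elim a a₂, ?_⟩
    have h1 := J.add_mem hj (h.colon _ ha)
    convert h1 using 1
    rw [Fintype.sum_sum_type]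
    simp only [Sum.elim_inl, Sum.elim_inr]
    rw [sub_mul, Finset.sum_mul]
    simp only [smul_mul_assoc]
    rw [smul_eq_mul] at hjr
    rw [add_comm (∑ i, a i • (u i * g)), ← sub_sub, ← hjr, add_sub_assoc]
  · rw [Fintype.sum_sum_type]
    rfl

theorem spanned_leaf {m n : ℕ} (h : 2 * n ≤ m) : Spanned n (stI m 0 0 n) (ch m 0 0 n) := by
  have e : stI m 0 0 n = stIdeal n 0 n 0 := by
    rw [stI_eq (n := n) (k := 0) (by ring) rfl, show 2 * n - m = 0 by omega]
  refine ⟨Fin (n + 1), inferInstance, fun b => toU (yEven 0) ^ (b : ℕ), fun b => (n : ℤ) - 2 * b,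
    ?_, ?_, ?_⟩
  · intro b
    convert (hasWt_yEven 0).pow b using 1
    ring
  · intro z
    have := (st_mk_one n 0 n 0).smul_mem_span z
    obtain ⟨a, ha⟩ := (Submodule.mem_span_range_iff_exists_fun ℂ).1 this
    refine ⟨a, ?_⟩
    rw [e, ← smul_mk_one_eq_zero, sub_smul, ← ha, Finset.sum_smul, sub_eq_zero]
    simp only [smul_assoc]
  · rw [ch, pow_zero, pow_zero, one_mul, one_mul, chD, min_eq_right (by omega), chS_succ_sub,
      Finset.sum_range]

theorem Flt.spanned_of_le {m n : ℕ} {J : Submodule U U} {c : Ch} (h : Flt m n J c) (hm : 0 < m) :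
    2 * n ≤ m → Spanned n J c := by
  induction h with
  | leaf p y hy =>
    intro h
    rcases p with _ | p
    · rw [show wt m 0 0 y = y by simp [wt]] at *
      exact spanned_leaf h
    · rw [wt_eq] at h
      -- A leaf with `p > 0` has weight at least `m`, contrary to `2n ≤ m`.
      have : (0 + (p + 1)) * m = p * m + m := by ring
      have : 0 ≤ p * m := Nat.zero_le _
      omega
  | ext h _ _ ih ih₂ =>
    intro hn
    exact h.spanned (ih (by have := h.lt; omega)) (ih₂ hn)

/-- The level is chosen above `2n`, so that all leaves of the reduction are irreducible
`sl₂`-modules. -/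
theorem spanned_state {x a p y : ℕ} (hy : y ≤ x) : Spanned (wt x a p y) (stI x a p y) (ch x a p y) :=
  (flt_state (x + (2 * wt x a p y + 1)) _ _ x a p y rfl hy rfl (by omega)).spanned_of_le
    (by omega) (by omega)

theorem Flt.spanned {m n : ℕ} {J : Submodule U U} {c : Ch} (h : Flt m n J c) : Spanned n J c := by
  induction h with
  | leaf p y hy => exact spanned_state hy
  | ext h _ _ ih ih₂ => exact h.spanned ih ih₂

/-! ### Exactness -/

theorem Spanned.finite {n : ℕ} {J : Submodule U U} {c : Ch} (h : Spanned n J c) :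
    Module.Finite ℂ (U ⧸ J) ∧ (Module.finrank ℂ (U ⧸ J) : ℤ) ≤ chDim c := by
  obtain ⟨ι, _, u, w, hw, hs, rfl⟩ := h
  have htop : Submodule.span ℂ (Set.range fun i => (Submodule.Quotient.mk (u i) : U ⧸ J)) = ⊤ := by
    refine eq_top_iff.2 fun z _ => ?_
    obtain ⟨z, rfl⟩ := Submodule.Quotient.mk_surjective _ z
    obtain ⟨a, ha⟩ := hs z
    rw [Submodule.mem_span_range_iff_exists_fun]
    refine ⟨a, ?_⟩
    have := (Submodule.Quotient.mk_eq_zero J).2 ha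
    rw [Submodule.Quotient.mk_sub, sub_eq_zero] at this
    rw [this, ← Submodule.mkQ_apply, map_sum]
    rfl
  constructor
  · exact ⟨⟨(Set.finite_range _).toFinset, by simpa using htop⟩⟩
  · have := finrank_range_le_card (R := ℂ) fun i => (Submodule.Quotient.mk (u i) : U ⧸ J)
    rw [Set.finrank, htop, finrank_top] at this
    rw [map_sum]
    simp only [chDim_T]
    simpa using this

/-- The module `U ⧸ J` has a basis of weight vectors with character `c`. -/
def IsExact (n : ℕ) (J : Submodule U U) (c : Ch) : Prop :=
  Spanned n J c ∧ (Module.finrank ℂ (U ⧸ J) : ℤ) = chDim c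

/-- The dimension of `U ⧸ J` is at most the sum of those of `U ⧸ J'` and `U ⧸ J₂`, which are bounded
by the characters. If the total is attained, both bounds are equalities and `α` is injective, so
`J'` is the whole annihilator of the class of `g`. -/
theorem Ext.isExact {n n' : ℕ} {J J' J₂ : Submodule U U} {g : U} {c c₂ : Ch}
    (h : Ext n n' J J' J₂ g) (h' : Spanned n' J' c) (h₂ : Spanned n J₂ c₂)
    (hJ : (Module.finrank ℂ (U ⧸ J) : ℤ) = chDim (c + c₂)) :
    IsExact n' J' c ∧ IsExact n J₂ c₂ ∧ ∀ u, u * g ∈ J ↔ u ∈ J' := by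
  have f' := h'.finite.1
  have f₂ := h₂.finite.1
  have f := (h.spanned h' h₂).finite.1
  have hle : J ≤ J₂ := by rw [h.sup]; exact le_sup_left
  have hle' : J' ≤ J.comap (LinearMap.toSpanSingleton U U g) := h.colon
  let α : (U ⧸ J') →ₗ[ℂ] (U ⧸ J) := (J'.mapQ J (LinearMap.toSpanSingleton U U g) hle').restrictScalars ℂ
  let β : (U ⧸ J) →ₗ[ℂ] (U ⧸ J₂) := (J.mapQ J₂ LinearMap.id hle).restrictScalars ℂ
  have hβ : Function.Surjective β := by
    intro z
    obtain ⟨z, rfl⟩ := Submodule.Quotient.mk_surjective _ z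
    exact ⟨Submodule.Quotient.mk z, rfl⟩
  have hker : LinearMap.ker β ≤ LinearMap.range α := by
    intro z hz
    obtain ⟨z, rfl⟩ := Submodule.Quotient.mk_surjective _ z
    have hz : (Submodule.Quotient.mk z : U ⧸ J₂) = 0 := hz
    rw [Submodule.Quotient.mk_eq_zero, h.sup, Submodule.mem_sup] at hz
    obtain ⟨j, hj, r, hr, rfl⟩ := hz
    obtain ⟨q, rfl⟩ := Submodule.mem_span_singleton.1 hr
    refine ⟨Submodule.Quotient.mk q, ?_⟩
    change (Submodule.Quotient.mk (q • g) : U ⧸ J) = _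
    rw [Submodule.Quotient.mk_add, (Submodule.Quotient.mk_eq_zero J).2 hj, zero_add]
  have h1 := LinearMap.finrank_range_add_finrank_ker β
  rw [LinearMap.range_eq_top.2 hβ, finrank_top] at h1
  have h2 := LinearMap.finrank_range_add_finrank_ker α
  have h3 := Submodule.finrank_mono hker
  have h5 := h'.finite.2
  have h6 := h₂.finite.2
  rw [map_add] at hJ
  refine ⟨⟨h', by omega⟩, ⟨h₂, by omega⟩, fun u => ⟨fun hu => ?_, h.colon u⟩⟩
  have h7 : Module.finrank ℂ (LinearMap.ker α) = 0 := by omega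
  have h8 := Submodule.finrank_eq_zero.1 h7
  have h9 : (Submodule.Quotient.mk u : U ⧸ J') ∈ LinearMap.ker α := by
    change (Submodule.Quotient.mk (u • g) : U ⧸ J) = 0
    rwa [Submodule.Quotient.mk_eq_zero]
  rw [h8, Submodule.mem_bot, Submodule.Quotient.mk_eq_zero] at h9
  exact h9

theorem IsExact.of_ext {n n' : ℕ} {J J' J₂ : Submodule U U} {g : U} {c c₂ : Ch}
    (hJ : IsExact n J (c + c₂)) (h : Ext n n' J J' J₂ g) (h' : Spanned n' J' c)
    (h₂ : Spanned n J₂ c₂) : IsExact n J₂ c₂ :=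
  (h.isExact h' h₂ hJ.2).2.1

/-! ### Tensor powers of the natural representation

The tensor product of `n` copies of `K³` is realized as the space of multilinear polynomials in
`n` groups of three variables, on which tuples of matrices act by derivations. -/

section Tensor

variable {K : Type} [CommRing K] {n : ℕ}

/-- The multilinear monomials. -/
def tmon (K : Type) [CommRing K] {n : ℕ} (c : Fin n → Fin 3) : MvPolynomial (Fin n × Fin 3) K :=
  ∏ i, MvPolynomial.X (i, c i)

/-- The derivation by which a tuple of matrices acts. -/
def tder (m : Fin n → Matrix (Fin 3) (Fin 3) K) :
    Derivation K (MvPolynomial (Fin n × Fin 3) K) (MvPolynomial (Fin n × Fin 3) K) :=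
  MvPolynomial.mkDerivation K fun i => ∑ b, m i.1 b i.2 • MvPolynomial.X (i.1, b)

theorem tder_X (m : Fin n → Matrix (Fin 3) (Fin 3) K) (i : Fin n) (a : Fin 3) :
    tder m (MvPolynomial.X (i, a)) = ∑ b, m i b a • MvPolynomial.X (i, b) := by
  rw [tder, MvPolynomial.mkDerivation_X]

theorem derivation_prod {A ι : Type} [CommRing A] [Algebra K A] [DecidableEq ι] (D : Derivation K A A)
    (s : Finset ι) (f : ι → A) :
    D (∏ i ∈ s, f i) = ∑ i ∈ s, (∏ j ∈ s.erase i, f j) * D (f i) := by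
  induction s using Finset.induction_on with
  | empty => simp
  | insert a s ha ih =>
    rw [Finset.prod_insert ha, Derivation.leibniz, ih, Finset.sum_insert ha,
      Finset.erase_insert ha, smul_eq_mul, smul_eq_mul, Finset.mul_sum, add_comm]
    congr 1
    refine Finset.sum_congr rfl fun i hi => ?_
    have hne : a ≠ i := fun h => ha (h ▸ hi)
    rw [Finset.erase_insert_of_ne hne, Finset.prod_insert (fun h => ha (Finset.mem_of_mem_erase h)),
      mul_assoc]

theorem tmon_update (c : Fin n → Fin 3) (i : Fin n) (b : Fin 3) :
    tmon K (Function.update c i b) =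
      (∏ j ∈ Finset.univ.erase i, MvPolynomial.X (j, c j)) * MvPolynomial.X (i, b) := by
  rw [tmon, ← Finset.mul_prod_erase _ _ (Finset.mem_univ i), Function.update_self, mul_comm]
  congr 1
  refine Finset.prod_congr rfl fun j hj => ?_
  rw [Function.update_of_ne (Finset.ne_of_mem_erase hj)]

theorem tder_tmon (m : Fin n → Matrix (Fin 3) (Fin 3) K) (c : Fin n → Fin 3) :
    tder m (tmon K c) = ∑ i, ∑ b, m i b (c i) • tmon K (Function.update c i b) := by
  conv_lhs => rw [tmon]
  rw [derivation_prod]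
  refine Finset.sum_congr rfl fun i _ => ?_
  rw [tder_X, Finset.mul_sum]
  refine Finset.sum_congr rfl fun b _ => ?_
  rw [tmon_update, mul_smul_comm]

theorem tder_add (m m' : Fin n → Matrix (Fin 3) (Fin 3) K) : tder (m + m') = tder m + tder m' := by
  refine MvPolynomial.derivation_ext fun i => ?_
  rw [Derivation.add_apply, tder_X, tder_X, tder_X, ← Finset.sum_add_distrib]
  refine Finset.sum_congr rfl fun b _ => ?_
  rw [← add_smul]
  rfl

theorem tder_lie (m m' : Fin n → Matrix (Fin 3) (Fin 3) K) (f : MvPolynomial (Fin n × Fin 3) K) :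
    tder (fun i => m i * m' i - m' i * m i) f = tder m (tder m' f) - tder m' (tder m f) := by
  rw [← Derivation.commutator_apply]
  congr 1
  refine MvPolynomial.derivation_ext fun i => ?_
  rw [Derivation.commutator_apply, tder_X, tder_X, tder_X, map_sum, map_sum]
  simp only [Derivation.map_smul, tder_X, Finset.smul_sum, smul_smul]
  rw [Finset.sum_comm, Finset.sum_comm (f := fun a b => (m i.1 a i.2 * m' i.1 b a) • _),
    ← Finset.sum_sub_distrib]
  refine Finset.sum_congr rfl fun b _ => ?_
  rw [← Finset.sum_smul, ← Finset.sum_smul, ← sub_smul]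
  congr 1
  rw [Matrix.sub_apply, Matrix.mul_apply, Matrix.mul_apply]
  simp only [mul_comm]

theorem map_tder {K' : Type} [CommRing K'] (g : K →+* K') (m : Fin n → Matrix (Fin 3) (Fin 3) K)
    (f : MvPolynomial (Fin n × Fin 3) K) :
    MvPolynomial.map g (tder m f) = tder (fun i => (m i).map g) (MvPolynomial.map g f) := by
  induction f using MvPolynomial.induction_on with
  | C a => simp
  | add p q hp hq => simp only [map_add, hp, hq]
  | mul_X p i hp =>
    obtain ⟨i, a⟩ := i
    simp only [Derivation.leibniz, map_mul, map_add, smul_eq_mul, hp, MvPolynomial.map_X, tder_X,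
      map_sum, MvPolynomial.smul_eq_C_mul, MvPolynomial.map_C, Matrix.map_apply]

theorem map_tmon {K' : Type} [CommRing K'] (g : K →+* K') (c : Fin n → Fin 3) :
    MvPolynomial.map g (tmon K c) = tmon K' c := by
  simp [tmon, map_prod]

/-- In the Leibniz expansion of `D^(a+b+1) (f g)` each term has at least `a + 1` derivatives on `f`
or `b + 1` on `g`. -/
theorem iterate_derivation_mul_eq_zero {A : Type} [CommRing A] [Algebra K A] (D : Derivation K A A)
    (N : ℕ) : ∀ (a b : ℕ) (f g : A), a + b = N → (D : A → A)^[a + 1] f = 0 → D^[b + 1] g = 0 →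
    D^[N + 1] (f * g) = 0 := by
  induction N with
  | zero =>
    intro a b f g hab hf hg
    obtain rfl : a = 0 := by omega
    obtain rfl : b = 0 := by omega
    simp only [zero_add, Function.iterate_one] at *
    rw [Derivation.leibniz, hf, hg, smul_zero, smul_zero, add_zero]
  | succ N ih =>
    intro a b f g hab hf hg
    have hadd : ∀ (k : ℕ) (x y : A), (D : A → A)^[k] (x + y) = D^[k] x + D^[k] y := by
      intro k x y
      exact iterate_map_add D k x y
    have hz : ∀ k : ℕ, (D : A → A)^[k] 0 = 0 := fun k => iterate_map_zero D k
    rw [Function.iterate_succ_apply, Derivation.leibniz, hadd, smul_eq_mul, smul_eq_mul]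
    have h1 : (D : A → A)^[N + 1] (f * D g) = 0 := by
      rcases b with _ | b
      · rw [zero_add, Function.iterate_one] at hg
        rw [hg, mul_zero, hz]
      · exact ih a b f (D g) (by omega) hf hg
    have h2 : (D : A → A)^[N + 1] (g * D f) = 0 := by
      rcases a with _ | a
      · rw [zero_add, Function.iterate_one] at hf
        rw [hf, mul_zero, hz]
      · rw [mul_comm]
        exact ih a b (D f) g (by omega) hf hg
    rw [h1, h2, add_zero]

theorem iterate_derivation_prod_eq_zero {A ι : Type} [CommRing A] [Algebra K A] [DecidableEq ι]
    (D : Derivation K A A) (s : Finset ι) (f : ι → A) (h : ∀ i ∈ s, D (D (f i)) = 0) :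
    (D : A → A)^[s.card + 1] (∏ i ∈ s, f i) = 0 := by
  induction s using Finset.induction_on with
  | empty => simp
  | insert a s ha ih =>
    rw [Finset.prod_insert ha, Finset.card_insert_of_notMem ha]
    refine iterate_derivation_mul_eq_zero D _ 1 s.card _ _ (add_comm _ _) ?_
      (ih fun i hi => h i (Finset.mem_insert_of_mem hi))
    exact h a (Finset.mem_insert_self _ _)

theorem linearIndependent_tmon : LinearIndependent K (tmon K : (Fin n → Fin 3) → _) := by
  have h : (tmon K : (Fin n → Fin 3) → _) = (MvPolynomial.basisMonomials (Fin n × Fin 3) K) ∘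
      fun c => ∑ i, Finsupp.single (i, c i) 1 := by
    funext c
    exact (MvPolynomial.monomial_sum_one _ _).symm
  rw [h]
  refine (MvPolynomial.basisMonomials _ _).linearIndependent.comp _ ?_
  intro c c' hc
  funext i
  by_contra hne
  have := congrArg (fun f => f (i, c i)) hc
  simp only [Finsupp.coe_finsetSum, Finset.sum_apply] at this
  rw [Finset.sum_eq_single i, Finset.sum_eq_zero] at this
  · simp at this
  · intro j _
    rw [Finsupp.single_apply, if_neg]
    rw [Prod.mk.injEq]
    rintro ⟨rfl, h⟩
    exact hne h.symm
  · intro j _ hj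
    rw [Finsupp.single_apply, if_neg]
    rw [Prod.mk.injEq]
    exact fun h => hj h.1
  · simp

end Tensor

/-! ### The family of evaluation modules -/

/-- The points at which the polynomials are evaluated. -/
def pt {n : ℕ} (i : Fin n) : ℂ := (i : ℕ) + 1

theorem pt_ne_zero {n : ℕ} (i : Fin n) : pt i ≠ 0 := Nat.cast_add_one_ne_zero _

/-- Fourth powers must differ because the polynomials in `sepPoly`, which separate the points, have
to be invariant under `t ↦ i t`. -/
theorem pt_pow_ne {n : ℕ} {i j : Fin n} (h : i ≠ j) : pt i ^ 4 ≠ pt j ^ 4 := by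
  intro he
  have h1 : ((i : ℕ) + 1) ^ 4 = ((j : ℕ) + 1) ^ 4 := by
    have : ((((i : ℕ) + 1) ^ 4 : ℕ) : ℂ) = (((j : ℕ) + 1) ^ 4 : ℕ) := by push_cast; exact he
    exact_mod_cast this
  have h2 := Nat.pow_left_injective (n := 4) (by norm_num) h1
  exact h (Fin.ext (by simpa using h2))

/-- The substitution `t ↦ s a_i`. -/
def evPt {n : ℕ} (i : Fin n) : ℂ[X] →ₐ[ℂ] ℂ[X] :=
  Polynomial.aeval (Polynomial.C (pt i) * Polynomial.X)

/-- The matrices by which an element of `𝔠𝔤` acts on the evaluation modules. -/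
def evMat (n : ℕ) (z : CG) (i : Fin n) : Matrix (Fin 3) (Fin 3) ℂ[X] :=
  z.1.map (evPt i)

/-- The polynomials in which the evaluation modules live. -/
abbrev TP (n : ℕ) : Type := MvPolynomial (Fin n × Fin 3) ℂ[X]

/-- The action of `𝔠𝔤`. -/
def evRep (n : ℕ) : CG →ₗ⁅ℂ⁆ Module.End ℂ[X] (TP n) where
  toFun z := (tder (evMat n z)).toLinearMap
  map_add' a b := by
    have : evMat n (a + b) = evMat n a + evMat n b := by
      funext i
      exact Matrix.map_add (evPt i) (map_add _) _ _
    rw [this, tder_add]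
    rfl
  map_smul' c a := by
    have : evMat n (c • a) = (Polynomial.C c) • evMat n a := by
      funext i
      ext1 j k
      change evPt i ((c • a.1) j k) = Polynomial.C c * evPt i (a.1 j k)
      rw [Matrix.smul_apply, map_smul, Polynomial.smul_eq_C_mul]
    rw [this, RingHom.id_apply]
    have h2 : tder ((Polynomial.C c) • evMat n a) = (Polynomial.C c) • tder (evMat n a) := by
      refine MvPolynomial.derivation_ext fun i => ?_
      rw [Derivation.smul_apply, tder_X, tder_X, Finset.smul_sum]
      refine Finset.sum_congr rfl fun b _ => ?_
      rw [smul_smul]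
      rfl
    rw [h2]
    refine LinearMap.ext fun f => ?_
    change Polynomial.C c • tder (evMat n a) f = c • tder (evMat n a) f
    rw [← Polynomial.algebraMap_eq, algebraMap_smul]
  map_lie' {a b} := by
    have : evMat n ⁅a, b⁆ = fun i => evMat n a i * evMat n b i - evMat n b i * evMat n a i := by
      funext i
      rw [evMat, lie_val, Matrix.map_sub (evPt i) (map_sub _), Matrix.map_mul, Matrix.map_mul]
      rfl
    rw [this]
    refine LinearMap.ext fun f => ?_
    exact tder_lie _ _ _

/-- The action of `U`. -/
def evU (n : ℕ) : U →ₐ[ℂ] Module.End ℂ[X] (TP n) := UniversalEnvelopingAlgebra.lift ℂ (evRep n)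

theorem evU_toU (n : ℕ) (z : CG) (f : TP n) : evU n (toU z) f = tder (evMat n z) f := by
  rw [evU, toU, UniversalEnvelopingAlgebra.lift_ι_apply]
  rfl

/-- The highest weight vector. -/
def tvec (n : ℕ) : TP n := tmon ℂ[X] fun _ => 0

theorem tder_tvec {n : ℕ} {m : Fin n → Matrix (Fin 3) (Fin 3) ℂ[X]}
    (h : ∀ i, m i 1 0 = 0 ∧ m i 2 0 = 0) : tder m (tvec n) = (∑ i, m i 0 0) • tvec n := by
  rw [tvec, tder_tmon, Finset.sum_smul]
  refine Finset.sum_congr rfl fun i _ => ?_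
  rw [Fin.sum_univ_three, (h i).1, (h i).2, zero_smul, zero_smul, add_zero, add_zero,
    Function.update_eq_self_iff.2 rfl]

theorem evU_nPlus {n : ℕ} {z : CG} (hz : z ∈ nPlus) : evU n (toU z) (tvec n) = 0 := by
  have h : ∀ (i : Fin n) b, evMat n z i b 0 = 0 := by
    intro i b
    rw [evMat, Matrix.map_apply, hz b 0 (Fin.zero_le b), map_zero]
  rw [evU_toU, tder_tvec fun i => ⟨h i 1, h i 2⟩]
  simp [h]

/-- A polynomial without constant term becomes divisible by `s` under `t ↦ s a_i`; at `s = 0` the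
action is therefore zero. -/
theorem evU_hPlus {n : ℕ} {z : CG} (hz : z ∈ hPlus) :
    ∃ q : ℂ[X], evU n (toU z) (tvec n) = (Polynomial.X * q) • tvec n := by
  have h : ∀ (i : Fin n) b, b ≠ 0 → evMat n z i b 0 = 0 := by
    intro i b hb
    rw [evMat, Matrix.map_apply, hz.1 b 0 hb, map_zero]
  obtain ⟨q, hq⟩ := Polynomial.X_dvd_iff.2 (hz.2 0)
  refine ⟨∑ i : Fin n, Polynomial.C (pt i) * evPt i q, ?_⟩
  rw [evU_toU, tder_tvec fun i => ⟨h i 1 (by decide), h i 2 (by decide)⟩, Finset.mul_sum]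
  congr 1
  refine Finset.sum_congr rfl fun i _ => ?_
  rw [evMat, Matrix.map_apply, hq, map_mul, evPt, Polynomial.aeval_X]
  ring

theorem evU_h0 (n : ℕ) : evU n (toU h0) (tvec n) = (n : ℂ[X]) • tvec n := by
  rw [evU_toU, tder_tvec fun i => ⟨by simp [evMat, h0], by simp [evMat, h0]⟩]
  simp [evMat, h0]

/-- On each of the `n` factors `y₀` has square zero. -/
theorem evU_yEven_pow (n : ℕ) : evU n (toU (yEven 0) ^ (n + 1)) (tvec n) = 0 := by
  have h1 : ∀ k (f : TP n), evU n (toU (yEven 0) ^ k) f = (tder (evMat n (yEven 0)))^[k] f := by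
    intro k
    induction k with
    | zero => intro f; simp
    | succ k ih =>
      intro f
      rw [pow_succ, map_mul, Module.End.mul_apply, ih, evU_toU, Function.iterate_succ_apply]
  rw [h1, tvec, tmon]
  have := iterate_derivation_prod_eq_zero (tder (evMat n (yEven 0))) Finset.univ
    (fun i : Fin n => (MvPolynomial.X (i, 0) : TP n)) ?_
  · rwa [Finset.card_univ, Fintype.card_fin] at this
  · intro i _
    have e1 : evMat n (yEven 0) i = !![0, 0, 0; 0, 0, 0; 1, 0, 0] := by
      ext1 j k
      fin_cases j <;> fin_cases k <;> simp [evMat, yEven]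
    rw [tder_X, e1]
    simp [Fin.sum_univ_three, tder_X, e1]

/-- The lattice generated by the highest weight vector. -/
def lattice (n : ℕ) : Submodule ℂ[X] (TP n) :=
  Submodule.span ℂ[X] (Set.range fun u => evU n u (tvec n))

theorem evU_mem_lattice (n : ℕ) (u : U) : evU n u (tvec n) ∈ lattice n :=
  Submodule.subset_span ⟨u, rfl⟩

theorem evU_lattice {n : ℕ} (u : U) {f : TP n} (hf : f ∈ lattice n) : evU n u f ∈ lattice n := by
  induction hf using Submodule.span_induction with
  | mem f hf =>
    obtain ⟨w, rfl⟩ := hf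
    change evU n u (evU n w (tvec n)) ∈ _
    rw [← Module.End.mul_apply, ← map_mul]
    exact evU_mem_lattice n _
  | zero => rw [map_zero]; exact Submodule.zero_mem _
  | add a b _ _ ha hb => rw [map_add]; exact Submodule.add_mem _ ha hb
  | smul c a _ ha => rw [map_smul]; exact Submodule.smul_mem _ c ha

theorem lattice_le (n : ℕ) :
    lattice n ≤ Submodule.span ℂ[X] (Set.range (tmon ℂ[X] : (Fin n → Fin 3) → TP n)) := by
  set P := Submodule.span ℂ[X] (Set.range (tmon ℂ[X] : (Fin n → Fin 3) → TP n)) with hP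
  have hmon : ∀ c, (tmon ℂ[X] c : TP n) ∈ P := fun c => Submodule.subset_span ⟨c, rfl⟩
  let S : Subalgebra ℂ U :=
    { carrier := {u | ∀ f ∈ P, evU n u f ∈ P}
      mul_mem' := fun {a b} ha hb f hf => by
        rw [map_mul, Module.End.mul_apply]; exact ha _ (hb f hf)
      add_mem' := fun {a b} ha hb f hf => by
        rw [map_add, LinearMap.add_apply]; exact P.add_mem (ha f hf) (hb f hf)
      algebraMap_mem' := fun r f hf => by
        rw [AlgHom.commutes, Module.algebraMap_end_apply, ← algebraMap_smul ℂ[X] r f]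
        exact P.smul_mem _ hf }
  have hS : S = ⊤ := by
    refine subalgebra_eq_top S fun z f hf => ?_
    rw [evU_toU]
    induction hf using Submodule.span_induction with
    | mem f hf =>
      obtain ⟨c, rfl⟩ := hf
      rw [tder_tmon]
      exact P.sum_mem fun i _ => P.sum_mem fun b _ => P.smul_mem _ (hmon _)
    | zero => rw [map_zero]; exact P.zero_mem
    | add a b _ _ ha hb => rw [map_add]; exact P.add_mem ha hb
    | smul c a _ ha => rw [Derivation.map_smul]; exact P.smul_mem c ha
  rw [lattice, Submodule.span_le]
  rintro _ ⟨u, rfl⟩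
  have hu : u ∈ S := by rw [hS]; trivial
  exact hu _ (hmon _)

instance (n : ℕ) : Module.Finite ℂ[X] (lattice n) := by
  have h1 : (Submodule.span ℂ[X] (Set.range (tmon ℂ[X] : (Fin n → Fin 3) → TP n))).FG :=
    Submodule.fg_span (Set.finite_range _)
  have h2 := isNoetherian_of_fg_of_noetherian _ h1
  exact Module.Finite.iff_fg.2 (isNoetherian_submodule.1 h2 _ (lattice_le n))

theorem free_of_isTorsionFree {R M : Type} [CommRing R] [IsDomain R] [IsPrincipalIdealRing R]
    [AddCommGroup M] [Module R M] [Module.IsTorsionFree R M] (N : Submodule R M)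
    [Module.Finite R N] : Module.Free R N := inferInstance

/-! ### Cyclicity at a generic point -/

/-- A linear combination of odd lowering operators. -/
def yComb (α β : ℂ) (B : ℂ[X]) (hB : Polynomial.aeval (Polynomial.C Complex.I * Polynomial.X : ℂ[X]) B = B) :
    CG :=
  ⟨!![0, 0, 0;
      B * (Polynomial.C α * Polynomial.X + Polynomial.C β * Polynomial.X ^ 3), 0, 0;
      0, Polynomial.C Complex.I * B *
        (Polynomial.C α * Polynomial.X - Polynomial.C β * Polynomial.X ^ 3), 0], by
    have h2 : (Polynomial.C Complex.I ^ 2 : ℂ[X]) = -1 := by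
      rw [← Polynomial.C_pow, Complex.I_sq]; simp
    rw [mem_currentAlg]
    refine ⟨by simp, ?_⟩
    rintro s rfl
    simp only [Matrix.of_apply, Matrix.cons_val', Matrix.cons_val_zero, Matrix.cons_val_one,
      Matrix.cons_val, map_zero, neg_zero, and_self, and_true, true_and, map_mul, map_add, map_sub,
      map_pow, hB, Polynomial.aeval_X, Polynomial.aeval_C, Polynomial.algebraMap_eq]
    constructor
    · linear_combination (B * Polynomial.C α * Polynomial.X +
        B * Polynomial.C β * Polynomial.X ^ 3 * (1 - Polynomial.C Complex.I ^ 2)) * h2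
    · linear_combination (-B * Polynomial.C Complex.I * Polynomial.C β * Polynomial.X ^ 3) * h2⟩

/-- A polynomial in `t⁴` that vanishes at all evaluation points but one. -/
def sepPoly {n : ℕ} (i : Fin n) : ℂ[X] :=
  ∏ j ∈ Finset.univ.erase i, (Polynomial.X ^ 4 - Polynomial.C (pt j ^ 4))

theorem aeval_sepPoly {n : ℕ} (i : Fin n) :
    Polynomial.aeval (Polynomial.C Complex.I * Polynomial.X : ℂ[X]) (sepPoly i) = sepPoly i := by
  have h4 : (Polynomial.C Complex.I ^ 4 : ℂ[X]) = 1 := by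
    rw [← Polynomial.C_pow, Complex.I_pow_four, Polynomial.C_1]
  rw [sepPoly, map_prod]
  refine Finset.prod_congr rfl fun j _ => ?_
  rw [map_sub, map_pow, Polynomial.aeval_X, Polynomial.aeval_C, mul_pow, h4, one_mul]
  rfl

theorem eval_sepPoly_self {n : ℕ} (i : Fin n) : (sepPoly i).eval (pt i) ≠ 0 := by
  rw [sepPoly, Polynomial.eval_prod, Finset.prod_ne_zero_iff]
  intro j hj
  simpa [sub_eq_zero] using pt_pow_ne (Finset.ne_of_mem_erase hj).symm

theorem eval_sepPoly_of_ne {n : ℕ} {i j : Fin n} (h : j ≠ i) : (sepPoly i).eval (pt j) = 0 := by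
  rw [sepPoly, Polynomial.eval_prod]
  exact Finset.prod_eq_zero (Finset.mem_erase.2 ⟨h, Finset.mem_univ j⟩) (by simp)

/-- Specialization at `s = 1`. -/
def spec (n : ℕ) : TP n →+* MvPolynomial (Fin n × Fin 3) ℂ :=
  MvPolynomial.map (Polynomial.evalRingHom 1)

/-- The specialization of the lattice. -/
def specLattice (n : ℕ) : Submodule ℂ (MvPolynomial (Fin n × Fin 3) ℂ) where
  carrier := spec n '' lattice n
  zero_mem' := ⟨0, Submodule.zero_mem _, map_zero _⟩
  add_mem' := by
    rintro _ _ ⟨f, hf, rfl⟩ ⟨g, hg, rfl⟩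
    exact ⟨f + g, Submodule.add_mem _ hf hg, map_add _ _ _⟩
  smul_mem' := by
    rintro c _ ⟨f, hf, rfl⟩
    refine ⟨Polynomial.C c • f, Submodule.smul_mem _ _ hf, ?_⟩
    rw [MvPolynomial.smul_eq_C_mul, map_mul, spec, MvPolynomial.map_C, MvPolynomial.smul_eq_C_mul]
    simp

theorem tder_mem_specLattice {n : ℕ} (z : CG) {f : MvPolynomial (Fin n × Fin 3) ℂ}
    (hf : f ∈ specLattice n) :
    tder (fun i => z.1.map fun q => q.eval (pt i)) f ∈ specLattice n := by
  obtain ⟨f, hf, rfl⟩ := hf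
  refine ⟨evU n (toU z) f, evU_lattice _ hf, ?_⟩
  have h : (fun i : Fin n => (evMat n z i).map (Polynomial.evalRingHom (1 : ℂ))) =
      fun i => z.1.map fun q => q.eval (pt i) := by
    funext i
    ext1 j k
    rw [Matrix.map_apply, Matrix.map_apply, evMat, Matrix.map_apply, evPt,
      Polynomial.coe_evalRingHom, Polynomial.aeval_def, Polynomial.algebraMap_eq, ← Polynomial.comp,
      Polynomial.eval_comp]
    simp
  rw [evU_toU, spec, map_tder, h]

theorem tmon_update_mem_specLattice {n : ℕ} (c : Fin n → Fin 3) (i : Fin n)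
    (hc : tmon ℂ c ∈ specLattice n) {b : Fin 3} {z : CG}
    (h0 : ∀ j, j ≠ i → ∀ a b, (z.1 a b).eval (pt j) = 0)
    (h1 : (z.1 b (c i)).eval (pt i) ≠ 0) (h2 : ∀ a, a ≠ b → (z.1 a (c i)).eval (pt i) = 0) :
    tmon ℂ (Function.update c i b) ∈ specLattice n := by
  have := tder_mem_specLattice z hc
  rw [tder_tmon, Finset.sum_eq_single i, Finset.sum_eq_single b] at this
  · exact (Submodule.smul_mem_iff _ h1).1 this
  · intro a _ ha
    rw [Matrix.map_apply, h2 a ha, zero_smul]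
  · simp
  · intro j _ hj
    refine Finset.sum_eq_zero fun a _ => ?_
    rw [Matrix.map_apply, h0 j hj, zero_smul]
  · simp

/-- Cyclicity at `s = 1`: starting from the highest weight vector the factors are changed one at a
time, from `0` to `1` to `2`, by elements that vanish at all other points. -/
theorem tmon_mem_specLattice {n : ℕ} (c : Fin n → Fin 3) : tmon ℂ c ∈ specLattice n := by
  have key : ∀ s : Finset (Fin n), tmon ℂ (fun i => if i ∈ s then c i else 0) ∈ specLattice n := by
    intro s
    induction s using Finset.induction_on with
    | empty =>
      refine ⟨tvec n, ?_, ?_⟩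
      · have := evU_mem_lattice n 1
        rwa [map_one] at this
      · simp [spec, tvec, map_tmon]
    | insert i s hi ih =>
      set d : Fin n → Fin 3 := fun j => if j ∈ s then c j else 0 with hd
      have hdi : d i = 0 := by simp [hd, hi]
      have hupd : (fun j => if j ∈ insert i s then c j else 0) = Function.update d i (c i) := by
        funext j
        rcases eq_or_ne j i with rfl | hj
        · simp
        · simp [hd, hj]
      rw [hupd]
      have hp := pt_ne_zero i
      have hs := eval_sepPoly_self i
      -- With `α = a_i²` and `β = 1` the entry at `E₃₂` vanishes at `a_i` and the one at `E₂₁` does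
      -- not.
      have step1 : tmon ℂ (Function.update d i 1) ∈ specLattice n := by
        refine tmon_update_mem_specLattice d i ih
          (z := yComb (pt i ^ 2) 1 (sepPoly i) (aeval_sepPoly i)) ?_ ?_ ?_
        · intro j hj a b
          have := eval_sepPoly_of_ne hj
          fin_cases a <;> fin_cases b <;> simp [yComb, this]
        · rw [hdi]
          have : pt i ^ 2 * pt i + pt i ^ 3 ≠ 0 := by
            rw [show pt i ^ 2 * pt i + pt i ^ 3 = 2 * pt i ^ 3 by ring]
            exact mul_ne_zero two_ne_zero (pow_ne_zero _ hp)
          simpa [yComb, hs] using this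
        · rw [hdi]
          intro a ha
          fin_cases a <;> simp [yComb] at *
      -- The sign of `β` exchanges the roles of the two entries.
      have step2 : tmon ℂ (Function.update d i 2) ∈ specLattice n := by
        have := tmon_update_mem_specLattice (Function.update d i 1) i step1 (b := 2)
          (z := yComb (pt i ^ 2) (-1) (sepPoly i) (aeval_sepPoly i)) ?_ ?_ ?_
        · rwa [Function.update_idem] at this
        · intro j hj a b
          have := eval_sepPoly_of_ne hj
          fin_cases a <;> fin_cases b <;> simp [yComb, this]
        · rw [Function.update_self]
          have : pt i ^ 2 * pt i + pt i ^ 3 ≠ 0 := by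
            rw [show pt i ^ 2 * pt i + pt i ^ 3 = 2 * pt i ^ 3 by ring]
            exact mul_ne_zero two_ne_zero (pow_ne_zero _ hp)
          simpa [yComb, hs] using this
        · rw [Function.update_self]
          intro a ha
          fin_cases a <;> simp [yComb] at *
      have hci : c i = 0 ∨ c i = 1 ∨ c i = 2 := by
        generalize c i = e
        fin_cases e <;> simp
      rcases hci with h | h | h <;> rw [h]
      · rwa [Function.update_eq_self_iff.2 hdi.symm]
      · exact step1
      · exact step2
  simpa using key Finset.univ

/-- The dimension of a local Weyl module is at least `3 ^ n`. -/
theorem three_pow_le_finrank (n : ℕ) [Module.Finite ℂ (U ⧸ Submodule.span U (baseRel n))] :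
    3 ^ n ≤ Module.finrank ℂ (U ⧸ Submodule.span U (baseRel n)) := by
  -- The lattice is free over the principal ideal domain `ℂ[s]`. Its rank is bounded below at `s =
  -- 1`, and its fibre at `s = 0` is a quotient of the local Weyl module.
  have : Module.Free ℂ[X] (lattice n) := free_of_isTorsionFree _
  let b := Module.Free.chooseBasis ℂ[X] (lattice n)
  have h1 : 3 ^ n ≤ Fintype.card (Module.Free.ChooseBasisIndex ℂ[X] (lattice n)) := by
    have hle : Submodule.span ℂ (Set.range (tmon ℂ : (Fin n → Fin 3) → _)) ≤
        Submodule.span ℂ (Set.range fun k => spec n (b k)) := by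
      rw [Submodule.span_le]
      rintro _ ⟨c, rfl⟩
      obtain ⟨f, hf, hfc⟩ := tmon_mem_specLattice c
      rw [← hfc]
      have := congrArg (fun g : lattice n => spec n g) (b.sum_repr ⟨f, hf⟩)
      simp only [Submodule.coe_sum, Submodule.coe_smul, map_sum, MvPolynomial.smul_eq_C_mul,
        map_mul] at this
      rw [SetLike.mem_coe, ← this]
      refine Submodule.sum_mem _ fun k _ => ?_
      have hC : spec n (MvPolynomial.C (b.repr ⟨f, hf⟩ k)) =
          MvPolynomial.C ((b.repr ⟨f, hf⟩ k).eval 1) := by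
        rw [spec, MvPolynomial.map_C]; rfl
      rw [hC, ← MvPolynomial.smul_eq_C_mul]
      exact Submodule.smul_mem _ _ (Submodule.subset_span ⟨k, rfl⟩)
    have : Module.Finite ℂ (Submodule.span ℂ (Set.range fun k => spec n (b k))) :=
      Module.Finite.span_of_finite ℂ (Set.finite_range _)
    have h2 := Submodule.finrank_mono hle
    rw [finrank_span_eq_card linearIndependent_tmon] at h2
    have h3 := finrank_range_le_card (R := ℂ) fun k => spec n (b k)
    rw [Set.finrank] at h3
    have h4 : Fintype.card (Fin n → Fin 3) = 3 ^ n := by simp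
    omega
  refine h1.trans ?_
  -- Reduction modulo `s`, in coordinates.
  let ε : lattice n →ₗ[ℂ] (Module.Free.ChooseBasisIndex ℂ[X] (lattice n) → ℂ) :=
    { toFun := fun f k => (b.repr f k).eval 0
      map_add' := fun f g => by funext k; simp
      map_smul' := fun r f => by
        funext k
        rw [← algebraMap_smul ℂ[X] r f, map_smul]
        simp }
  have hε : ∀ (q : ℂ[X]) (f : lattice n), ε (q • f) = q.eval 0 • ε f := by
    intro q f
    funext k
    change (b.repr (q • f) k).eval 0 = q.eval 0 * (b.repr f k).eval 0
    rw [map_smul, Finsupp.smul_apply, smul_eq_mul, Polynomial.eval_mul]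
  let Λ : U →ₗ[ℂ] (Module.Free.ChooseBasisIndex ℂ[X] (lattice n) → ℂ) :=
    { toFun := fun u => ε ⟨evU n u (tvec n), evU_mem_lattice n u⟩
      map_add' := fun u w => by
        rw [← map_add]
        congr 1
        exact Subtype.ext (by simp)
      map_smul' := fun r u => by
        rw [RingHom.id_apply, ← map_smul]
        congr 1
        exact Subtype.ext (by simp) }
  -- The orbit of the highest weight vector spans the lattice over `ℂ[s]`, and modulo `s` the
  -- scalars from `ℂ[s]` become constants.
  have hΛ : Function.Surjective Λ := by
    rw [← LinearMap.range_eq_top]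
    have hmem : ∀ f : lattice n, ε f ∈ LinearMap.range Λ := by
      rintro ⟨f, hf⟩
      induction hf using Submodule.span_induction with
      | mem f hf =>
        obtain ⟨u, rfl⟩ := hf
        exact ⟨u, rfl⟩
      | zero => exact (map_zero ε).symm ▸ Submodule.zero_mem _
      | add f g hf hg h1 h2 =>
        have := Submodule.add_mem _ h1 h2
        rwa [← map_add] at this
      | smul q f hf h1 =>
        have := Submodule.smul_mem _ (q.eval 0) h1
        rwa [← hε] at this
    refine eq_top_iff.2 fun g _ => ?_
    have : g = ε (∑ k, (Polynomial.C (g k)) • b k) := by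
      rw [map_sum]
      simp only [hε, Polynomial.eval_C]
      funext k
      rw [Finset.sum_apply, Finset.sum_eq_single k]
      · change g k = g k * (b.repr (b k) k).eval 0
        simp
      · intro j _ hj
        change g j * (b.repr (b j) k).eval 0 = 0
        rw [Module.Basis.repr_self, Finsupp.single_apply, if_neg hj, Polynomial.eval_zero, mul_zero]
      · simp
    rw [this]
    exact hmem _
  have hker : ∀ u ∈ Submodule.span U (baseRel n), Λ u = 0 := by
    -- The action is linear over `ℂ[s]`, so divisibility by `s` survives a further factor `a`.
    have hX : ∀ (a u : U) (q : ℂ[X]), evU n u (tvec n) = (Polynomial.X * q) • tvec n →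
        Λ (a * u) = 0 := by
      intro a u q hu
      have : (⟨evU n (a * u) (tvec n), evU_mem_lattice n _⟩ : lattice n) =
          (Polynomial.X * q) • ⟨evU n a (tvec n), evU_mem_lattice n a⟩ := by
        refine Subtype.ext ?_
        change evU n (a * u) (tvec n) = (Polynomial.X * q) • evU n a (tvec n)
        rw [map_mul, Module.End.mul_apply, hu, map_smul]
      change ε _ = 0
      rw [this, hε]
      simp
    have key : ∀ u ∈ Submodule.span U (baseRel n), ∀ a, Λ (a * u) = 0 := by
      intro u hu
      induction hu using Submodule.span_induction with
      | mem u hu =>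
        intro a
        rcases hu with ⟨z, hz | hz, rfl⟩ | rfl | rfl
        · exact hX a _ 0 (by rw [evU_nPlus hz, mul_zero, zero_smul])
        · obtain ⟨q, hq⟩ := evU_hPlus (n := n) hz
          exact hX a _ q hq
        · refine hX a _ 0 ?_
          rw [map_sub, LinearMap.sub_apply, evU_h0, AlgHom.commutes, Module.algebraMap_end_apply,
            mul_zero, zero_smul, sub_eq_zero, ← algebraMap_smul ℂ[X] (n : ℂ), map_natCast]
        · exact hX a _ 0 (by rw [evU_yEven_pow, mul_zero, zero_smul])
      | zero => intro a; rw [mul_zero, map_zero]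
      | add u w _ _ h1 h2 => intro a; rw [mul_add, map_add, h1, h2, add_zero]
      | smul b u _ h => intro a; rw [smul_eq_mul, ← mul_assoc, h]
    intro u hu
    have := key u hu 1
    rwa [one_mul] at this
  let Q := (Submodule.span U (baseRel n)).restrictScalars ℂ
  let L : (U ⧸ Q) →ₗ[ℂ] (Module.Free.ChooseBasisIndex ℂ[X] (lattice n) → ℂ) :=
    Q.liftQ Λ fun u hu => hker u hu
  have hL : Function.Surjective L := by
    intro g
    obtain ⟨u, rfl⟩ := hΛ g
    exact ⟨Submodule.Quotient.mk u, rfl⟩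
  let e : (U ⧸ Q) ≃ₗ[ℂ] (U ⧸ Submodule.span U (baseRel n)) :=
    Submodule.Quotient.restrictScalarsEquiv ℂ (Submodule.span U (baseRel n))
  have h5 := LinearMap.finrank_range_le (L ∘ₗ e.symm.toLinearMap)
  have h6 : LinearMap.range (L ∘ₗ e.symm.toLinearMap) = ⊤ := by
    refine LinearMap.range_eq_top.2 fun g => ?_
    obtain ⟨q, rfl⟩ := hL g
    exact ⟨e q, congrArg L (e.symm_apply_apply q)⟩
  rw [h6, finrank_top, Module.finrank_fintype_fun_eq_card] at h5
  exact h5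

/-! ### Presentations by states -/

theorem span_eq_stIdeal {S : Set U} {n k i j : ℕ}
    (h : ∀ (M : Type) [AddCommGroup M] [Module U M] [Module ℂ M] [IsScalarTower ℂ U M] (v : M),
      (∀ u ∈ S, u • v = 0) ↔ St n k i j v) : Submodule.span U S = stIdeal n k i j := by
  apply le_antisymm
  · rw [Submodule.span_le]
    intro u hu
    exact (smul_mk_one_eq_zero u).1 ((h _ _).2 (st_mk_one n k i j) u hu)
  · rw [stIdeal_le_iff, ← h]
    intro u hu
    rw [smul_mk_one_eq_zero]
    exact Submodule.subset_span hu

section Module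

variable {M : Type} [AddCommGroup M] [Module U M] [Module ℂ M] [IsScalarTower ℂ U M]

theorem IsHW.trunc {n k : ℕ} {v : M} (hv : IsHW n v) (h : n ≤ k + 1) : Trunc k v :=
  ⟨fun _ _ => hv.yOdd_smul_eq_zero (by omega), fun _ _ => hv.yEven_smul_eq_zero (by omega)⟩

theorem IsHW.stt_one {p : ℕ} {v : M} (hv : IsHW (p + 1) v) : Stt 1 0 p 1 v := by
  have h : p + 1 = 0 * (1 + 1) + p * 1 + 1 := by ring
  rw [h] at hv
  exact stt_self hv (hv.trunc (by omega))

theorem IsHW.stt_zero {x : ℕ} {v : M} (hv : IsHW 0 v) : Stt x 0 0 0 v := by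
  have h : 0 = 0 * (x + 1) + 0 * x + 0 := by ring
  have hv' := hv
  rw [h] at hv'
  refine ⟨hv', hv.trunc (by omega), ?_, ?_⟩
  · simpa using hv.yEven_smul_eq_zero (k := 0) le_rfl
  · simpa using hv.yOdd_smul_eq_zero (k := 0) le_rfl

end Module

/-- The local Weyl module is itself a state, with all parts equal to one: truncation and power
relations follow from the highest weight. -/
theorem span_baseRel_succ (p : ℕ) : Submodule.span U (baseRel (p + 1)) = stI 1 0 p 1 := by
  refine span_eq_stIdeal fun M _ _ _ _ v => ?_
  rw [baseRel_iff]
  refine ⟨IsHW.stt_one, fun h => ?_⟩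
  have := h.hw
  rwa [show 0 * (1 + 1) + p * 1 + 1 = p + 1 by ring] at this

theorem span_baseRel_zero (x : ℕ) : Submodule.span U (baseRel 0) = stI x 0 0 0 := by
  refine span_eq_stIdeal fun M _ _ _ _ v => ?_
  rw [baseRel_iff]
  refine ⟨IsHW.stt_zero, fun h => ?_⟩
  have := h.hw
  rwa [show 0 * (x + 1) + 0 * x + 0 = 0 by ring] at this

theorem quo_eq {m p y : ℕ} (hy : 0 < y) (hym : y ≤ m) : quo m (p * m + y) = p + 1 := by
  rw [quo]
  apply Nat.div_eq_of_lt_le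
  · rw [add_mul]; omega
  · rw [add_mul, add_mul]; omega

theorem rmd_eq {m p y : ℕ} (hy : 0 < y) (hym : y ≤ m) : rmd m (p * m + y) = y := by
  rw [rmd, quo_eq hy hym, add_mul]
  omega

/-- For `y = m` the power relations are absent from the definition and for `m = 1` the truncation
is; they hold automatically by `stt_self` and `IsHW.trunc`. -/
theorem span_demazureRel {m p y : ℕ} (hy : 0 < y) (hym : y ≤ m) :
    Submodule.span U (demazureRel m (p * m + y)) = stI m 0 p y := by
  refine span_eq_stIdeal fun M _ _ _ _ v => ?_
  have hn : p * m + y = 0 * (m + 1) + p * m + y := by ring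
  rw [demazureRel, quo_eq hy hym, rmd_eq hy hym, Nat.add_sub_cancel]
  have hk : 0 + p = p := zero_add p
  constructor
  · intro h
    have hw : IsHW (p * m + y) v := baseRel_iff.1 fun u hu => h u (Or.inl (Or.inl hu))
    have T : Trunc p v := by
      rcases Nat.lt_or_ge 1 m with hm | hm
      · exact hw.toIsPrim.trunc (h _ (Or.inl (Or.inr ⟨hm, Or.inr rfl⟩)))
          (h _ (Or.inl (Or.inr ⟨hm, Or.inl rfl⟩)))
      · obtain rfl : m = 1 := by omega
        exact hw.trunc (by omega)
    rw [hn] at hw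
    rw [← hk] at T
    rcases hym.eq_or_lt with rfl | hlt
    · exact stt_self hw T
    · refine ⟨hw, T, ?_, ?_⟩ <;> rw [hk]
      · exact h _ (Or.inr ⟨hlt, Or.inl rfl⟩)
      · exact h _ (Or.inr ⟨hlt, Or.inr rfl⟩)
  · intro h
    have hw := h.hw
    have T := h.trunc
    have he := h.even
    have ho := h.odd
    rw [← hn] at hw
    rw [hk] at T he ho
    rintro u ((hu | ⟨_, rfl | rfl⟩) | ⟨_, rfl | rfl⟩)
    · exact baseRel_iff.2 hw u hu
    · exact T.even _ (by omega)
    · exact T.odd _ (by omega)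
    · exact he
    · exact ho

/-- For `n = 0` the conventions give `n₁ = -1` and `n₀ = m`. The extra relations `y₀ v = 0` and
`y_{1/2} v = 0` hold already in the trivial module. -/
theorem span_demazureRel_zero {m : ℕ} (hm : 0 < m) :
    Submodule.span U (demazureRel m 0) = stI m 0 0 0 := by
  rw [← span_baseRel_zero m]
  have hq : quo m 0 = 0 := by
    rw [quo]
    exact Nat.div_eq_of_lt (by omega)
  have hr : rmd m 0 = m := by
    rw [rmd, hq]
    omega
  apply le_antisymm
  · rw [Submodule.span_le, demazureRel, hq, hr]
    have hw : IsHW 0 (Submodule.Quotient.mk 1 : U ⧸ Submodule.span U (baseRel 0)) :=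
      baseRel_iff.1 fun u hu => (smul_mk_one_eq_zero u).2 (Submodule.subset_span hu)
    rintro u ((hu | ⟨_, rfl | rfl⟩) | ⟨h, _⟩)
    · exact Submodule.subset_span hu
    · exact (smul_mk_one_eq_zero _).1 (hw.yEven_smul_eq_zero le_rfl)
    · exact (smul_mk_one_eq_zero _).1 (hw.yOdd_smul_eq_zero le_rfl)
    · exact absurd h (lt_irrefl m)
  · exact Submodule.span_mono fun u hu => Or.inl (Or.inl hu)

/-- Every Demazure module is attached to a state. -/
theorem exists_span_demazureRel {m : ℕ} (hm : 0 < m) (n : ℕ) :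
    ∃ p y, y ≤ m ∧ n = wt m 0 p y ∧ Submodule.span U (demazureRel m n) = stI m 0 p y ∧
      (0 < n → 0 < y) := by
  rcases Nat.eq_zero_or_pos n with rfl | hn
  · exact ⟨0, 0, by omega, by simp [wt], span_demazureRel_zero hm, by omega⟩
  · have h1 := Nat.div_add_mod (n - 1) m
    have h2 := Nat.mod_lt (n - 1) hm
    have h3 : n = (n - 1) / m * m + ((n - 1) % m + 1) := by
      rw [mul_comm]; omega
    refine ⟨(n - 1) / m, (n - 1) % m + 1, h2, ?_, ?_, fun _ => by omega⟩
    · rw [wt]; omega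
    · rw [← span_demazureRel (by omega) h2, ← h3]

theorem stI_eq_span_demazureRel {m p y : ℕ} (hm : 0 < m) (hy : y ≤ m) :
    stI m 0 p y = Submodule.span U (demazureRel m (wt m 0 p y)) := by
  rcases Nat.eq_zero_or_pos y with rfl | h
  · rcases p with _ | p
    · rw [show wt m 0 0 0 = 0 by simp [wt], span_demazureRel_zero hm]
    · rw [stI_zero, show wt m 0 (p + 1) 0 = p * m + m by rw [wt]; ring, span_demazureRel hm le_rfl]
  · rw [show wt m 0 p y = p * m + y by rw [wt]; ring, span_demazureRel h hy]

/-! ### Exactness of all states -/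

/-- The upper bound `3^(p+1)` meets the lower bound from the evaluation modules. -/
theorem isExact_one (p : ℕ) : IsExact (wt 1 0 p 1) (stI 1 0 p 1) (ch 1 0 p 1) := by
  have hs := spanned_state (a := 0) (p := p) (le_refl 1)
  refine ⟨hs, le_antisymm hs.finite.2 ?_⟩
  have hf := hs.finite.1
  rw [← span_baseRel_succ] at hf ⊢
  have := three_pow_le_finrank (p + 1)
  have h2 : chDim (ch 1 0 p 1) = 3 ^ (p + 1) := by
    have h3 : chDim (chS 2) = 3 := by
      have := two_mul_chDim_chS 2
      norm_num at this
      omega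
    rw [ch, chD, Nat.sub_self, min_eq_left (by omega), pow_zero, one_mul, map_mul, map_pow, map_sub,
      h3]
    simp [chS, pow_succ]
  rw [h2]
  exact_mod_cast this

theorem isExact_zero (x : ℕ) : IsExact (wt x 0 0 0) (stI x 0 0 0) (ch x 0 0 0) := by
  have hs := spanned_state (a := 0) (p := 0) (Nat.zero_le x)
  refine ⟨hs, le_antisymm hs.finite.2 ?_⟩
  have hf := hs.finite.1
  rw [← span_baseRel_zero] at hf ⊢
  have := three_pow_le_finrank 0
  have h2 : chDim (ch x 0 0 0) = 1 := by
    simp [ch, chD, chS]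
  rw [h2]
  exact_mod_cast this

theorem isExact_congr {x a p y : ℕ} {J : Submodule U U} {c : Ch} {n : ℕ}
    (h : IsExact n J c) (hn : n = wt x a p y) (hJ : J = stI x a p y) (hc : c = ch x a p y) :
    IsExact (wt x a p y) (stI x a p y) (ch x a p y) := by
  rwa [hn, hJ, hc] at h

/-- The quotient in each extension inherits exactness; if two odd relators are needed, this is
applied twice. -/
theorem IsExact.step {x a p y : ℕ} (hy : y + 1 ≤ x)
    (h : IsExact (wt x a (p + 1) (y + 1)) (stI x a (p + 1) (y + 1)) (ch x a (p + 1) (y + 1))) :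
    IsExact (wt x (a + 1) p y) (stI x (a + 1) p y) (ch x (a + 1) p y) := by
  have hw : wt x a (p + 1) (y + 1) = wt x (a + 1) p y := by rw [wt_eq, wt_eq]; ring
  have hs := spanned_state (x := x) (a := a + 1) (p := p) (y := y) (by omega)
  rcases lt_trichotomy (2 * (y + 1)) (x + 1) with h1 | h1 | h1
  · rw [ch_of_two_mul_le (Nat.lt_succ_iff.1 h1)] at h
    have he := ext_of_two_mul_le (a := a) (p := p) (Nat.lt_succ_iff.1 h1)
    rw [hw] at h he
    exact h.of_ext he (spanned_state (by omega)) hs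
  · rw [ch_of_two_mul_eq h1] at h
    have he := ext_of_two_mul_eq (a := a) (p := p) h1
    rw [hw] at h he
    exact h.of_ext he (spanned_state (by omega)) hs
  · rw [ch_of_lt_two_mul (by omega) hy] at h
    have he := ext_of_lt_two_mul (a := a) (p := p) (x := x) (y := y) (by omega) hy
    have he' := ext_of_lt_two_mul' (a := a) (p := p) (x := x) (y := y) (by omega) hy
    rw [hw] at h he he'
    have hs' := spanned_state (x := x) (a := a + 1) (p := p) (y := x - (y + 1)) (by omega)
    exact (h.of_ext he (spanned_state (by omega)) (he'.spanned hs' hs)).of_ext he' hs' hs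

theorem IsExact.step_succ {x a y : ℕ} (hy : y ≤ x)
    (h : IsExact (wt x a 0 y) (stI x a 0 y) (ch x a 0 y)) :
    IsExact (wt (x + 1) 0 a y) (stI (x + 1) 0 a y) (ch (x + 1) 0 a y) := by
  have hw : wt x a 0 y = wt (x + 1) 0 a y := by rw [wt_eq, wt_eq]; ring
  rcases Nat.lt_or_ge x (2 * y) with h1 | h1
  · rw [ch_succ_of_lt h1 hy] at h
    have he := ext_succ (a := a) h1 hy
    rw [hw] at h he
    exact h.of_ext he (spanned_state (by omega)) (spanned_state (by omega))
  · rwa [ch_succ_of_le h1, stI_succ_of_le h1, hw] at h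

/-- The extensions are read backwards from the local Weyl modules at `x = 1`, `a = 0`: `(x, a+1, p,
y)` is a quotient of `(x, a, p+1, y+1)`, and `(x+1, 0, p, y)` of `(x, p, 0, y)`. A full last part,
for which there is no room, is first traded for an empty one. -/
theorem isExact_state (x : ℕ) (hx : 0 < x) : ∀ a p y : ℕ, y ≤ x →
    IsExact (wt x a p y) (stI x a p y) (ch x a p y) := by
  have zero_of : ∀ x a p, IsExact (wt x a (p + 1) 0) (stI x a (p + 1) 0) (ch x a (p + 1) 0) →
      IsExact (wt x a p x) (stI x a p x) (ch x a p x) := by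
    intro x a p h
    refine isExact_congr h ?_ (stI_zero x a p) (ch_zero x a p)
    rw [wt_eq, wt_eq]; ring
  have of_zero : ∀ x a p, IsExact (wt x a p x) (stI x a p x) (ch x a p x) →
      IsExact (wt x a (p + 1) 0) (stI x a (p + 1) 0) (ch x a (p + 1) 0) := by
    intro x a p h
    refine isExact_congr h ?_ (stI_zero x a p).symm (ch_zero x a p).symm
    rw [wt_eq, wt_eq]; ring
  induction x, hx using Nat.le_induction with
  | base =>
    intro a
    induction a with
    | zero =>
      intro p y hy
      rcases y with _ | y
      · rcases p with _ | p
        · exact isExact_zero _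
        · exact of_zero _ _ _ (isExact_one p)
      · obtain rfl : y = 0 := by simpa using hy
        exact isExact_one p
    | succ a ih =>
      intro p y hy
      rcases hy.eq_or_lt with rfl | hy
      · exact zero_of _ _ _ ((ih (p + 2) 1 le_rfl).step le_rfl)
      · exact (ih (p + 1) (y + 1) hy).step hy
  | succ x hx ihx =>
    intro a
    induction a with
    | zero =>
      intro p y hy
      rcases hy.eq_or_lt with rfl | hy
      · exact zero_of _ _ _ ((ihx (p + 1) 0 0 (Nat.zero_le x)).step_succ (Nat.zero_le x))
      · exact (ihx p 0 y (by omega)).step_succ (by omega)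
    | succ a ih =>
      intro p y hy
      rcases hy.eq_or_lt with rfl | hy
      · exact zero_of _ _ _ ((ih (p + 2) 1 (by omega)).step (by omega))
      · exact (ih (p + 1) (y + 1) hy).step hy

/-! ### Strict decrease of dimensions -/

/-- The dimension of the module attached to a state. -/
def stDim (x a p y : ℕ) : ℤ := chDim (ch x a p y)

theorem stDim_zero (x a p : ℕ) : stDim x a (p + 1) 0 = stDim x a p x := by
  rw [stDim, ch_zero, stDim]

theorem stDim_step {x a p y : ℕ} (hy : y + 1 ≤ x) :
    stDim x (a + 1) p y < stDim x a (p + 1) (y + 1) := by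
  rw [stDim, stDim]
  rcases lt_trichotomy (2 * (y + 1)) (x + 1) with h1 | h1 | h1
  · rw [ch_of_two_mul_le (Nat.lt_succ_iff.1 h1), map_add]
    linarith [chDim_ch_pos x a p (x - (y + 1))]
  · rw [ch_of_two_mul_eq h1, map_add]
    linarith [chDim_ch_pos x a (p + 1) (x - (y + 1))]
  · rw [ch_of_lt_two_mul (by omega) hy, map_add, map_add]
    linarith [chDim_ch_pos x a (p + 1) (x - (y + 1)), chDim_ch_pos x (a + 1) p (x - (y + 1))]

theorem stDim_succ_of_lt {x a y : ℕ} (h : x + 1 ≤ 2 * y) (hy : y ≤ x) :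
    stDim (x + 1) 0 a y < stDim x a 0 y := by
  rw [stDim, stDim, ch_succ_of_lt h hy, map_add]
  linarith [chDim_ch_pos (x + 1) 0 a (x - y)]

theorem stDim_succ_le {x a y : ℕ} (hy : y ≤ x) : stDim (x + 1) 0 a y ≤ stDim x a 0 y := by
  rcases Nat.lt_or_ge x (2 * y) with h | h
  · exact (stDim_succ_of_lt h hy).le
  · rw [stDim, stDim, ch_succ_of_le h]

/-- Among the states of a given weight, the dimension decreases with `x`, and with `a`. -/
theorem stDim_le {m p' y' : ℕ} (hm : 0 < m) (hy' : y' ≤ m) (x : ℕ) (hx : m ≤ x) :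
    ∀ a p y : ℕ, y ≤ x → wt x a p y = wt m 0 p' y' →
      stDim x a p y ≤ stDim m 0 p' y' ∧ (0 < a → stDim x a p y < stDim m 0 p' y') := by
  -- The equation `n = pm + y` with `0 ≤ y ≤ m` leaves only the ambiguity between `y = m` and `y =
  -- 0`, and there the dimensions agree.
  have base : ∀ p y, y ≤ m → wt m 0 p y = wt m 0 p' y' → stDim m 0 p y ≤ stDim m 0 p' y' := by
    intro p y hy h
    rw [wt_eq, wt_eq, zero_add, zero_add, add_zero, add_zero] at h
    rcases lt_trichotomy p p' with hp | rfl | hp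
    · have h1 : p * m + m ≤ p' * m := by nlinarith
      obtain rfl : y = m := by omega
      obtain rfl : y' = 0 := by omega
      obtain rfl : p' = p + 1 := by
        have : p' * y = (p + 1) * y := by rw [add_mul]; omega
        exact Nat.eq_of_mul_eq_mul_right hm this
      rw [stDim_zero]
    · obtain rfl : y = y' := by omega
      exact le_rfl
    · have h1 : p' * m + m ≤ p * m := by nlinarith
      obtain rfl : y' = m := by omega
      obtain rfl : y = 0 := by omega
      obtain rfl : p = p' + 1 := by
        have : p * y' = (p' + 1) * y' := by rw [add_mul]; omega
        exact Nat.eq_of_mul_eq_mul_right hm this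
      rw [stDim_zero]
  have succ_case : ∀ x, 0 < x → ∀ a, (∀ p y : ℕ, y ≤ x → wt x a p y = wt m 0 p' y' →
      stDim x a p y ≤ stDim m 0 p' y') → ∀ p y : ℕ, y ≤ x → wt x (a + 1) p y = wt m 0 p' y' →
      stDim x (a + 1) p y < stDim m 0 p' y' := by
    intro x hx a ih p y hy h
    rcases hy.eq_or_lt with rfl | hy
    · rw [← stDim_zero]
      refine (stDim_step (Nat.succ_le_of_lt hx)).trans_le (ih _ _ (by omega) ?_)
      rw [← h, wt_eq, wt_eq]; ring
    · refine (stDim_step hy).trans_le (ih _ _ hy ?_)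
      rw [← h, wt_eq, wt_eq]; ring
  induction x, hx using Nat.le_induction with
  | base =>
    intro a
    induction a with
    | zero => intro p y hy h; exact ⟨base p y hy h, fun h => absurd h (lt_irrefl 0)⟩
    | succ a ih =>
      intro p y hy h
      have := succ_case m hm a (fun p y hy h => (ih p y hy h).1) p y hy h
      exact ⟨this.le, fun _ => this⟩
  | succ x hx ihx =>
    intro a
    induction a with
    | zero =>
      intro p y hy h
      refine ⟨?_, fun h => absurd h (lt_irrefl 0)⟩
      rcases hy.eq_or_lt with rfl | hy
      · rw [← stDim_zero]
        refine (stDim_succ_le (Nat.zero_le x)).trans (ihx _ _ _ (Nat.zero_le x) ?_).1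
        rw [← h, wt_eq, wt_eq]; ring
      · refine (stDim_succ_le (by omega)).trans (ihx _ _ _ (by omega) ?_).1
        rw [← h, wt_eq, wt_eq]; ring
    | succ a ih =>
      intro p y hy h
      have := succ_case (x + 1) (by omega) a (fun p y hy h => (ih p y hy h).1) p y hy h
      exact ⟨this.le, fun _ => this⟩

/-- One level lower the partition reads `(x-1, p, 0, y)`. For `p > 0` the strict case of `stDim_le`
applies to it; for `p = 0` the extension `ext_succ` is proper because `x ≤ 2y`. If `p = 0` and `2y <
x` the two levels give the same module, so the hypothesis is needed. -/
theorem stDim_lt_of_two_mul {m p' y' : ℕ} (hm : 0 < m) (hy' : y' ≤ m) {x p y : ℕ} (hx : m < x)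
    (hy : y ≤ x) (h : wt x 0 p y = wt m 0 p' y') (hp : 0 < p ∨ x ≤ 2 * y) :
    stDim x 0 p y < stDim m 0 p' y' := by
  obtain ⟨x, rfl⟩ : ∃ z, x = z + 1 := ⟨x - 1, by omega⟩
  rcases hy.eq_or_lt with rfl | hy
  · rw [← stDim_zero]
    refine (stDim_succ_le (Nat.zero_le x)).trans_lt ((stDim_le hm hy' x (by omega) _ _ _
      (Nat.zero_le x) ?_).2 (Nat.succ_pos p))
    rw [← h, wt_eq, wt_eq]; ring
  · have hw : wt x p 0 y = wt m 0 p' y' := by rw [← h, wt_eq, wt_eq]; ring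
    have h1 := stDim_le hm hy' x (by omega) p 0 y (by omega) hw
    rcases Nat.eq_zero_or_pos p with rfl | hp0
    · exact (stDim_succ_of_lt (by omega) (by omega)).trans_le h1.1
    · exact (stDim_succ_le (by omega)).trans_lt (h1.2 hp0)

/-! ### The grading of cyclic modules -/

/-- The substitution `A(t) ↦ A(2t)`. -/
def scaleAlg : ℂ[X] →ₐ[ℂ] ℂ[X] := Polynomial.aeval (Polynomial.C 2 * Polynomial.X)

/-- The automorphism `A(t) ↦ A(2t)` of `𝔠𝔤`. -/
def scaleCG : CG →ₗ⁅ℂ⁆ CG where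
  toFun z := ⟨z.1.map scaleAlg, by
    have hc : ∀ q : ℂ[X],
        Polynomial.aeval (R := ℂ) (Polynomial.C Complex.I * Polynomial.X : ℂ[X]) (scaleAlg q) =
        scaleAlg (Polynomial.aeval (Polynomial.C Complex.I * Polynomial.X : ℂ[X]) q) := by
      intro q
      rw [← AlgHom.comp_apply, ← AlgHom.comp_apply]
      congr 1
      apply Polynomial.algHom_ext
      rw [AlgHom.comp_apply, AlgHom.comp_apply, scaleAlg, Polynomial.aeval_X, Polynomial.aeval_X,
        map_mul, map_mul, Polynomial.aeval_X, Polynomial.aeval_X, Polynomial.aeval_C,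
        Polynomial.aeval_C, Polynomial.algebraMap_eq]
      ring
    have hz := mem_currentAlg.1 z.2
    rw [mem_currentAlg]
    refine ⟨?_, ?_⟩
    · simp only [Matrix.map_apply]
      rw [← map_add, ← map_add, hz.1, map_zero]
    · rintro s rfl
      obtain ⟨h1, h2, h3, h4, h5, h6, h7, h8, h9⟩ := hz.2 _ rfl
      simp only [Matrix.map_apply, hc, ← map_neg scaleAlg]
      exact ⟨congrArg scaleAlg h1, congrArg scaleAlg h2, congrArg scaleAlg h3,
        congrArg scaleAlg h4, congrArg scaleAlg h5, congrArg scaleAlg h6, congrArg scaleAlg h7,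
        congrArg scaleAlg h8, congrArg scaleAlg h9⟩⟩
  map_add' a b := Subtype.ext (Matrix.map_add _ (map_add _) _ _)
  map_smul' c a := Subtype.ext (by
    ext1 j k
    change scaleAlg ((c • a.1) j k) = (c • a.1.map scaleAlg) j k
    rw [Matrix.smul_apply, map_smul, Matrix.smul_apply, Matrix.map_apply])
  map_lie' {a b} := Subtype.ext (by
    change (⁅a, b⁆ : CG).1.map scaleAlg = _
    rw [lie_val, lie_val, Matrix.map_sub _ (map_sub _), Matrix.map_mul, Matrix.map_mul])

/-- The automorphism of `U` induced by `A(t) ↦ A(2t)`. -/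
def scaleU : U →ₐ[ℂ] U :=
  UniversalEnvelopingAlgebra.lift ℂ ((UniversalEnvelopingAlgebra.ι ℂ).comp scaleCG)

theorem scaleU_toU (z : CG) : scaleU (toU z) = toU (scaleCG z) := by
  rw [scaleU, toU, UniversalEnvelopingAlgebra.lift_ι_apply]
  rfl

theorem coeff_scaleAlg (q : ℂ[X]) (k : ℕ) : (scaleAlg q).coeff k = 2 ^ k * q.coeff k := by
  induction q using Polynomial.induction_on' with
  | add p q hp hq => rw [map_add, Polynomial.coeff_add, hp, hq, Polynomial.coeff_add, mul_add]
  | monomial n a =>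
    rw [scaleAlg, Polynomial.aeval_monomial, Polynomial.algebraMap_eq, mul_pow, ← Polynomial.C_pow,
      ← mul_assoc, ← Polynomial.C_mul, Polynomial.coeff_C_mul_X_pow, Polynomial.coeff_monomial]
    split_ifs with h1 h2 h2
    · rw [h1]; ring
    · exact absurd h1.symm h2
    · exact absurd h2.symm h1
    · rw [mul_zero]

theorem scaleCG_of_mem {d : ℕ} {z : CG} (hz : z ∈ CGdeg d) : scaleCG z = (2 ^ d : ℂ) • z := by
  refine Subtype.ext ?_
  ext j k l
  change (scaleAlg (z.1 j k)).coeff l = (((2 : ℂ) ^ d • z.1) j k).coeff l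
  rw [coeff_scaleAlg, Matrix.smul_apply, Polynomial.coeff_smul, smul_eq_mul]
  rcases eq_or_ne l d with rfl | h
  · rfl
  · rw [hz j k l h, mul_zero, mul_zero]

theorem scaleU_of_mem {k : ℤ} {u : U} (hu : u ∈ Udeg k) : scaleU u = (2 : ℂ) ^ k • u := by
  induction hu using Submodule.span_induction with
  | mem u hu =>
    obtain ⟨l, hl, rfl, rfl⟩ := hu
    rw [zpow_natCast]
    induction l with
    | nil => simp
    | cons a l ih =>
      rw [List.map_cons, List.prod_cons, map_mul, ih fun b hb => hl b (List.mem_cons_of_mem _ hb),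
        scaleU_toU, scaleCG_of_mem (hl a List.mem_cons_self), toU_smul, List.map_cons, List.sum_cons,
        smul_mul_smul_comm, pow_add]
  | zero => rw [map_zero, smul_zero]
  | add a b _ _ ha hb => rw [map_add, ha, hb, smul_add]
  | smul c a _ ha => rw [map_smul, ha, smul_comm]

theorem scaleU_mem_span {S : Set U} (h : ∀ u ∈ S, scaleU u ∈ Submodule.span U S) {u : U}
    (hu : u ∈ Submodule.span U S) : scaleU u ∈ Submodule.span U S := by
  induction hu using Submodule.span_induction with
  | mem u hu => exact h u hu
  | zero => rw [map_zero]; exact Submodule.zero_mem _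
  | add a b _ _ ha hb => rw [map_add]; exact Submodule.add_mem _ ha hb
  | smul a u _ hu => rw [smul_eq_mul, map_mul]; exact Submodule.smul_mem _ _ hu

/-- The relators are homogeneous or form families stable under `A(t) ↦ A(2t)`. -/
theorem scaleU_mem_stIdeal {n k i j : ℕ} {u : U} (hu : u ∈ stIdeal n k i j) :
    scaleU u ∈ stIdeal n k i j := by
  have hdeg : ∀ {d : ℤ} {u : U}, u ∈ Udeg d → u ∈ stRel n k i j → scaleU u ∈
      Submodule.span U (stRel n k i j) := by
    intro d u hd hu
    rw [scaleU_of_mem hd, ← algebraMap_smul U]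
    exact Submodule.smul_mem _ _ (Submodule.subset_span hu)
  refine scaleU_mem_span (fun u hu => ?_) hu
  have hu' := hu
  rcases hu with (⟨z, hz, rfl⟩ | rfl | rfl) | rfl | rfl | rfl | rfl
  · rw [scaleU_toU]
    refine Submodule.subset_span (Or.inl (Or.inl ⟨_, ?_, rfl⟩))
    rcases hz with hz | hz
    · left
      intro a b hab
      change scaleAlg (z.1 a b) = 0
      rw [hz a b hab, map_zero]
    · right
      refine ⟨fun a b hab => ?_, fun a => ?_⟩
      · change scaleAlg (z.1 a b) = 0
        rw [hz.1 a b hab, map_zero]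
      · change (scaleAlg (z.1 a a)).coeff 0 = 0
        rw [coeff_scaleAlg, hz.2 a, mul_zero]
  · have hh : h0 ∈ CGdeg 0 := by
      intro a b l hl
      fin_cases a <;> fin_cases b <;> simp [h0, Polynomial.coeff_one, hl]
    rw [map_sub, scaleU_toU, scaleCG_of_mem hh, pow_zero, one_smul, AlgHom.commutes]
    exact Submodule.subset_span hu'
  · exact hdeg (pow_mem_Udeg (toU_mem_Udeg (yEven_mem_CGdeg 0)) _) hu'
  · exact hdeg (toU_mem_Udeg (yEven_mem_CGdeg _)) hu'
  · exact hdeg (toU_mem_Udeg (yOdd_mem_CGdeg _)) hu'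
  · exact hdeg (pow_mem_Udeg (toU_mem_Udeg (yEven_mem_CGdeg _)) _) hu'
  · exact hdeg (pow_mem_Udeg (toU_mem_Udeg (yOdd_mem_CGdeg _)) _) hu'

section Module

variable {M : Type} [AddCommGroup M] [Module U M] [Module ℂ M] [IsScalarTower ℂ U M]

/-- The action on a vector. -/
def actOn (v : M) : U →ₗ[ℂ] M := (LinearMap.toSpanSingleton U M v).restrictScalars ℂ

theorem actOn_apply (v : M) (u : U) : actOn v u = u • v := rfl

/-- The grading of a cyclic module for which the generator has degree zero. -/
def cycDeg (v : M) (k : ℤ) : Submodule ℂ M := (Udeg k).map (actOn v)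

theorem mem_cycDeg {v m : M} {k : ℤ} : m ∈ cycDeg v k ↔ ∃ u ∈ Udeg k, u • v = m := Iff.rfl

/-- The substitution `A(t) ↦ A(2t)` descends to the cyclic module and acts on the component of
degree `k` by `2^k`. Eigenspaces for distinct eigenvalues are independent. -/
theorem iSupIndep_cycDeg {n k i j : ℕ} {v : M} (hv : ∀ m, ∃ u : U, u • v = m)
    (hJ : ∀ u : U, u • v = 0 ↔ u ∈ stIdeal n k i j) : iSupIndep (cycDeg v) := by
  have hsurj : LinearMap.range (actOn v) = ⊤ := LinearMap.range_eq_top.2 hv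
  -- A linear section of the orbit map defines the descended operator; stability of the ideal makes
  -- the choice immaterial.
  obtain ⟨g, hg⟩ := (actOn v).exists_rightInverse_of_surjective hsurj
  let S : Module.End ℂ M := actOn v ∘ₗ scaleU.toLinearMap ∘ₗ g
  have hS : ∀ u : U, S (u • v) = scaleU u • v := by
    intro u
    change scaleU (g (u • v)) • v = scaleU u • v
    rw [← sub_eq_zero, ← sub_smul, ← map_sub, hJ]
    refine scaleU_mem_stIdeal ((hJ _).1 ?_)
    have := LinearMap.congr_fun hg (u • v)
    change g (u • v) • v = u • v at this
    rw [sub_smul, this, sub_self]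
  have hle : ∀ k, cycDeg v k ≤ S.eigenspace ((2 : ℂ) ^ k) := by
    rintro k m ⟨u, hu, rfl⟩
    rw [Module.End.mem_eigenspace_iff, actOn_apply, hS, scaleU_of_mem hu, smul_assoc]
  have hinj : Function.Injective fun k : ℤ => (2 : ℂ) ^ k := by
    intro a b h
    have h' : (2 : ℝ) ^ a = (2 : ℝ) ^ b := by
      have : (((2 : ℝ) ^ a : ℝ) : ℂ) = (((2 : ℝ) ^ b : ℝ) : ℂ) := by push_cast; exact h
      exact_mod_cast this
    exact zpow_right_injective₀ (by norm_num) (by norm_num) h'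
  exact ((Module.End.eigenspaces_iSupIndep S).comp hinj).mono hle

end Module

theorem xEven_mem_CGdeg (k : ℕ) : xEven k ∈ CGdeg (4 * k) := by
  intro i j l hl
  fin_cases i <;> fin_cases j <;> simp [xEven, Polynomial.coeff_X_pow, hl]

theorem xOdd_mem_CGdeg (k : ℕ) : xOdd k ∈ CGdeg (2 * k + 1) := by
  intro i j l hl
  have h : (Polynomial.C (Complex.I ^ (2 * k + 1)) * Polynomial.X ^ (2 * k + 1) :
      Polynomial ℂ).coeff l = 0 := by
    rw [Polynomial.coeff_C_mul_X_pow, if_neg hl]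
  fin_cases i <;> fin_cases j <;> simp [xOdd, Polynomial.coeff_X_pow, hl] <;> simpa using h

theorem hDiag_mem_CGdeg (k : ℕ) : hDiag k ∈ CGdeg (2 * k) := by
  intro i j l hl
  have h : ∀ c : ℂ, (Polynomial.C c * Polynomial.X ^ (2 * k) : Polynomial ℂ).coeff l = 0 := by
    intro c
    rw [Polynomial.coeff_C_mul_X_pow, if_neg hl]
  have h1 : (Polynomial.X ^ (2 * k) : Polynomial ℂ).coeff l = 0 := by
    rw [Polynomial.coeff_X_pow, if_neg hl]
  fin_cases i <;> fin_cases j <;> first | exact Polynomial.coeff_zero l | exact h1 | exact h _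

theorem iSup_Udeg : ⨆ k, Udeg k = ⊤ := by
  let S : Subalgebra ℂ U :=
    { carrier := {u | u ∈ ⨆ k, Udeg k}
      mul_mem' := fun {a b} ha hb => by
        change a * b ∈ ⨆ k, Udeg k
        induction ha using Submodule.iSup_induction' with
        | mem i x hx =>
          induction hb using Submodule.iSup_induction' with
          | mem j y hy => exact Submodule.mem_iSup_of_mem (i + j) (mul_mem_Udeg hx hy)
          | zero => rw [mul_zero]; exact Submodule.zero_mem _
          | add y z _ _ h1 h2 => rw [mul_add]; exact Submodule.add_mem _ h1 h2
        | zero => rw [zero_mul]; exact Submodule.zero_mem _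
        | add y z _ _ h1 h2 => rw [add_mul]; exact Submodule.add_mem _ h1 h2
      add_mem' := fun {a b} ha hb => (⨆ k, Udeg k).add_mem (x := a) (y := b) ha hb
      algebraMap_mem' := fun r => by
        change algebraMap ℂ U r ∈ ⨆ k, Udeg k
        rw [Algebra.algebraMap_eq_smul_one]
        exact Submodule.smul_mem _ _ (Submodule.mem_iSup_of_mem 0 one_mem_Udeg) }
  have hS : S = ⊤ := by
    refine subalgebra_eq_top S fun z => ?_
    let P : Submodule ℂ CG := (⨆ k, Udeg k).comap (UniversalEnvelopingAlgebra.ι ℂ : CG →ₗ⁅ℂ⁆ U).toLinearMap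
    have hP : ∀ {d : ℕ} {z : CG}, z ∈ CGdeg d → z ∈ P := fun {d z} hz =>
      Submodule.mem_iSup_of_mem (d : ℤ) (toU_mem_Udeg hz)
    exact mem_of_basis P (fun k => hP (xOdd_mem_CGdeg k)) (fun k => hP (xEven_mem_CGdeg k))
      (fun k => hP (hDiag_mem_CGdeg k)) (fun k => hP (yOdd_mem_CGdeg k))
      (fun k => hP (yEven_mem_CGdeg k)) z
  refine eq_top_iff.2 fun u _ => ?_
  have : u ∈ S := by rw [hS]; trivial
  exact this

/-! ### Demazure flags from exact filtrations -/

theorem mem_of_iSupIndep {M : Type} [AddCommGroup M] [Module ℂ M] {gr P : ℤ → Submodule ℂ M}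
    (hgr : iSupIndep gr) (hP : ∀ k, P k ≤ gr k) {k : ℤ} {x : M} (hx : x ∈ gr k)
    (hx' : x ∈ ⨆ j, P j) : x ∈ P k := by
  have hle : ⨆ j, P j ≤ P k ⊔ ⨆ (j) (_ : j ≠ k), P j := by
    refine iSup_le fun j => ?_
    rcases eq_or_ne j k with rfl | h
    · exact le_sup_left
    · exact (le_iSup₂ (f := fun j (_ : j ≠ k) => P j) j h).trans le_sup_right
  obtain ⟨a, ha, b, hb, rfl⟩ := Submodule.mem_sup.1 (hle hx')
  have h1 : b ∈ gr k := by
    have := (gr k).sub_mem hx (hP k ha)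
    rwa [add_sub_cancel_left] at this
  have h2 : b ∈ ⨆ (j) (_ : j ≠ k), gr j := (iSup₂_mono fun j _ => hP j) hb
  have h3 := (Submodule.disjoint_def.1 (hgr k)) b h1 h2
  rwa [h3, add_zero]

section Module

variable {M : Type} [AddCommGroup M] [Module U M] [Module ℂ M] [IsScalarTower ℂ U M]

/-- A grading of a module, compatible with the grading of `U`. -/
structure IsGrading (gr : ℤ → Submodule ℂ M) : Prop where
  indep : iSupIndep gr
  smul_mem : ∀ {j k : ℤ} {u : U} {m : M}, u ∈ Udeg j → m ∈ gr k → u • m ∈ gr (j + k)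

/-- A step of a Demazure flag. -/
def FlagStep (gr : ℤ → Submodule ℂ M) (m : ℕ) (N' N : Submodule U M) : Prop :=
  IsGradedSub gr N ∧ N' ≤ N ∧
    ∃ (n s : ℕ) (e : (N ⧸ N'.submoduleOf N) ≃ₗ[U] D m n),
      ∀ k : ℤ, (subquoDeg gr N' N k).map (e.toLinearMap.restrictScalars ℂ) = Ddeg m n (k - s)

theorem smul_mem_iSup {P : ℤ → Submodule ℂ M} {w : M} (h : ∀ k, ∀ u ∈ Udeg k, u • w ∈ ⨆ j, P j)
    (u : U) : u • w ∈ ⨆ j, P j := by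
  have hu : u ∈ ⨆ k, Udeg k := by rw [iSup_Udeg]; trivial
  induction hu using Submodule.iSup_induction' with
  | mem i x hx => exact h i x hx
  | zero => rw [zero_smul]; exact Submodule.zero_mem _
  | add x y _ _ hx hy => rw [add_smul]; exact Submodule.add_mem _ hx hy

theorem IsGrading.mem_iSup_of_mem_sup {gr : ℤ → Submodule ℂ M} {N' : Submodule U M}
    (hN : IsGradedSub gr N') {w : M} {s : ℕ} {x : M}
    (hx : x ∈ N' ⊔ Submodule.span U {w}) :
    x ∈ ⨆ k, ((N'.restrictScalars ℂ ⊓ gr k) ⊔ (Udeg (k - s)).map (actOn w)) := by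
  obtain ⟨a, ha, b, hb, rfl⟩ := Submodule.mem_sup.1 hx
  obtain ⟨u, rfl⟩ := Submodule.mem_span_singleton.1 hb
  refine Submodule.add_mem _ ?_ ?_
  · have ha' : a ∈ N'.restrictScalars ℂ := ha
    rw [hN] at ha'
    exact (iSup_mono fun k => le_sup_left : (⨆ k, N'.restrictScalars ℂ ⊓ gr k) ≤ _) ha'
  · refine smul_mem_iSup (fun k u hu => ?_) u
    refine Submodule.mem_iSup_of_mem (k + s) (Submodule.mem_sup_right ⟨u, ?_, rfl⟩)
    rwa [add_sub_cancel_right]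

theorem IsGrading.piece_le {gr : ℤ → Submodule ℂ M} (hgr : IsGrading gr) {N' : Submodule U M}
    {w : M} {s : ℕ} (hw : w ∈ gr s) (k : ℤ) :
    (N'.restrictScalars ℂ ⊓ gr k) ⊔ (Udeg (k - s)).map (actOn w) ≤
      (N' ⊔ Submodule.span U {w}).restrictScalars ℂ ⊓ gr k := by
  refine sup_le (inf_le_inf_right _ fun x hx => Submodule.mem_sup_left hx) ?_
  rintro _ ⟨u, hu, rfl⟩
  refine ⟨Submodule.mem_sup_right (Submodule.mem_span_singleton.2 ⟨u, rfl⟩), ?_⟩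
  have := hgr.smul_mem hu hw
  rwa [sub_add_cancel] at this

theorem IsGrading.isGradedSub_sup {gr : ℤ → Submodule ℂ M} (hgr : IsGrading gr) {N' : Submodule U M}
    (hN : IsGradedSub gr N') {w : M} {s : ℕ} (hw : w ∈ gr s) :
    IsGradedSub gr (N' ⊔ Submodule.span U {w}) := by
  apply le_antisymm
  · intro x hx
    exact iSup_mono (hgr.piece_le hw) (IsGrading.mem_iSup_of_mem_sup (s := s) hN hx)
  · exact iSup_le fun k => inf_le_left

/-- The hypothesis identifies the annihilator of the class of `w` modulo `N'` with the ideal of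
`D(m,n)`. Independence of the grading shows that a vector of degree `k` in `N' + U w` is a vector of
`N'` plus `u w` with `u` of degree `k - s`. -/
theorem IsGrading.flagStep {gr : ℤ → Submodule ℂ M} (hgr : IsGrading gr) {N' : Submodule U M}
    (hN : IsGradedSub gr N') {w : M} {s : ℕ} (hw : w ∈ gr s) {m n : ℕ}
    (hJ : ∀ u : U, u • w ∈ N' ↔ u ∈ Submodule.span U (demazureRel m n)) :
    FlagStep gr m N' (N' ⊔ Submodule.span U {w}) := by
  refine ⟨hgr.isGradedSub_sup hN hw, le_sup_left, n, s, ?_⟩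
  set N := N' ⊔ Submodule.span U {w} with hNdef
  have hwN : w ∈ N := Submodule.mem_sup_right (Submodule.mem_span_singleton_self w)
  let φ : U →ₗ[U] (N ⧸ N'.submoduleOf N) :=
    LinearMap.toSpanSingleton U _ (Submodule.Quotient.mk ⟨w, hwN⟩)
  have hφ : ∀ u : U, φ u = Submodule.Quotient.mk ⟨u • w, N.smul_mem u hwN⟩ := fun u => rfl
  have hker : LinearMap.ker φ = Submodule.span U (demazureRel m n) := by
    ext u
    rw [LinearMap.mem_ker, hφ, Submodule.Quotient.mk_eq_zero, ← hJ]
    rfl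
  have hdecomp : ∀ (a : M) (ha : a ∈ N') (u : U) (h : a + u • w ∈ N),
      (Submodule.Quotient.mk ⟨a + u • w, h⟩ : N ⧸ N'.submoduleOf N) = φ u := by
    intro a ha u h
    rw [hφ, Submodule.Quotient.eq]
    change a + u • w - u • w ∈ N'
    rwa [add_sub_cancel_right]
  have hsurj : Function.Surjective φ := by
    intro z
    obtain ⟨⟨x, hx⟩, rfl⟩ := Submodule.Quotient.mk_surjective _ z
    obtain ⟨a, ha, b, hb, rfl⟩ := Submodule.mem_sup.1 hx
    obtain ⟨u, rfl⟩ := Submodule.mem_span_singleton.1 hb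
    exact ⟨u, (hdecomp a ha u hx).symm⟩
  let e : (N ⧸ N'.submoduleOf N) ≃ₗ[U] D m n :=
    ((Submodule.quotEquivOfEq _ _ hker).symm.trans
      (φ.quotKerEquivOfSurjective hsurj)).symm
  have he : ∀ u, e (φ u) = Submodule.Quotient.mk u := by
    intro u
    rw [LinearEquiv.symm_apply_eq]
    rfl
  refine ⟨e, fun k => ?_⟩
  apply le_antisymm
  · rintro _ ⟨_, ⟨⟨x, hxN⟩, hx, rfl⟩, rfl⟩
    have hx : x ∈ gr k := hx
    have hmem := mem_of_iSupIndep hgr.indep (fun k => (hgr.piece_le hw k).trans inf_le_right) hx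
      (IsGrading.mem_iSup_of_mem_sup (s := s) hN hxN)
    obtain ⟨a, ha, b, ⟨u, hu, rfl⟩, rfl⟩ := Submodule.mem_sup.1 hmem
    refine ⟨u, hu, ?_⟩
    change Submodule.Quotient.mk u = e (Submodule.Quotient.mk ⟨a + u • w, hxN⟩)
    rw [hdecomp a ha.1 u hxN, he]
  · rintro _ ⟨u, hu, rfl⟩
    have h1 := hgr.smul_mem hu hw
    rw [sub_add_cancel] at h1
    exact ⟨φ u, ⟨⟨u • w, N.smul_mem u hwN⟩, h1, rfl⟩, he u⟩

/-- Working relative to a submodule `N'` lets chains be concatenated: one leads from `N'` to `N' + U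
g w`, whose annihilator modulo `N'` is `J'` by `Ext.isExact`, the next on to `N' + U w`, governed by
`J₂ = J + U g`. -/
theorem Flt.exists_flag {gr : ℤ → Submodule ℂ M} (hgr : IsGrading gr) {m : ℕ} (hm : 0 < m) {n : ℕ}
    {J : Submodule U U} {c : Ch} (h : Flt m n J c) :
    (Module.finrank ℂ (U ⧸ J) : ℤ) = chDim c → ∀ (N' : Submodule U M) (w : M) (s : ℕ),
      IsGradedSub gr N' → w ∈ gr s → (∀ u : U, u • w ∈ N' ↔ u ∈ J) →
      Relation.ReflTransGen (FlagStep gr m) N' (N' ⊔ Submodule.span U {w}) := by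
  induction h with
  | leaf p y hy =>
    intro _ N' w s hN hw hJ
    rw [stI_eq_span_demazureRel hm hy] at hJ
    exact Relation.ReflTransGen.single (hgr.flagStep hN hw hJ)
  | @ext n n' J J' J₂ g c c₂ h h' h₂ ih ih₂ =>
    intro hd N' w s hN hw hJ
    obtain ⟨e', e₂, hcolon⟩ := h.isExact h'.spanned h₂.spanned hd
    obtain ⟨t, ht⟩ := h.deg
    have hgw : g • w ∈ gr ((t + s : ℕ) : ℤ) := by
      have := hgr.smul_mem ht hw
      exact_mod_cast this
    have h1 := ih e'.2 N' (g • w) (t + s) hN hgw fun u => by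
      rw [← mul_smul, hJ, hcolon]
    have hN2 := hgr.isGradedSub_sup hN hgw
    have h2 := ih₂ e₂.2 (N' ⊔ Submodule.span U {g • w}) w s hN2 hw fun u => by
      rw [h.sup, Submodule.mem_sup, Submodule.mem_sup]
      constructor
      · rintro ⟨a, ha, b, hb, hab⟩
        obtain ⟨q, rfl⟩ := Submodule.mem_span_singleton.1 hb
        refine ⟨u - q * g, ?_, q * g, Submodule.mem_span_singleton.2 ⟨q, rfl⟩, sub_add_cancel _ _⟩
        rw [← hJ, sub_smul, mul_smul, ← hab, add_sub_cancel_right]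
        exact ha
      · rintro ⟨a, ha, b, hb, rfl⟩
        obtain ⟨q, rfl⟩ := Submodule.mem_span_singleton.1 hb
        refine ⟨a • w, (hJ a).2 ha, q • g • w, Submodule.mem_span_singleton.2 ⟨q, rfl⟩, ?_⟩
        rw [add_smul, smul_eq_mul, mul_smul]
    refine h1.trans ?_
    have hle : Submodule.span U {g • w} ≤ Submodule.span U {w} := by
      rw [Submodule.span_singleton_le_iff_mem]
      exact Submodule.smul_mem _ _ (Submodule.mem_span_singleton_self w)
    rwa [sup_assoc, sup_eq_right.2 hle] at h2

theorem isGradedSub_bot (gr : ℤ → Submodule ℂ M) : IsGradedSub gr (⊥ : Submodule U M) := by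
  rw [IsGradedSub]
  symm
  rw [eq_bot_iff.2 (iSup_le fun k => (inf_le_left :
    (⊥ : Submodule U M).restrictScalars ℂ ⊓ gr k ≤ _))]
  rfl

theorem exists_chain_of_reflTransGen {gr : ℤ → Submodule ℂ M} {m : ℕ} {A B : Submodule U M}
    (hA : IsGradedSub gr A) (h : Relation.ReflTransGen (FlagStep gr m) A B) :
    ∃ (N : ℕ) (F : ℕ → Submodule U M), F 0 = A ∧ F N = B ∧ (∀ j ≤ N, IsGradedSub gr (F j)) ∧
      ∀ j < N, FlagStep gr m (F j) (F (j + 1)) := by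
  induction h with
  | refl => exact ⟨0, fun _ => A, rfl, rfl, fun _ _ => hA, fun j hj => absurd hj (Nat.not_lt_zero j)⟩
  | @tail B C _ hBC ih =>
    obtain ⟨N, F, h0, hN, hg, hs⟩ := ih
    refine ⟨N + 1, fun j => if j ≤ N then F j else C, ?_, ?_, ?_, ?_⟩
    · simpa using h0
    · simp
    · intro j hj
      by_cases h : j ≤ N
      · simpa [h] using hg j h
      · simpa [h] using hBC.1
    · intro j hj
      rcases (Nat.lt_succ_iff.1 hj).eq_or_lt with rfl | h
      · simpa [hN] using hBC
      · have h1 : j ≤ N := h.le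
        have h2 : j + 1 ≤ N := h
        simpa [h1, h2] using hs j h

theorem hasDemazureFlag_of_reflTransGen {gr : ℤ → Submodule ℂ M} {m : ℕ}
    (h : Relation.ReflTransGen (FlagStep gr m) ⊥ ⊤) : HasDemazureFlag gr m := by
  obtain ⟨N, F, h0, hN, hg, hs⟩ := exists_chain_of_reflTransGen (isGradedSub_bot gr) h
  exact ⟨N, F, h0, hN, hg, fun j hj => (hs j hj).2⟩

theorem isGrading_cycDeg {n k i j : ℕ} {v : M} (hv : ∀ m, ∃ u : U, u • v = m)
    (hJ : ∀ u : U, u • v = 0 ↔ u ∈ stIdeal n k i j) : IsGrading (cycDeg v) := by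
  refine ⟨iSupIndep_cycDeg hv hJ, ?_⟩
  rintro a b u _ hu ⟨w, hw, rfl⟩
  exact ⟨u * w, mul_mem_Udeg hu hw, mul_smul _ _ _⟩

/-- A cyclic module attached to a state has Demazure flags of all sufficiently large levels. -/
theorem hasDemazureFlag_cycDeg {x a p y : ℕ} (hx : 0 < x) (hy : y ≤ x) {v : M}
    (hv : ∀ m, ∃ u : U, u • v = m) (hJ : ∀ u : U, u • v = 0 ↔ u ∈ stI x a p y) {m : ℕ}
    (hm : x ≤ m) (ha : 0 < a → x < m) : HasDemazureFlag (cycDeg v) m := by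
  apply hasDemazureFlag_of_reflTransGen
  have hgr := isGrading_cycDeg hv hJ
  have hflt := flt_state m _ (m - x) x a p y rfl hy (by omega) (by omega)
  have h := hflt.exists_flag hgr (by omega) (isExact_state x hx a p y hy).2 ⊥ v 0
    (isGradedSub_bot _)
    ⟨1, one_mem_Udeg, one_smul _ _⟩ hJ
  have htop : Submodule.span U {v} = ⊤ := by
    refine eq_top_iff.2 fun m _ => ?_
    obtain ⟨u, rfl⟩ := hv m
    exact Submodule.mem_span_singleton.2 ⟨u, rfl⟩
  rwa [bot_sup_eq, htop] at h

end Module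

section Module

variable {M : Type} [AddCommGroup M] [Module U M] [Module ℂ M] [IsScalarTower ℂ U M]

/-! ### Weights of highest weight modules -/

/-- The vectors obtained from `v` by applying lowering operators, with the drop in weight. -/
inductive LowWord (v : M) : ℕ → M → Prop
  | base : LowWord v 0 v
  | odd (k : ℕ) {j : ℕ} {m : M} (h : LowWord v j m) : LowWord v (j + 1) (toU (yOdd k) • m)
  | even (k : ℕ) {j : ℕ} {m : M} (h : LowWord v j m) : LowWord v (j + 2) (toU (yEven k) • m)

theorem HasWt.smul {w : ℤ} {u : U} (hu : HasWt w u) {μ : ℂ} {m : M} (hm : toU h0 • m = μ • m) :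
    toU h0 • u • m = (μ + w) • u • m := by
  rw [← mul_smul, hu, add_smul, mul_smul, hm, smul_smul_comm', smul_assoc, add_smul]

theorem LowWord.weight {v m : M} {μ : ℂ} (hv : toU h0 • v = μ • v) {j : ℕ} (h : LowWord v j m) :
    toU h0 • m = (μ - j) • m := by
  induction h with
  | base => rw [hv, Nat.cast_zero, sub_zero]
  | odd k _ ih =>
    rw [(hasWt_yOdd k).smul ih]
    congr 1
    push_cast; ring
  | even k _ ih =>
    rw [(hasWt_yEven k).smul ih]
    congr 1
    push_cast; ring

/-- An element of `𝔠𝔤` is moved through a word by commutators until it meets `v`, where basis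
elements lower, scale or kill. This much of the Poincaré–Birkhoff–Witt theorem suffices. -/
theorem IsHW.smul_mem_lowWord {n : ℕ} {v : M} (hv : IsHW n v) (u : U) :
    u • v ∈ Submodule.span ℂ {m | ∃ j, LowWord v j m} := by
  set W := Submodule.span ℂ {m : M | ∃ j, LowWord v j m}
  have hmem : ∀ {j m}, LowWord v j m → m ∈ W := fun {j m} h => Submodule.subset_span ⟨j, h⟩
  have hlow : ∀ z : CG, (∀ {j m}, LowWord v j m → toU z • m ∈ W) → ∀ m ∈ W, toU z • m ∈ W := by
    intro z hz m hm
    induction hm using Submodule.span_induction with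
    | mem m hm =>
      obtain ⟨j, hj⟩ := hm
      exact hz hj
    | zero => rw [smul_zero]; exact W.zero_mem
    | add a b _ _ ha hb => rw [smul_add]; exact W.add_mem ha hb
    | smul c a _ ha => rw [smul_smul_comm']; exact W.smul_mem c ha
  have hodd : ∀ k, ∀ m ∈ W, toU (yOdd k) • m ∈ W := fun k => hlow _ fun h => hmem (h.odd k)
  have heven : ∀ k, ∀ m ∈ W, toU (yEven k) • m ∈ W := fun k => hlow _ fun h => hmem (h.even k)
  have hword : ∀ {j m}, LowWord v j m → ∀ z : CG, toU z • m ∈ W := by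
    intro j m h
    induction h with
    | base =>
      intro z
      let S : Submodule ℂ CG :=
        { carrier := {z | toU z • v ∈ W}
          zero_mem' := by
            change toU 0 • v ∈ W
            rw [toU_zero, zero_smul]; exact W.zero_mem
          add_mem' := fun {a b} ha hb => by
            change toU (a + b) • v ∈ W
            rw [toU, map_add, add_smul]; exact W.add_mem ha hb
          smul_mem' := fun c a ha => by
            change toU (c • a) • v ∈ W
            rw [toU_smul, smul_assoc]; exact W.smul_mem c ha }
      refine mem_of_basis S (fun k => ?_) (fun k => ?_) (fun k => ?_)
        (fun k => hmem (LowWord.base.odd k)) (fun k => hmem (LowWord.base.even k)) z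
      · change toU (xOdd k) • v ∈ W
        rw [hv.xOdd]; exact W.zero_mem
      · change toU (xEven k) • v ∈ W
        rw [hv.xEven]; exact W.zero_mem
      · change toU (hDiag k) • v ∈ W
        rcases k with _ | k
        · rw [hDiag_zero, hv.weight]; exact W.smul_mem _ (hmem LowWord.base)
        · rw [hv.hDiag]; exact W.zero_mem
    | odd k _ ih =>
      intro z
      rw [toU_smul_smul]
      exact W.add_mem (hodd k _ (ih z)) (ih _)
    | even k _ ih =>
      intro z
      rw [toU_smul_smul]
      exact W.add_mem (heven k _ (ih z)) (ih _)
  exact smul_mem_of_toU_smul_mem (fun z => hlow z fun h => hword h z) u (hmem LowWord.base)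

/-- The module is spanned by words of weights `n - j` with `j ≥ 0`, and eigenspaces of `h₀` are
independent. -/
theorem IsHW.weight_le {n n' : ℕ} {v w : M} (hv : IsHW n v) (hgen : ∀ m, ∃ u : U, u • v = m)
    (hw : w ≠ 0) (hw' : toU h0 • w = (n' : ℂ) • w) : n' ≤ n := by
  let H : Module.End ℂ M :=
    { toFun := fun m => toU h0 • m
      map_add' := fun a b => smul_add _ a b
      map_smul' := fun c a => smul_smul_comm' c _ a }
  let gr : ℤ → Submodule ℂ M := fun j => H.eigenspace ((n : ℂ) - j)
  have hinj : Function.Injective fun j : ℤ => (n : ℂ) - j := by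
    intro a b h
    have : (a : ℂ) = b := by simpa using h
    exact_mod_cast this
  have hgr : iSupIndep gr := (Module.End.eigenspaces_iSupIndep H).comp hinj
  let P : ℤ → Submodule ℂ M := fun k => Submodule.span ℂ {m | ∃ j : ℕ, (j : ℤ) = k ∧ LowWord v j m}
  have hP : ∀ k, P k ≤ gr k := by
    intro k
    rw [Submodule.span_le]
    rintro m ⟨j, rfl, hm⟩
    exact Module.End.mem_eigenspace_iff.2 (by
      change toU h0 • m = _
      rw [hm.weight hv.weight]
      push_cast; rfl)
  have htop : w ∈ ⨆ k, P k := by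
    obtain ⟨u, rfl⟩ := hgen w
    refine (Submodule.span_le.2 ?_ : Submodule.span ℂ {m | ∃ j, LowWord v j m} ≤ _)
      (hv.smul_mem_lowWord u)
    rintro m ⟨j, hm⟩
    exact Submodule.mem_iSup_of_mem (j : ℤ) (Submodule.subset_span ⟨j, rfl, hm⟩)
  have hwgr : w ∈ gr ((n : ℤ) - n') := Module.End.mem_eigenspace_iff.2 (by
    change toU h0 • w = _
    rw [hw']
    congr 1
    push_cast; ring)
  have hmem := mem_of_iSupIndep hgr hP hwgr htop
  by_contra hlt
  apply hw
  have : P ((n : ℤ) - n') = ⊥ := by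
    refine Submodule.span_eq_bot.2 ?_
    rintro m ⟨j, hj, _⟩
    omega
  rwa [this, Submodule.mem_bot] at hmem

/-! ### Levels of Demazure flags -/

theorem exists_linearEquiv_of_ann {J : Submodule U U} {v : M} (hv : ∀ m, ∃ u : U, u • v = m)
    (hJ : ∀ u : U, u • v = 0 ↔ u ∈ J) :
    ∃ e : (U ⧸ J) ≃ₗ[U] M, ∀ u, e (Submodule.Quotient.mk u) = u • v := by
  have hker : LinearMap.ker (LinearMap.toSpanSingleton U M v) = J := by
    ext u
    rw [LinearMap.mem_ker, ← hJ]
    rfl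
  exact ⟨(Submodule.quotEquivOfEq _ _ hker).symm.trans
    ((LinearMap.toSpanSingleton U M v).quotKerEquivOfSurjective hv), fun u => rfl⟩

theorem finite_finrank_of_ann {x a p y : ℕ} (hx : 0 < x) (hy : y ≤ x) {v : M}
    (hv : ∀ m, ∃ u : U, u • v = m) (hJ : ∀ u : U, u • v = 0 ↔ u ∈ stI x a p y) :
    Module.Finite ℂ M ∧ (Module.finrank ℂ M : ℤ) = stDim x a p y := by
  obtain ⟨e, -⟩ := exists_linearEquiv_of_ann hv hJ
  have h := isExact_state x hx a p y hy
  have hf := h.1.finite.1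
  refine ⟨Module.Finite.equiv (e.restrictScalars ℂ), ?_⟩
  rw [← (e.restrictScalars ℂ).finrank_eq, h.2, stDim]

theorem vgen_gen (m n : ℕ) (z : D m n) : ∃ u : U, u • vgen m n = z := by
  obtain ⟨u, rfl⟩ := Submodule.Quotient.mk_surjective _ z
  exact ⟨u, smul_mk_one u⟩

theorem vgen_ann (m n : ℕ) (u : U) :
    u • vgen m n = 0 ↔ u ∈ Submodule.span U (demazureRel m n) :=
  smul_mk_one_eq_zero u

theorem vgen_isHW (m n : ℕ) : IsHW n (vgen m n) :=
  baseRel_iff.1 fun u hu => (vgen_ann m n u).2 (Submodule.subset_span (Or.inl (Or.inl hu)))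

/-- A Demazure flag of level `m` gives a Demazure module of level `m` of the same highest weight
and at most the same dimension. -/
theorem exists_stDim_le_of_flag {gr : ℤ → Submodule ℂ M} {m : ℕ} (hm : 0 < m)
    (h : HasDemazureFlag gr m) {n : ℕ} {v : M} (hv : ∀ m, ∃ u : U, u • v = m) (hv0 : v ≠ 0)
    (hn : IsHW n v) [Module.Finite ℂ M] :
    ∃ p y, y ≤ m ∧ n = wt m 0 p y ∧ stDim m 0 p y ≤ Module.finrank ℂ M := by
  obtain ⟨N, F, h0, hN, -, hs⟩ := h
  rcases N with _ | N
  · rw [h0] at hN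
    have : v ∈ (⊥ : Submodule U M) := by rw [hN]; trivial
    exact absurd ((Submodule.mem_bot U).1 this) hv0
  obtain ⟨-, n', s, e, -⟩ := hs N (Nat.lt_succ_self N)
  have htop : ∀ z : M, z ∈ F (N + 1) := fun z => by rw [hN]; trivial
  -- The top layer of the flag is a quotient of the whole module.
  let φ : M →ₗ[U] D m n' := e.toLinearMap ∘ₗ ((F N).submoduleOf (F (N + 1))).mkQ ∘ₗ
    (LinearMap.id.codRestrict (F (N + 1)) htop)
  have hφ : Function.Surjective φ := by
    intro z
    obtain ⟨⟨q, hq⟩, hqz⟩ := Submodule.Quotient.mk_surjective _ (e.symm z)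
    refine ⟨q, ?_⟩
    change e (Submodule.Quotient.mk ⟨q, htop q⟩) = z
    rw [hqz, e.apply_symm_apply]
  obtain ⟨p, y, hy, hn', hspan, -⟩ := exists_span_demazureRel hm n'
  have hD := finite_finrank_of_ann hm hy (vgen_gen m n') (fun u => by rw [vgen_ann, hspan])
  have hD1 := hD.1
  have hgen : ∀ z, ∃ u : U, u • φ v = z := by
    intro z
    obtain ⟨q, rfl⟩ := hφ z
    obtain ⟨u, rfl⟩ := hv q
    exact ⟨u, (map_smul φ u v).symm⟩
  have hvn : vgen m n' ≠ 0 := by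
    intro h0
    have : Module.finrank ℂ (D m n') = 0 := by
      rw [Module.finrank_eq_zero_iff_of_free, subsingleton_iff_forall_eq 0]
      intro z
      obtain ⟨u, rfl⟩ := vgen_gen m n' z
      rw [h0, smul_zero]
    have h1 := hD.2
    have h2 := chDim_ch_pos m 0 p y
    rw [this, stDim] at h1
    omega
  have hw : IsHW n (φ v) := by
    rw [← baseRel_iff] at hn ⊢
    intro u hu
    rw [← map_smul, hn u hu, map_zero]
  have hw0 : φ v ≠ 0 := by
    intro h0
    obtain ⟨u, hu⟩ := hgen (vgen m n')
    rw [h0, smul_zero] at hu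
    exact hvn hu.symm
  -- The image of `v` and the given generator both generate `D m n'` and are of highest weight, so
  -- each weight bounds the other.
  have h1 := (vgen_isHW m n').weight_le (vgen_gen m n') hw0 hw.weight
  have h2 := hw.weight_le hgen hvn (vgen_isHW m n').weight
  refine ⟨p, y, hy, by omega, ?_⟩
  rw [← hD.2]
  have h3 := LinearMap.finrank_range_le (φ.restrictScalars ℂ)
  have h4 : LinearMap.range (φ.restrictScalars ℂ) = ⊤ := LinearMap.range_eq_top.2 hφ
  rw [h4, finrank_top] at h3
  exact_mod_cast h3

end Module

/-! ### The modules of partitions -/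

/-- Translation to states: `x = ξ (ℓ - 1)`, `a = ℓ - 1 - p`, `y = ξ ℓ`. For `ℓ = 1` this makes `x =
ξ 0`, with no parts in between. -/
theorem IsPart.data {ℓ p : ℕ} {ξ : ℕ → ℕ} (h : IsPart ℓ p ξ) :
    ℓ = ℓ - 1 - p + p + 1 ∧ 0 < ξ (ℓ - 1) ∧ ξ ℓ ≤ ξ (ℓ - 1) ∧
      size ℓ ξ = wt (ξ (ℓ - 1)) (ℓ - 1 - p) p (ξ ℓ) ∧ (0 < ℓ - 1 - p → ξ 1 = ξ (ℓ - 1) + 1) ∧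
      (ℓ - 1 - p = 0 → 1 < ℓ → ξ 1 = ξ (ℓ - 1)) := by
  have hr := h.range_p
  have hle : ξ ℓ ≤ ξ (ℓ - 1) := h.anti (Nat.sub_le _ _)
  have hpos := h.pos
  obtain ⟨x, hx1, hx2⟩ := h.form
  have hℓ : ℓ = ℓ - 1 - p + p + 1 := by omega
  have hxx : 0 < p → ξ (ℓ - 1) = x := fun hp => hx2 _ (by omega) le_rfl
  refine ⟨hℓ, by omega, hle, ?_, ?_, ?_⟩
  · obtain ⟨a, ha⟩ : ∃ a, ℓ - 1 - p = a := ⟨_, rfl⟩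
    have e : ∑ j ∈ Finset.Icc 1 ℓ, ξ j = ∑ i ∈ Finset.range (a + p + 1), ξ (1 + i) := by
      rw [show Finset.Icc 1 ℓ = Finset.Ico 1 (ℓ + 1) from rfl, Finset.sum_Ico_eq_sum_range]
      congr 2
      omega
    have e1 : ∑ i ∈ Finset.range a, ξ (1 + i) = a * (x + 1) := by
      rw [Finset.sum_congr rfl (fun i hi => hx1 (1 + i) (by omega)
        (by have := Finset.mem_range.1 hi; omega))]
      simp
    have e2 : ∑ i ∈ Finset.range p, ξ (1 + (a + i)) = p * x := by
      rw [Finset.sum_congr rfl (fun i hi => hx2 (1 + (a + i)) (by omega)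
        (by have := Finset.mem_range.1 hi; omega))]
      simp
    rw [size, wt, e, Finset.sum_range_succ, Finset.sum_range_add, e1, e2, ha,
      show 1 + (a + p) = ℓ by omega]
    rcases Nat.eq_zero_or_pos p with hp | hp
    · have ha0 : a = 0 := by omega
      simp [ha0, hp]
    · rw [hxx hp]
  · intro ha
    rw [hx1 1 le_rfl (by omega), hxx (by omega)]
  · intro ha hl
    rw [hx2 1 (by omega) (by omega), hxx (by omega)]

/-- The generator of `V(ξ)`. -/
def wgen (ℓ : ℕ) (ξ : ℕ → ℕ) : V ℓ ξ := Submodule.Quotient.mk (vgen 1 (size ℓ ξ))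

theorem wgen_gen (ℓ : ℕ) (ξ : ℕ → ℕ) (z : V ℓ ξ) : ∃ u : U, u • wgen ℓ ξ = z := by
  obtain ⟨z, rfl⟩ := Submodule.Quotient.mk_surjective _ z
  obtain ⟨u, rfl⟩ := vgen_gen _ _ z
  exact ⟨u, rfl⟩

theorem wgen_isHW (ℓ : ℕ) (ξ : ℕ → ℕ) : IsHW (size ℓ ξ) (wgen ℓ ξ) :=
  baseRel_iff.1 fun u hu => by
    rw [wgen, ← Submodule.Quotient.mk_smul, baseRel_iff.2 (vgen_isHW 1 (size ℓ ξ)) u hu]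
    rfl

theorem smul_wgen_eq_zero {ℓ : ℕ} {ξ : ℕ → ℕ} {u : U} (h : u • vgen 1 (size ℓ ξ) ∈ vRel ℓ ξ) :
    u • wgen ℓ ξ = 0 :=
  (Submodule.Quotient.mk_eq_zero _).2 (Submodule.subset_span h)

theorem divPow_smul_eq_zero_iff {M : Type} [AddCommGroup M] [Module U M] [Module ℂ M]
    [IsScalarTower ℂ U M] {z : CG} {b : ℕ} {v : M} :
    divPow z b • v = 0 ↔ toU z ^ b • v = 0 := by
  rw [divPow, smul_assoc, smul_eq_zero_iff_right]
  exact inv_ne_zero (Nat.cast_ne_zero.2 b.factorial_ne_zero)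

theorem demazureRel_one_smul {M : Type} [AddCommGroup M] [Module U M] [Module ℂ M]
    [IsScalarTower ℂ U M] {n : ℕ} (hn : 0 < n) {v : M} (hv : IsHW n v) {u : U}
    (hu : u ∈ Submodule.span U (demazureRel 1 n)) : u • v = 0 := by
  obtain ⟨n, rfl⟩ := Nat.exists_eq_succ_of_ne_zero hn.ne'
  have h := span_demazureRel (m := 1) (p := n) (y := 1) one_pos le_rfl
  rw [mul_one, ← span_baseRel_succ] at h
  rw [Nat.succ_eq_add_one, h] at hu
  exact span_smul_eq_zero (baseRel_iff.2 hv) hu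

/-- The relations omitted in the definition of `V(ξ)` are consequences: both power relations for
`ξ_ℓ = ξ_{ℓ-1}`, and the even one for `ξ_ℓ + 1 = ξ_{ℓ-1}`, where it follows from the odd one. -/
theorem IsPart.stt_wgen {ℓ p : ℕ} {ξ : ℕ → ℕ} (h : IsPart ℓ p ξ) :
    Stt (ξ (ℓ - 1)) (ℓ - 1 - p) p (ξ ℓ) (wgen ℓ ξ) := by
  obtain ⟨hℓ, hx, hy, hn, -, -⟩ := h.data
  have hw : IsHW (wt (ξ (ℓ - 1)) (ℓ - 1 - p) p (ξ ℓ)) (wgen ℓ ξ) :=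
    Eq.subst (motive := fun n => IsHW n (wgen ℓ ξ)) hn (wgen_isHW ℓ ξ)
  have hk : ℓ - 1 - p + p = ℓ - 1 := by omega
  have T : Trunc (ℓ - 1 - p + p) (wgen ℓ ξ) := by
    refine hw.toIsPrim.trunc (smul_wgen_eq_zero ?_) (smul_wgen_eq_zero ?_) <;>
      rw [← hℓ] <;> simp [vRel]
  rcases hy.eq_or_lt with e | hlt
  · rw [e] at hw ⊢
    exact stt_self hw T
  have ho : toU (yOdd (ℓ - 1 - p + p)) ^ (2 * ξ ℓ - ξ (ℓ - 1) + 1) • wgen ℓ ξ = 0 := by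
    rw [← divPow_smul_eq_zero_iff, hk]
    exact smul_wgen_eq_zero (Or.inr ⟨hlt, rfl⟩)
  refine ⟨hw, T, ?_, ho⟩
  rcases (Nat.succ_le_of_lt hlt).eq_or_lt with e | hlt'
  · refine yEven_pow_smul_eq_zero_of_state (a := ℓ - 1 - p) hw T (wt_eq _ _ _ _) (by omega) ?_ ho
    have := h.pos
    omega
  · rw [← divPow_smul_eq_zero_iff, hk]
    exact smul_wgen_eq_zero (Or.inl (Or.inr ⟨hlt', rfl⟩))

/-- As `D(1,n)` is the local Weyl module, it maps onto `U ⧸ J`. The map kills the relators of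
`V(ξ)`, so nothing outside `J` can annihilate the generator. -/
theorem IsPart.ann_wgen {ℓ p : ℕ} {ξ : ℕ → ℕ} (h : IsPart ℓ p ξ) (u : U) :
    u • wgen ℓ ξ = 0 ↔ u ∈ stI (ξ (ℓ - 1)) (ℓ - 1 - p) p (ξ ℓ) := by
  refine ⟨fun hu => ?_, stIdeal_smul_iff.2 h.stt_wgen u⟩
  obtain ⟨hℓ, hx, hy, hn, -, -⟩ := h.data
  have hk : ℓ - 1 - p + p = ℓ - 1 := by omega
  have hpos : 0 < size ℓ ξ := by
    have := h.pos
    rw [hn, wt]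
    omega
  set J := stI (ξ (ℓ - 1)) (ℓ - 1 - p) p (ξ ℓ) with hJ
  have hS : Stt (ξ (ℓ - 1)) (ℓ - 1 - p) p (ξ ℓ) (Submodule.Quotient.mk 1 : U ⧸ J) := st_mk_one _ _ _ _
  have hw : IsHW (size ℓ ξ) (Submodule.Quotient.mk 1 : U ⧸ J) := by
    rw [hn]
    exact hS.hw
  let φ : D 1 (size ℓ ξ) →ₗ[U] U ⧸ J :=
    (Submodule.span U (demazureRel 1 (size ℓ ξ))).liftQ
      (LinearMap.toSpanSingleton U _ (Submodule.Quotient.mk 1)) fun u hu =>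
        demazureRel_one_smul hpos hw hu
  have hφ : ∀ u : U, φ (u • vgen 1 (size ℓ ξ)) = u • (Submodule.Quotient.mk 1 : U ⧸ J) := by
    intro u
    rw [vgen, smul_mk_one]
    rfl
  have hT := hS.trunc
  have he := hS.even
  have ho := hS.odd
  rw [hk] at hT he ho
  have hker : Submodule.span U (vRel ℓ ξ) ≤ LinearMap.ker φ := by
    rw [Submodule.span_le]
    rintro z (((rfl | rfl) | ⟨-, rfl⟩) | ⟨-, rfl⟩) <;> change φ _ = 0 <;> rw [hφ]
    · exact hT.even _ (by omega)
    · exact hT.odd _ (by omega)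
    · exact divPow_smul_eq_zero_iff.2 he
    · exact divPow_smul_eq_zero_iff.2 ho
  have h1 : (Submodule.Quotient.mk (u • vgen 1 (size ℓ ξ)) : V ℓ ξ) = 0 := hu
  rw [Submodule.Quotient.mk_eq_zero] at h1
  have h2 : φ (u • vgen 1 (size ℓ ξ)) = 0 := hker h1
  rwa [hφ, smul_mk_one_eq_zero] at h2

theorem Vdeg_eq_cycDeg (ℓ : ℕ) (ξ : ℕ → ℕ) : Vdeg ℓ ξ = cycDeg (wgen ℓ ξ) := by
  funext k
  refine Submodule.ext fun z => ?_
  rw [mem_cycDeg]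
  constructor
  · rintro ⟨_, ⟨u, hu, rfl⟩, rfl⟩
    exact ⟨u, hu, (congrArg _ (smul_mk_one u) :)⟩
  · rintro ⟨u, hu, rfl⟩
    exact ⟨_, ⟨u, hu, rfl⟩, (congrArg _ (smul_mk_one u).symm :)⟩

theorem IsPart.hasDemazureFlag {ℓ p : ℕ} {ξ : ℕ → ℕ} (h : IsPart ℓ p ξ) {m : ℕ} (hm : ξ 0 ≤ m) :
    HasDemazureFlag (Vdeg ℓ ξ) m := by
  obtain ⟨hℓ, hx, hy, hn, ha, -⟩ := h.data
  have h1 := h.anti (Nat.zero_le (ℓ - 1))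
  have h2 := h.anti (Nat.zero_le 1)
  rw [Vdeg_eq_cycDeg]
  refine hasDemazureFlag_cycDeg hx hy (wgen_gen ℓ ξ) h.ann_wgen (h1.trans hm) fun h0 => ?_
  have := ha h0
  omega

theorem IsPart.finrank_V {ℓ p : ℕ} {ξ : ℕ → ℕ} (h : IsPart ℓ p ξ) :
    Module.Finite ℂ (V ℓ ξ) ∧
      (Module.finrank ℂ (V ℓ ξ) : ℤ) = stDim (ξ (ℓ - 1)) (ℓ - 1 - p) p (ξ ℓ) :=
  finite_finrank_of_ann h.data.2.1 h.data.2.2.1 (wgen_gen ℓ ξ) h.ann_wgen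

theorem IsPart.le_of_hasDemazureFlag {ℓ p : ℕ} {ξ : ℕ → ℕ} (h : IsPart ℓ p ξ)
    (h1 : 1 < ℓ → ξ 0 = ξ 1) (h2 : ℓ = 1 → ξ 0 ≤ 2 * ξ 1) {m : ℕ} (hm : 0 < m)
    (hf : HasDemazureFlag (Vdeg ℓ ξ) m) : ξ 0 ≤ m := by
  obtain ⟨hℓ, hx, hy, hn, ha, ha'⟩ := h.data
  obtain ⟨hfin, hdim⟩ := h.finrank_V
  have hne : wgen ℓ ξ ≠ 0 := by
    intro h0
    have h3 : Module.finrank ℂ (V ℓ ξ) = 0 := by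
      rw [Module.finrank_eq_zero_iff_of_free, subsingleton_iff_forall_eq 0]
      intro z
      obtain ⟨u, rfl⟩ := wgen_gen ℓ ξ z
      rw [h0, smul_zero]
    have h4 := chDim_ch_pos (ξ (ℓ - 1)) (ℓ - 1 - p) p (ξ ℓ)
    rw [h3, stDim] at hdim
    omega
  obtain ⟨p', y', hy', hwt, hle⟩ := exists_stDim_le_of_flag hm hf (wgen_gen ℓ ξ) hne (wgen_isHW ℓ ξ)
  rw [hdim] at hle
  by_contra hlt
  rw [not_le] at hlt
  rw [hn] at hwt
  have hr := h.range_p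
  -- Without parts `x + 1` the normalization gives `m < ξ 0 = x`, together with `p > 0` or `x ≤ 2y`.
  -- With such parts `ξ 0 = x + 1`, hence only `m ≤ x`, but then `a > 0` makes the inequality of
  -- dimensions strict.
  rcases Nat.eq_zero_or_pos (ℓ - 1 - p) with h0 | h0
  · have hx0 : ξ 0 = ξ (ℓ - 1) := by
      rcases hr with ⟨rfl, -⟩ | ⟨hl, -⟩
      · rfl
      · rw [h1 hl, ha' h0 hl]
    rw [h0] at hle hwt
    refine absurd hle (not_le.2 (stDim_lt_of_two_mul hm hy' (hx0 ▸ hlt) hy hwt ?_))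
    rcases hr with ⟨rfl, -⟩ | ⟨-, hp, -⟩
    · exact Or.inr (h2 rfl)
    · exact Or.inl hp
  · have h3 := ha h0
    have h4 := h1 (by omega)
    exact absurd hle (not_le.2 ((stDim_le hm hy' _ (by omega) _ _ _ hy hwt).2 h0))

theorem chDim_chS_choose (k : ℕ) : ((chDim (chS (k + 1)) : ℤ) : ℚ) = ((k + 2).choose 2 : ℕ) := by
  have h := two_mul_chDim_chS (k + 1)
  have h' : (2 : ℚ) * (chDim (chS (k + 1)) : ℤ) = ((k + 1 : ℕ) : ℚ) * ((k + 1 : ℕ) + 1) := by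
    exact_mod_cast h
  rw [Nat.cast_choose_two]
  push_cast at *
  linarith

theorem chDim_chD {x y : ℕ} (hy : y ≤ x) :
    ((chDim (chD x y) : ℤ) : ℚ) = (y + 1 : ℚ) + ((2 * y - x : ℕ) : ℚ) * (x + 1) / 2 := by
  have h1 : (2 : ℚ) * (chDim (chS (y + 1)) : ℤ) = ((y + 1 : ℕ) : ℚ) * ((y + 1 : ℕ) + 1) := by
    exact_mod_cast two_mul_chDim_chS (y + 1)
  have h2 : (2 : ℚ) * (chDim (chS (min (x - y) y)) : ℤ) =
      ((min (x - y) y : ℕ) : ℚ) * ((min (x - y) y : ℕ) + 1) := by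
    exact_mod_cast two_mul_chDim_chS (min (x - y) y)
  rw [chD, map_sub, Int.cast_sub]
  rcases le_total (2 * y) x with h | h
  · rw [min_eq_right (by omega)] at *
    rw [Nat.sub_eq_zero_of_le h]
    push_cast at *
    linarith
  · rw [min_eq_left (by omega)] at *
    rw [Nat.cast_sub hy] at h2
    rw [Nat.cast_sub h]
    push_cast at *
    linarith

theorem IsPart.finrank_V_eq {ℓ p : ℕ} {ξ : ℕ → ℕ} (h : IsPart ℓ p ξ) :
    (Module.finrank ℂ (V ℓ ξ) : ℚ) =
      ((ξ 1 + 2).choose 2 : ℚ) ^ (ℓ - 1 - p) * ((ξ (ℓ - 1) + 2).choose 2 : ℚ) ^ p *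
        ((ξ ℓ + 1 : ℚ) + ((2 * ξ ℓ - ξ (ℓ - 1) : ℕ) : ℚ) * (ξ (ℓ - 1) + 1) / 2) := by
  obtain ⟨hℓ, hx, hy, hn, ha, -⟩ := h.data
  have h1 : (Module.finrank ℂ (V ℓ ξ) : ℚ) = ((Module.finrank ℂ (V ℓ ξ) : ℤ) : ℚ) := by norm_cast
  rw [h1, h.finrank_V.2, stDim, ch, map_mul, map_mul, map_pow, map_pow]
  push_cast
  rw [chDim_chD hy, chDim_chS_choose, chDim_chS_choose]
  congr 2
  rcases Nat.eq_zero_or_pos (ℓ - 1 - p) with h0 | h0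
  · rw [h0, pow_zero, pow_zero]
  · rw [ha h0]

/-! ### Finite-dimensional `sl₂`-modules are determined by their weights -/

section Sl2

open LieModule

variable {L : Type} [LieRing L] [LieAlgebra ℂ L] {h e f : L}

/-- The coefficients `∏ (-(i+1)(n-i))⁻¹`. -/
def strCoeff (n : ℕ) : ℕ → ℂ
  | 0 => 1
  | j + 1 => (-(((j : ℂ) + 1) * (n - j)))⁻¹ * strCoeff n j

theorem strCoeff_succ {n j : ℕ} (hj : j < n) :
    strCoeff n j = -(((j : ℂ) + 1) * (n - j)) * strCoeff n (j + 1) := by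
  rw [strCoeff, mul_inv_cancel_left₀]
  refine neg_ne_zero.2 (mul_ne_zero (Nat.cast_add_one_ne_zero j) (sub_ne_zero.2 ?_))
  exact_mod_cast hj.ne'

variable {M N K : Type} [AddCommGroup M] [Module ℂ M] [LieRingModule L M] [LieModule ℂ L M]
  [AddCommGroup N] [Module ℂ N] [LieRingModule L N] [LieModule ℂ L N]
  [AddCommGroup K] [Module ℂ K] [LieRingModule L K] [LieModule ℂ L K]

variable (e f) in
/-- The map `M → N` attached to a functional on `M` and a vector of `N`. -/
def strMap (n : ℕ) (φ : M →ₗ[ℂ] ℂ) (w : N) : M →ₗ[ℂ] N :=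
  ∑ j ∈ Finset.range (n + 1), strCoeff n j •
    ((toEnd ℂ L (M →ₗ[ℂ] ℂ) e ^ j) φ).smulRight ((toEnd ℂ L N f ^ j) w)

theorem strMap_apply (n : ℕ) (φ : M →ₗ[ℂ] ℂ) (w : N) (m : M) :
    strMap e f n φ w m = ∑ j ∈ Finset.range (n + 1),
      (strCoeff n j * ((toEnd ℂ L (M →ₗ[ℂ] ℂ) e ^ j) φ) m) • (toEnd ℂ L N f ^ j) w := by
  simp [strMap, LinearMap.sum_apply, mul_smul]

variable (t : IsSl2Triple h e f)

/-- The two sums match after a shift of the index: the rule for `e^j φ` supplies the factor that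
`strCoeff_succ` absorbs. The end terms vanish because `f φ = 0` and `f^(n+1) w = 0`. -/
theorem strMap_lie_f [Module.Finite ℂ N] {n : ℕ} {φ : M →ₗ[ℂ] ℂ} {w : N}
    (hφ : t.symm.HasPrimitiveVectorWith φ (n : ℂ)) (hw : t.HasPrimitiveVectorWith w (n : ℂ)) (m : M) :
    strMap e f n φ w ⁅f, m⁆ = ⁅f, strMap e f n φ w m⁆ := by
  rw [strMap_apply, strMap_apply, lie_sum, Finset.sum_range_succ', Finset.sum_range_succ]
  have h1 : ⁅f, (strCoeff n n * ((toEnd ℂ L (M →ₗ[ℂ] ℂ) e ^ n) φ) m) • (toEnd ℂ L N f ^ n) w⁆ = 0 := by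
    rw [lie_smul, hw.lie_f_pow_toEnd_f, hw.pow_toEnd_f_eq_zero_of_eq_nat rfl, smul_zero]
  have h2 : φ ⁅f, m⁆ = 0 := by
    have := congrArg (fun ψ : M →ₗ[ℂ] ℂ => ψ m) hφ.lie_e
    simpa using this
  rw [h1, pow_zero, Module.End.one_apply, h2, mul_zero, zero_smul, add_zero, add_zero]
  refine Finset.sum_congr rfl fun j hj => ?_
  have h3 : ((toEnd ℂ L (M →ₗ[ℂ] ℂ) e ^ (j + 1)) φ) ⁅f, m⁆ =
      -(((j + 1) * (n - j)) * ((toEnd ℂ L (M →ₗ[ℂ] ℂ) e ^ j) φ) m) := by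
    have := congrArg (fun ψ : M →ₗ[ℂ] ℂ => ψ m) (hφ.lie_e_pow_succ_toEnd_f j)
    rw [Module.Dual.lie_apply] at this
    rw [← neg_eq_iff_eq_neg, this]
    rfl
  rw [h3, lie_smul, hw.lie_f_pow_toEnd_f, strCoeff_succ (Finset.mem_range.1 hj)]
  congr 1
  ring

theorem strMap_lie_e [Module.Finite ℂ M] {n : ℕ} {φ : M →ₗ[ℂ] ℂ} {w : N}
    (hφ : t.symm.HasPrimitiveVectorWith φ (n : ℂ)) (hw : t.HasPrimitiveVectorWith w (n : ℂ)) (m : M) :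
    strMap e f n φ w ⁅e, m⁆ = ⁅e, strMap e f n φ w m⁆ := by
  have h1 : ∀ j, ((toEnd ℂ L (M →ₗ[ℂ] ℂ) e ^ j) φ) ⁅e, m⁆ =
      -((toEnd ℂ L (M →ₗ[ℂ] ℂ) e ^ (j + 1)) φ) m := by
    intro j
    rw [← hφ.lie_f_pow_toEnd_f j, Module.Dual.lie_apply, neg_neg]
  rw [strMap_apply, strMap_apply, lie_sum, Finset.sum_range_succ, Finset.sum_range_succ', h1 n,
    hφ.pow_toEnd_f_eq_zero_of_eq_nat rfl, LinearMap.zero_apply, neg_zero, mul_zero, zero_smul,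
    add_zero, pow_zero, pow_zero, Module.End.one_apply, Module.End.one_apply, lie_smul, hw.lie_e,
    smul_zero, add_zero]
  refine Finset.sum_congr rfl fun j hj => ?_
  rw [h1, lie_smul, hw.lie_e_pow_succ_toEnd_f, smul_smul, strCoeff_succ (Finset.mem_range.1 hj)]
  congr 1
  ring

theorem lie_comm_of_sl2 (hL : ∀ x : L, ∃ a b c : ℂ, x = a • e + b • f + c • h)
    (t : IsSl2Triple h e f) {g : M →ₗ[ℂ] N} (he : ∀ m, g ⁅e, m⁆ = ⁅e, g m⁆)
    (hf : ∀ m, g ⁅f, m⁆ = ⁅f, g m⁆) (x : L) (m : M) : g ⁅x, m⁆ = ⁅x, g m⁆ := by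
  obtain ⟨a, b, c, rfl⟩ := hL x
  simp only [← t.lie_e_f, add_lie, smul_lie, lie_lie, map_add, map_smul, map_sub, he, hf]

/-- As `e v = 0`, only the term with `j = 0` survives. -/
theorem strMap_self {n : ℕ} {φ : M →ₗ[ℂ] ℂ} {v : M} (hv : ⁅e, v⁆ = 0) (h1 : φ v = 1) (w : N) :
    strMap e f n φ w v = w := by
  rw [strMap_apply, Finset.sum_range_succ', Finset.sum_eq_zero, zero_add]
  · simp [h1, strCoeff]
  · intro j _
    rw [pow_succ', Module.End.mul_apply, toEnd_apply_apply, Module.Dual.lie_apply, hv]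
    simp

theorem map_strMap {n : ℕ} {φ : M →ₗ[ℂ] ℂ} {w : N} {g : N →ₗ[ℂ] K}
    (hg : ∀ m, g ⁅f, m⁆ = ⁅f, g m⁆) (m : M) :
    g (strMap e f n φ w m) = strMap e f n φ (g w) m := by
  have h1 : ∀ j, g ((toEnd ℂ L N f ^ j) w) = (toEnd ℂ L K f ^ j) (g w) := by
    intro j
    induction j with
    | zero => simp
    | succ j ih => simp [pow_succ', hg, ih]
  rw [strMap_apply, strMap_apply, map_sum]
  simp only [map_smul, h1]

/-! ### Weight spaces -/

variable (h M) in
/-- The weight spaces of integral weight. -/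
def wtSpace (k : ℤ) : Submodule ℂ M := (toEnd ℂ L M h).eigenspace (k : ℂ)

theorem mem_wtSpace {k : ℤ} {m : M} : m ∈ wtSpace h M k ↔ ⁅h, m⁆ = (k : ℂ) • m :=
  Module.End.mem_eigenspace_iff

variable (h M) in
theorem iSupIndep_wtSpace : iSupIndep (wtSpace h M) :=
  ((toEnd ℂ L M h).eigenspaces_iSupIndep).comp (Int.cast_injective (α := ℂ))

theorem lie_e_mem_wtSpace (t : IsSl2Triple h e f) {k : ℤ} {m : M} (hm : m ∈ wtSpace h M k) :
    ⁅e, m⁆ ∈ wtSpace h M (k + 2) := by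
  rw [mem_wtSpace] at *
  rw [leibniz_lie, hm, t.lie_h_e_smul ℂ, lie_smul, smul_lie, ← add_smul]
  push_cast
  rw [add_comm]

theorem lie_f_mem_wtSpace (t : IsSl2Triple h e f) {k : ℤ} {m : M} (hm : m ∈ wtSpace h M k) :
    ⁅f, m⁆ ∈ wtSpace h M (k - 2) := by
  rw [mem_wtSpace] at *
  rw [leibniz_lie, hm, t.lie_lie_smul_f ℂ, lie_smul, neg_lie, smul_lie, ← neg_smul, ← add_smul]
  push_cast
  congr 1
  ring

/-- The functional is supported on the top weight space. For `t.symm`, whose Cartan element is `-h`,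
it has weight `n` in the dual; `f` kills it because `f` reaches the weight `n` only from `n + 2`,
where there is nothing. -/
theorem exists_functional (t : IsSl2Triple h e f) (hM : ⨆ k, wtSpace h M k = ⊤) {n : ℤ} {v : M}
    (hv : v ∈ wtSpace h M n) (hv0 : v ≠ 0) (htop : ∀ k, n < k → wtSpace h M k = ⊥) :
    ∃ φ : M →ₗ[ℂ] ℂ, φ v = 1 ∧ t.symm.HasPrimitiveVectorWith φ (n : ℂ) := by
  have hnot : v ∉ ⨆ k ≠ n, wtSpace h M k := fun hv' =>
    hv0 ((Submodule.disjoint_def.1 (iSupIndep_wtSpace h M n)) v hv hv')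
  obtain ⟨ψ, hψ, hker⟩ := Submodule.exists_le_ker_of_notMem hnot
  have hext : ∀ χ : M →ₗ[ℂ] ℂ, (∀ k, ∀ m ∈ wtSpace h M k, χ m = 0) → χ = 0 := by
    intro χ hχ
    have : (⨆ k, wtSpace h M k) ≤ LinearMap.ker χ := iSup_le fun k m hm => hχ k m hm
    rw [hM] at this
    exact LinearMap.ext fun m => this trivial
  have hψ0 : ∀ k, k ≠ n → ∀ m ∈ wtSpace h M k, ψ m = 0 := fun k hk m hm =>
    hker (le_iSup₂_of_le (f := fun k (_ : k ≠ n) => wtSpace h M k) k hk le_rfl hm)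
  refine ⟨(ψ v)⁻¹ • ψ, by simp [hψ], ⟨?_, ?_, ?_⟩⟩
  · intro h0
    have := congrArg (fun χ : M →ₗ[ℂ] ℂ => χ v) h0
    simp [hψ] at this
  · rw [lie_smul, smul_comm]
    congr 1
    rw [← sub_eq_zero]
    refine hext _ fun k m hm => ?_
    rw [LinearMap.sub_apply, Module.Dual.lie_apply, neg_lie, map_neg, neg_neg, LinearMap.smul_apply,
      mem_wtSpace.1 hm, map_smul, ← sub_smul]
    by_cases hk : k = n
    · rw [hk, sub_self, zero_smul]
    · rw [hψ0 k hk m hm, smul_zero]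
  · rw [lie_smul]
    refine smul_eq_zero_of_right _ (hext _ fun k m hm => ?_)
    rw [Module.Dual.lie_apply, neg_eq_zero]
    by_cases hk : k - 2 = n
    · rw [htop k (by omega), Submodule.mem_bot] at hm
      rw [hm, lie_zero, map_zero]
    · exact hψ0 _ hk _ (lie_f_mem_wtSpace t hm)

/-- The complement `P.ker` of an idempotent endomorphism of Lie modules. -/
def kerProj (P : M →ₗ⁅ℂ,L⁆ M) (hP : ∀ m, P (P m) = P m) : M →ₗ⁅ℂ,L⁆ P.ker where
  toFun m := ⟨m - P m, by rw [LieModuleHom.mem_ker, map_sub, hP, sub_self]⟩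
  map_add' m m' := Subtype.ext (by simp; abel)
  map_smul' c m := Subtype.ext (by simp [smul_sub])
  map_lie' {x m} := Subtype.ext (by simp)

theorem kerProj_coe (P : M →ₗ⁅ℂ,L⁆ M) (hP : ∀ m, P (P m) = P m) (m : M) :
    (kerProj P hP m : M) = m - P m := rfl

theorem map_mem_wtSpace (g : M →ₗ⁅ℂ,L⁆ N) {k : ℤ} {m : M} (hm : m ∈ wtSpace h M k) :
    g m ∈ wtSpace h N k := by
  rw [mem_wtSpace] at *
  rw [← LieModuleHom.map_lie, hm, map_smul]

theorem iSup_wtSpace_ker (P : M →ₗ⁅ℂ,L⁆ M) (hP : ∀ m, P (P m) = P m)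
    (hM : ⨆ k, wtSpace h M k = ⊤) : ⨆ k, wtSpace h P.ker k = ⊤ := by
  have h1 : (⨆ k, wtSpace h M k) ≤
      (⨆ k, wtSpace h P.ker k).comap ((kerProj P hP : M →ₗ⁅ℂ,L⁆ P.ker) : M →ₗ[ℂ] P.ker) :=
    iSup_le fun k m hm => le_iSup (wtSpace h P.ker) k (map_mem_wtSpace (kerProj P hP) hm)
  rw [hM] at h1
  refine eq_top_iff.2 fun m _ => ?_
  have h2 := h1 (x := (m : M)) trivial
  have h3 : kerProj P hP (m : M) = m := Subtype.ext (by
    rw [kerProj_coe, LieModuleHom.mem_ker.1 m.2, sub_zero])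
  rw [← h3]
  exact h2

theorem finrank_wtSpace_ker [Module.Finite ℂ M] (P : M →ₗ⁅ℂ,L⁆ M) (k : ℤ) :
    Module.finrank ℂ (wtSpace h M k) = Module.finrank ℂ ((wtSpace h M k).map (P : M →ₗ[ℂ] M)) +
      Module.finrank ℂ (wtSpace h P.ker k) := by
  rw [← LinearMap.finrank_range_add_finrank_ker ((P : M →ₗ[ℂ] M).domRestrict (wtSpace h M k)),
    LinearMap.range_domRestrict]
  congr 1
  refine LinearEquiv.finrank_eq ?_
  exact
    { toFun := fun m => ⟨⟨m.1.1, LieModuleHom.mem_ker.2 m.2⟩, mem_wtSpace.2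
        (Subtype.ext (mem_wtSpace.1 m.1.2))⟩
      map_add' := fun _ _ => rfl
      map_smul' := fun _ _ => rfl
      invFun := fun m => ⟨⟨m.1.1, mem_wtSpace.2 (congrArg Subtype.val (mem_wtSpace.1 m.2))⟩,
        LieModuleHom.mem_ker.1 m.1.2⟩
      left_inv := fun _ => rfl
      right_inv := fun _ => rfl }

theorem finrank_map_wtSpace_le [Module.Finite ℂ M] {P : M →ₗ⁅ℂ,L⁆ M} {Q : N →ₗ⁅ℂ,L⁆ N}
    (A : M →ₗ⁅ℂ,L⁆ N) (B : N →ₗ⁅ℂ,L⁆ M) (hQ : ∀ m, A (B m) = Q m) (hB : ∀ m, P (B m) = B m)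
    (k : ℤ) :
    Module.finrank ℂ ((wtSpace h N k).map (Q : N →ₗ[ℂ] N)) ≤
      Module.finrank ℂ ((wtSpace h M k).map (P : M →ₗ[ℂ] M)) := by
  have h1 : (wtSpace h N k).map (Q : N →ₗ[ℂ] N) ≤
      ((wtSpace h M k).map (P : M →ₗ[ℂ] M)).map (A : M →ₗ[ℂ] N) := by
    rintro _ ⟨m, hm, rfl⟩
    exact ⟨B m, ⟨B m, map_mem_wtSpace B hm, hB m⟩, hQ m⟩
  have h2 : Module.Finite ℂ (((wtSpace h M k).map (P : M →ₗ[ℂ] M)).map (A : M →ₗ[ℂ] N)) := inferInstance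
  exact (Submodule.finrank_mono h1).trans (Submodule.finrank_map_le _ _)

/-- Gluing an isomorphism of complements. -/
theorem nonempty_equiv_of_ker {P : M →ₗ⁅ℂ,L⁆ M} {Q : N →ₗ⁅ℂ,L⁆ N} (A : M →ₗ⁅ℂ,L⁆ N)
    (B : N →ₗ⁅ℂ,L⁆ M) (hAB : ∀ m, A (B m) = Q m) (hBA : ∀ m, B (A m) = P m)
    (hA : ∀ m, Q (A m) = A m) (hB : ∀ m, P (B m) = B m) (g : P.ker ≃ₗ⁅ℂ,L⁆ Q.ker) :
    Nonempty (M ≃ₗ⁅ℂ,L⁆ N) := by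
  have hP : ∀ m, P (P m) = P m := fun m => by rw [← hBA m, hB]
  have hQ : ∀ m, Q (Q m) = Q m := fun m => by rw [← hAB m, hA]
  have hA' : ∀ m, A (P m) = A m := fun m => by rw [← hBA m, hAB, hA]
  have hB' : ∀ m, B (Q m) = B m := fun m => by rw [← hAB m, hBA, hB]
  have hA0 : ∀ m : P.ker, A m = 0 := fun m => by
    rw [← hA', LieModuleHom.mem_ker.1 m.2, map_zero]
  have hB0 : ∀ m : Q.ker, B m = 0 := fun m => by
    rw [← hB', LieModuleHom.mem_ker.1 m.2, map_zero]
  have hP0 : ∀ m : P.ker, kerProj P hP m = m := fun m => Subtype.ext (by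
    rw [kerProj_coe, LieModuleHom.mem_ker.1 m.2, sub_zero])
  have hQ0 : ∀ m : Q.ker, kerProj Q hQ m = m := fun m => Subtype.ext (by
    rw [kerProj_coe, LieModuleHom.mem_ker.1 m.2, sub_zero])
  have hPB : ∀ m, kerProj P hP (B m) = 0 := fun m => Subtype.ext (by
    rw [kerProj_coe, hB, sub_self]; rfl)
  have hQA : ∀ m, kerProj Q hQ (A m) = 0 := fun m => Subtype.ext (by
    rw [kerProj_coe, hA, sub_self]; rfl)
  let X : M →ₗ⁅ℂ,L⁆ N := A + Q.ker.incl.comp ((g : P.ker →ₗ⁅ℂ,L⁆ Q.ker).comp (kerProj P hP))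
  let Y : N →ₗ⁅ℂ,L⁆ M := B + P.ker.incl.comp ((g.symm : Q.ker →ₗ⁅ℂ,L⁆ P.ker).comp (kerProj Q hQ))
  have hX : ∀ m, X m = A m + (g (kerProj P hP m) : N) := fun m => rfl
  have hY : ∀ m, Y m = B m + (g.symm (kerProj Q hQ m) : M) := fun m => rfl
  refine ⟨{ X with invFun := Y, left_inv := fun m => ?_, right_inv := fun m => ?_ }⟩
  · change Y (X m) = m
    rw [hX, hY, map_add, map_add, hB0, hQA, hQ0, hBA, zero_add, add_zero,
      LieModuleEquiv.symm_apply_apply, kerProj_coe, add_sub_cancel]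
  · change X (Y m) = m
    rw [hY, hX, map_add, map_add, hA0, hPB, hP0, hAB, zero_add, add_zero,
      LieModuleEquiv.apply_symm_apply, kerProj_coe, add_sub_cancel]

/-- Finite-dimensional weight modules over `sl₂` with the same weight multiplicities are
isomorphic. -/
theorem nonempty_equiv_of_finrank_wtSpace (t : IsSl2Triple h e f)
    (hL : ∀ x : L, ∃ a b c : ℂ, x = a • e + b • f + c • h) (d : ℕ) :
    ∀ (M N : Type) [AddCommGroup M] [Module ℂ M] [LieRingModule L M] [LieModule ℂ L M]
      [AddCommGroup N] [Module ℂ N] [LieRingModule L N] [LieModule ℂ L N]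
      [Module.Finite ℂ M] [Module.Finite ℂ N], Module.finrank ℂ M = d →
      ⨆ k, wtSpace h M k = ⊤ → ⨆ k, wtSpace h N k = ⊤ →
      (∀ k, Module.finrank ℂ (wtSpace h M k) = Module.finrank ℂ (wtSpace h N k)) →
      Nonempty (M ≃ₗ⁅ℂ,L⁆ N) := by
  induction d using Nat.strong_induction_on with
  | _ d ih =>
  intro M N _ _ _ _ _ _ _ _ _ _ hd hM hN hMN
  have hbot : ∀ k, wtSpace h M k = ⊥ ↔ wtSpace h N k = ⊥ := fun k => by
    rw [← Submodule.finrank_eq_zero, hMN, Submodule.finrank_eq_zero]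
  by_cases hall : ∀ k, wtSpace h M k = ⊥
  · have h1 : Subsingleton M := by
      rw [← Submodule.subsingleton_iff ℂ]
      refine subsingleton_of_bot_eq_top ?_
      rw [← hM]
      simp [hall]
    have h2 : Subsingleton N := by
      rw [← Submodule.subsingleton_iff ℂ]
      refine subsingleton_of_bot_eq_top ?_
      rw [← hN]
      simp [fun k => (hbot k).1 (hall k)]
    exact ⟨{ (0 : M →ₗ⁅ℂ,L⁆ N) with
      invFun := 0
      left_inv := fun m => Subsingleton.elim _ _
      right_inv := fun m => Subsingleton.elim _ _ }⟩
  push Not at hall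
  have hfin : {k | wtSpace h M k ≠ ⊥}.Finite :=
    WellFoundedGT.finite_ne_bot_of_iSupIndep (iSupIndep_wtSpace h M)
  obtain ⟨n, hn, hmax⟩ := Set.exists_max_image _ id hfin hall
  have htop : ∀ k, n < k → wtSpace h M k = ⊥ := fun k hk => by
    by_contra hk'
    exact absurd (hmax k hk') (not_le.2 hk)
  have htop' : ∀ k, n < k → wtSpace h N k = ⊥ := fun k hk => (hbot k).1 (htop k hk)
  obtain ⟨v, hv, hv0⟩ := Submodule.exists_mem_ne_zero_of_ne_bot hn
  obtain ⟨w, hw, hw0⟩ := Submodule.exists_mem_ne_zero_of_ne_bot (fun h0 => hn ((hbot n).2 h0))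
  have pv : t.HasPrimitiveVectorWith v (n : ℂ) := ⟨hv0, mem_wtSpace.1 hv, by
    have := lie_e_mem_wtSpace t hv
    rwa [htop _ (by omega), Submodule.mem_bot] at this⟩
  have pw : t.HasPrimitiveVectorWith w (n : ℂ) := ⟨hw0, mem_wtSpace.1 hw, by
    have := lie_e_mem_wtSpace t hw
    rwa [htop' _ (by omega), Submodule.mem_bot] at this⟩
  obtain ⟨φ, hφ1, pφ⟩ := exists_functional t hM hv hv0 htop
  obtain ⟨ψ, hψ1, pψ⟩ := exists_functional t hN hw hw0 htop'
  obtain ⟨n', hn'⟩ := pv.exists_nat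
  rw [hn'] at pv pw pφ pψ
  -- `P` and `Q` project onto the strings through the highest weight vectors `v` and `w`, while `A`
  -- and `B` identify these strings. The induction applies to the complements `P.ker` and `Q.ker`.
  let P : M →ₗ⁅ℂ,L⁆ M :=
    { strMap e f n' φ v with
      map_lie' := fun {x m} => lie_comm_of_sl2 hL t (strMap_lie_e t pφ pv) (strMap_lie_f t pφ pv) x m }
  let Q : N →ₗ⁅ℂ,L⁆ N :=
    { strMap e f n' ψ w with
      map_lie' := fun {x m} => lie_comm_of_sl2 hL t (strMap_lie_e t pψ pw) (strMap_lie_f t pψ pw) x m }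
  let A : M →ₗ⁅ℂ,L⁆ N :=
    { strMap e f n' φ w with
      map_lie' := fun {x m} => lie_comm_of_sl2 hL t (strMap_lie_e t pφ pw) (strMap_lie_f t pφ pw) x m }
  let B : N →ₗ⁅ℂ,L⁆ M :=
    { strMap e f n' ψ v with
      map_lie' := fun {x m} => lie_comm_of_sl2 hL t (strMap_lie_e t pψ pv) (strMap_lie_f t pψ pv) x m }
  have hAB : ∀ m, A (B m) = Q m := fun m =>
    (map_strMap (strMap_lie_f t pφ pw) m).trans (by rw [strMap_self pv.lie_e hφ1]; rfl)
  have hBA : ∀ m, B (A m) = P m := fun m =>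
    (map_strMap (strMap_lie_f t pψ pv) m).trans (by rw [strMap_self pw.lie_e hψ1]; rfl)
  have hA : ∀ m, Q (A m) = A m := fun m =>
    (map_strMap (strMap_lie_f t pψ pw) m).trans (by rw [strMap_self pw.lie_e hψ1]; rfl)
  have hB : ∀ m, P (B m) = B m := fun m =>
    (map_strMap (strMap_lie_f t pφ pv) m).trans (by rw [strMap_self pv.lie_e hφ1]; rfl)
  have hP : ∀ m, P (P m) = P m := fun m => by rw [← hBA m, hB]
  have hQ : ∀ m, Q (Q m) = Q m := fun m => by rw [← hAB m, hA]
  have hlt : Module.finrank ℂ P.ker < d := by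
    rw [← hd]
    refine Submodule.finrank_lt (s := P.ker.toSubmodule) fun h0 => hv0 ?_
    have h1 : v ∈ P.ker.toSubmodule := by rw [h0]; trivial
    have h2 : P v = v := strMap_self pv.lie_e hφ1 v
    rw [← h2]
    exact LieModuleHom.mem_ker.1 h1
  -- The images of `P` and `Q` have equal weight multiplicities, each being bounded by the other
  -- through `A` and `B`; subtraction gives the same for the kernels.
  obtain ⟨g⟩ := ih _ hlt P.ker Q.ker rfl (iSup_wtSpace_ker P hP hM) (iSup_wtSpace_ker Q hQ hN)
    fun k => by
      have h1 := finrank_wtSpace_ker (h := h) P k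
      have h2 := finrank_wtSpace_ker (h := h) Q k
      have h3 := finrank_map_wtSpace_le (h := h) A B hAB hB k
      have h4 := finrank_map_wtSpace_le (h := h) B A hBA hA k
      have h5 := hMN k
      omega
  exact nonempty_equiv_of_ker A B hAB hBA hA hB g

end Sl2

/-! ### Characters of `sl₂`-modules -/

/-- The element `h` of `sl₂`. -/
def slH : sl2 :=
  ⟨!![1, 0; 0, -1], by
    change Matrix.trace (!![1, 0; 0, -1] : Matrix (Fin 2) (Fin 2) ℂ) = 0
    simp [Matrix.trace_fin_two]⟩

/-- The element `e` of `sl₂`. -/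
def slE : sl2 :=
  ⟨!![0, 1; 0, 0], by
    change Matrix.trace (!![0, 1; 0, 0] : Matrix (Fin 2) (Fin 2) ℂ) = 0
    simp [Matrix.trace_fin_two]⟩

/-- The element `f` of `sl₂`. -/
def slF : sl2 :=
  ⟨!![0, 0; 1, 0], by
    change Matrix.trace (!![0, 0; 1, 0] : Matrix (Fin 2) (Fin 2) ℂ) = 0
    simp [Matrix.trace_fin_two]⟩

theorem isSl2Triple_sl : IsSl2Triple slH slE slF where
  h_ne_zero h := by
    have := congrFun (congrFun (congrArg Subtype.val h) 0) 0
    simp [slH] at this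
  lie_e_f := Subtype.ext (by
    change slE.1 * slF.1 - slF.1 * slE.1 = slH.1
    ext i j
    fin_cases i <;> fin_cases j <;> simp [slE, slF, slH])
  lie_h_e_nsmul := Subtype.ext (by
    change slH.1 * slE.1 - slE.1 * slH.1 = 2 • slE.1
    ext i j
    fin_cases i <;> fin_cases j <;>
      norm_num [slE, slH, Matrix.mul_apply, Fin.sum_univ_two])
  lie_h_f_nsmul := Subtype.ext (by
    change slH.1 * slF.1 - slF.1 * slH.1 = -(2 • slF.1)
    ext i j
    fin_cases i <;> fin_cases j <;>
      norm_num [slF, slH, Matrix.mul_apply, Fin.sum_univ_two])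

theorem exists_eq_sl (x : sl2) : ∃ a b c : ℂ, x = a • slE + b • slF + c • slH := by
  have ht : x.1 0 0 + x.1 1 1 = 0 := by
    rw [← Matrix.trace_fin_two]; exact x.2
  refine ⟨x.1 0 1, x.1 1 0, x.1 0 0, Subtype.ext ?_⟩
  change x.1 = x.1 0 1 • slE.1 + x.1 1 0 • slF.1 + x.1 0 0 • slH.1
  ext i j
  fin_cases i <;> fin_cases j <;> simp [slE, slF, slH]
  linear_combination ht

theorem slIncl_slH : slIncl slH = h0 := by
  refine Subtype.ext ?_
  change corner slH.1 = h0.1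
  ext1 i j
  fin_cases i <;> fin_cases j <;> simp [corner, slH, h0]

/-- The `sl₂`-module `A` has a basis of weight vectors with character `c`. -/
def SlMod.HasChar (A : SlMod) (c : Ch) : Prop :=
  ∃ (ι : Type) (_ : Fintype ι) (b : Module.Basis ι ℂ A.carrier) (w : ι → ℤ),
    (∀ i, ⁅slH, b i⁆ = (w i : ℂ) • b i) ∧ ∑ i, LaurentPolynomial.T (w i) = c

theorem SlMod.HasChar.triv : SlMod.triv.HasChar 1 :=
  ⟨Unit, inferInstance, Module.Basis.singleton Unit ℂ, fun _ => 0, fun i => by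
    rw [Int.cast_zero]
    exact (zero_smul ℂ (Module.Basis.singleton Unit ℂ i)).symm, by simp⟩

theorem SlMod.HasChar.tensor {A B : SlMod} {c d : Ch} (hA : A.HasChar c) (hB : B.HasChar d) :
    (A.tensor B).HasChar (c * d) := by
  obtain ⟨ι, _, b, w, hw, rfl⟩ := hA
  obtain ⟨κ, _, b', w', hw', rfl⟩ := hB
  have key : ∀ i : ι × κ, ⁅slH, b.tensorProduct b' i⁆ =
      ((w i.1 + w' i.2 : ℤ) : ℂ) • b.tensorProduct b' i := by
    intro i
    rw [Module.Basis.tensorProduct_apply', TensorProduct.LieModule.lie_tmul_right, hw, hw',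
      ← TensorProduct.smul_tmul', TensorProduct.tmul_smul, ← add_smul]
    push_cast
    rfl
  refine ⟨ι × κ, inferInstance, b.tensorProduct b', fun i => w i.1 + w' i.2, key, ?_⟩
  rw [Fintype.sum_prod_type, Finset.sum_mul_sum]
  simp only [LaurentPolynomial.T_add]

theorem SlMod.HasChar.tpow {A : SlMod} {c : Ch} (hA : A.HasChar c) (k : ℕ) :
    (A.tpow k).HasChar (c ^ k) := by
  induction k with
  | zero => exact SlMod.HasChar.triv
  | succ k ih =>
    rw [pow_succ]
    exact ih.tensor hA

theorem coeff_sum_T {ι : Type} [Fintype ι] (w : ι → ℤ) (k : ℤ) :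
    (∑ i, LaurentPolynomial.T (w i) : Ch).coeff k = (Fintype.card {i // w i = k} : ℤ) := by
  rw [AddMonoidAlgebra.coeff_sum, Finsupp.finsetSum_apply, Fintype.card_subtype]
  simp [LaurentPolynomial.T_apply]

section Weights

variable {M : Type} [AddCommGroup M] [Module ℂ M] [LieRingModule sl2 M] [LieModule ℂ sl2 M]
  {ι : Type} [Fintype ι] (b : Module.Basis ι ℂ M) {w : ι → ℤ}

theorem iSup_wtSpace_of_basis (hw : ∀ i, ⁅slH, b i⁆ = (w i : ℂ) • b i) :
    ⨆ k, wtSpace slH M k = ⊤ := by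
  rw [eq_top_iff, ← b.span_eq, Submodule.span_le]
  rintro _ ⟨i, rfl⟩
  exact le_iSup (wtSpace slH M) (w i) (mem_wtSpace.2 (hw i))

theorem finrank_wtSpace_of_basis (hw : ∀ i, ⁅slH, b i⁆ = (w i : ℂ) • b i) (k : ℤ) :
    Module.finrank ℂ (wtSpace slH M k) = Fintype.card {i // w i = k} := by
  have h1 : wtSpace slH M k = Submodule.span ℂ (Set.range fun i : {i // w i = k} => b i) := by
    refine le_antisymm (fun m hm => ?_) (Submodule.span_le.2 ?_)
    · have h2 : ∀ i, w i ≠ k → b.repr m i = 0 := by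
        intro i hi
        have h3 : ⁅slH, m⁆ = ∑ j, (b.repr m j * w j) • b j := by
          conv_lhs => rw [← b.sum_repr m]
          rw [lie_sum]
          refine Finset.sum_congr rfl fun j _ => ?_
          rw [lie_smul, hw, smul_smul]
        rw [mem_wtSpace.1 hm] at h3
        have h4 := congrArg (fun z => b.repr z i) h3
        simp only [map_smul, Finsupp.smul_apply, b.repr_sum_self, smul_eq_mul] at h4
        have h5 : ((k : ℂ) - w i) * b.repr m i = 0 := by linear_combination h4
        refine (mul_eq_zero.1 h5).resolve_left (sub_ne_zero.2 ?_)
        exact_mod_cast (Ne.symm hi)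
      rw [← b.sum_repr m]
      refine Submodule.sum_mem _ fun i _ => ?_
      by_cases hi : w i = k
      · exact Submodule.smul_mem _ _ (Submodule.subset_span ⟨⟨i, hi⟩, rfl⟩)
      · rw [h2 i hi, zero_smul]
        exact Submodule.zero_mem _
    · rintro _ ⟨⟨i, rfl⟩, rfl⟩
      exact mem_wtSpace.2 (hw i)
  rw [h1]
  exact finrank_span_eq_card (b.linearIndependent.comp _ Subtype.val_injective)

end Weights

theorem SlMod.HasChar.iso {A B : SlMod} {c : Ch} (hA : A.HasChar c) (hB : B.HasChar c) :
    A.Iso B := by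
  obtain ⟨ι, _, b, w, hw, hc⟩ := hA
  obtain ⟨κ, _, b', w', hw', hc'⟩ := hB
  have : Module.Finite ℂ A.carrier := Module.Finite.of_basis b
  have : Module.Finite ℂ B.carrier := Module.Finite.of_basis b'
  refine nonempty_equiv_of_finrank_wtSpace isSl2Triple_sl exists_eq_sl _ A.carrier B.carrier rfl
    (iSup_wtSpace_of_basis b hw) (iSup_wtSpace_of_basis b' hw') fun k => ?_
  have h1 := congrArg (fun z : Ch => z.coeff k) (hc.trans hc'.symm)
  simp only [coeff_sum_T] at h1
  rw [finrank_wtSpace_of_basis b hw, finrank_wtSpace_of_basis b' hw']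
  exact_mod_cast h1

/-- By exactness the spanning family of weight vectors has as many members as the dimension, so it
is a basis. -/
theorem hasChar_of_ann {M : Type} [AddCommGroup M] [Module U M] [Module ℂ M] [IsScalarTower ℂ U M]
    {x a p y : ℕ} (hx : 0 < x) (hy : y ≤ x) {v : M} (hv : ∀ m, ∃ u : U, u • v = m)
    (hJ : ∀ u : U, u • v = 0 ↔ u ∈ stI x a p y) : (resSl M).HasChar (ch x a p y) := by
  obtain ⟨hfin, hdim⟩ := finite_finrank_of_ann hx hy hv hJ
  obtain ⟨ι, _, u, w, hw, hs, hc⟩ := spanned_state (a := a) (p := p) hy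
  have hst : Stt x a p y v := stIdeal_smul_iff.1 fun u hu => (hJ u).2 hu
  have hspan : ⊤ ≤ Submodule.span ℂ (Set.range fun i => u i • v) := by
    intro m _
    obtain ⟨z, rfl⟩ := hv m
    obtain ⟨c, hz⟩ := hs z
    rw [← hJ, sub_smul, sub_eq_zero, Finset.sum_smul] at hz
    rw [hz]
    refine Submodule.sum_mem _ fun i _ => ?_
    rw [smul_assoc]
    exact Submodule.smul_mem _ _ (Submodule.subset_span ⟨i, rfl⟩)
  have hcard : Fintype.card ι = Module.finrank ℂ M := by
    have h1 : chDim (ch x a p y) = Fintype.card ι := by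
      rw [← hc, map_sum]
      simp [chDim_T]
    rw [stDim, h1] at hdim
    exact_mod_cast hdim.symm
  have key : ∀ i, toU (slIncl slH) • basisOfTopLeSpanOfCardEqFinrank _ hspan hcard i =
      (w i : ℂ) • basisOfTopLeSpanOfCardEqFinrank _ hspan hcard i := by
    intro i
    rw [coe_basisOfTopLeSpanOfCardEqFinrank, slIncl_slH, (hw i).smul hst.hw.weight, wt]
    congr 1
    push_cast
    ring
  exact ⟨ι, inferInstance, basisOfTopLeSpanOfCardEqFinrank _ hspan hcard, w, key, hc⟩

theorem hasChar_D {m y : ℕ} (hy : 0 < y) (hym : y ≤ m) :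
    (resSl (D m y)).HasChar (chD m y) := by
  have h1 := span_demazureRel (p := 0) hy hym
  rw [zero_mul, zero_add] at h1
  have h2 := hasChar_of_ann (by omega) hym (vgen_gen m y) (a := 0) (p := 0) fun u => by
    rw [vgen_ann, h1]
  simpa [ch] using h2

theorem hasChar_D_self {m : ℕ} (hm : 0 < m) : (resSl (D m m)).HasChar (chS (m + 1)) := by
  have := hasChar_D hm le_rfl
  simpa [chD, chS] using this

theorem IsPart.iso {ℓ p : ℕ} {ξ : ℕ → ℕ} (h : IsPart ℓ p ξ) :
    (resSl (V ℓ ξ)).Iso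
      ((((resSl (D (ξ 1) (ξ 1))).tpow (ℓ - 1 - p)).tensor
        ((resSl (D (ξ (ℓ - 1)) (ξ (ℓ - 1)))).tpow p)).tensor
        (resSl (D (ξ (ℓ - 1)) (ξ ℓ)))) := by
  obtain ⟨hℓ, hx, hy, hn, ha, -⟩ := h.data
  refine (hasChar_of_ann hx hy (wgen_gen ℓ ξ) h.ann_wgen).iso ?_
  refine SlMod.HasChar.tensor (SlMod.HasChar.tensor ?_ ((hasChar_D_self hx).tpow p))
    (hasChar_D h.pos hy)
  rcases Nat.eq_zero_or_pos (ℓ - 1 - p) with h0 | h0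
  · rw [h0, pow_zero]
    exact SlMod.HasChar.triv
  · rw [ha h0]
    exact (hasChar_D_self (Nat.succ_pos _)).tpow _

end HyperspecialA22

end

open HyperspecialA22 in
theorem theorem4p3 (ℓ p : ℕ) (ξ : ℕ → ℕ) (hξ : IsPart ℓ p ξ) :
    (resSl (V ℓ ξ)).Iso
      ((((resSl (D (ξ 1) (ξ 1))).tpow (ℓ - 1 - p)).tensor
        ((resSl (D (ξ (ℓ - 1)) (ξ (ℓ - 1)))).tpow p)).tensor
        (resSl (D (ξ (ℓ - 1)) (ξ ℓ)))) ∧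
    (Module.finrank ℂ (V ℓ ξ) : ℚ) =
      ((ξ 1 + 2).choose 2 : ℚ) ^ (ℓ - 1 - p) * ((ξ (ℓ - 1) + 2).choose 2 : ℚ) ^ p *
        ((ξ ℓ + 1 : ℚ) + ((2 * ξ ℓ - ξ (ℓ - 1) : ℕ) : ℚ) * (ξ (ℓ - 1) + 1) / 2) ∧
    (∀ m : ℕ, ξ 0 ≤ m → HasDemazureFlag (Vdeg ℓ ξ) m) ∧
    ((1 < ℓ → ξ 0 = ξ 1) → (ℓ = 1 → ξ 0 ≤ 2 * ξ 1) →
      ∀ m : ℕ, 0 < m → (HasDemazureFlag (Vdeg ℓ ξ) m ↔ ξ 0 ≤ m)) := by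
  exact ⟨hξ.iso, hξ.finrank_V_eq, fun m hm => hξ.hasDemazureFlag hm, fun h1 h2 m hm =>
    ⟨hξ.le_of_hasDemazureFlag h1 h2 hm, hξ.hasDemazureFlag⟩⟩
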